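/- Conventions. For a tempered distribution $f$ on $\mathbb R^3$, $\widehat f(\xi)=\int e^{-i\xi\cdot x}f(x)\,dx$. For $a\ge 0$, $\sigma\ge 1$, $s\in\mathbb R$ let $$\mathcal X^s_{a,\sigma}=\Big\{f\in\mathcal S'(\mathbb R^3):\ \widehat f\in L^1_{\rm loc},\ \|f\|_{\mathcal X^s_{a,\sigma}}=\int_{\mathbb R^3}|\xi|^s e^{a|\xi|^{1/\sigma}}|\widehat f(\xi)|\,d\xi<\infty\Big\}$$ (scalar or vector valued, $|\cdot|$ being the Euclidean norm), and $\|(u_0,\theta_0)\|_{\mathcal X^s_{a,\sigma}}=\|u_0\|_{\mathcal X^s_{a,\sigma}}+\|\theta_0\|_{\mathcal X^s_{a,\sigma}}$. For $T>0$, $C_T(X)=C([0,T];X)$ carries the supremum norm, written $L^\infty_T(X)$, and $L^p_T(X)=L^p([0,T];X)$. A mild solution on $[0,T]$ of the fractional Boussinesq system with data $(u_0,\theta_0)$ is a pair $(u,\theta)$, with $u$ valued in $\mathbb R^3$, $\operatorname{div}u=0$, and $\theta$ valued in $\mathbb R$, such that for all $t\in[0,T]$ $$u(t)=e^{-t(-\Delta)^\alpha}u_0-\int_0^te^{-(t-\tau)(-\Delta)^\alpha}\mathbb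 P(u\cdot\nabla u)\,d\tau+\int_0^te^{-(t-\tau)(-\Delta)^\alpha}\mathbb P(\theta e_3)\,d\tau,$$ $$\theta(t)=e^{-t(-\Delta)^\beta}\theta_0-\int_0^te^{-(t-\tau)(-\Delta)^\beta}(u\cdot\nabla\theta)\,d\tau,$$ where $\mathbb P$ is the Leray projector, $e_3=(0,0,1)$, $u\cdot\nabla w=\sum_j\partial_j(u_jw)$ in the sense of distributions, and the integrals are taken in $\mathcal S'$ (tested against Schwartz functions). Theorem. Let $a\ge0$, $\sigma\ge1$, $\alpha,\beta\ge\frac12$, $q_{\alpha,\beta}=\max\{1-2\alpha,\ \alpha(1-2\beta)/\beta,\ \beta(1-2\alpha)/\alpha\}$ and $s\in[\max\{-1,q_{\alpha,\beta}\},0]$. There are constants $\varepsilon>0$ and $C_2>0$, depending only on $a,\sigma,\alpha,\beta,s$, such that for every $M\in\mathbb R$, with $M<\varepsilon$ in the case $s=q_{\alpha,\beta}$, there are $T>0$ and $C_1>0$ (depending only on $M$ and $a,\sigma,\alpha,\beta,s$) with the following property. For all real-valued data $u_0\in\mathcal X^s_{a,\sigma}$ (with values in $\mathbb R^3$, $\operatorname{div}u_0=0$)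 and $\theta_0\in\mathcal X^s_{a,\sigma}$ with $\|(u_0,\theta_0)\|_{\mathcal X^s_{a,\sigma}}\le M$ there is a unique mild solution $$(u,\theta)\in\big[C_T(\mathcal X^s_{a,\sigma})\cap L^1_T(\mathcal X^{s+2\alpha}_{a,\sigma})\big]\times\big[C_T(\mathcal X^s_{a,\sigma})\cap L^1_T(\mathcal X^{s+2\beta}_{a,\sigma})\big]$$ on $[0,T]$ with data $(u_0,\theta_0)$ such that $$\|u\|_{L^\infty_T(\mathcal X^s_{a,\sigma})}+\|u\|_{L^1_T(\mathcal X^{s+2\alpha}_{a,\sigma})}+\|\theta\|_{L^\infty_T(\mathcal X^s_{a,\sigma})}+\|\theta\|_{L^1_T(\mathcal X^{s+2\beta}_{a,\sigma})}<C_1 .$$ Moreover, the left-hand side is at most $C_2\|(u_0,\theta_0)\|_{\mathcal X^s_{a,\sigma}}$, and for every real $p\ge1$ $$(u,\theta)\in L^p_T(\mathcal X^{s+2\alpha/p}_{a,\sigma})\times L^p_T(\mathcal X^{s+2\beta/p}_{a,\sigma}).$$ -/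

import Mathlib

open MeasureTheory Set Filter Topology
open scoped SchwartzMap FourierTransform LineDeriv ENNReal ContDiff

/-- The physical (and frequency) space `ℝ³`. -/
abbrev E3 : Type := EuclideanSpace ℝ (Fin 3)

/-- `ℂ³` with its Euclidean norm, the value space of vector-valued distributions. -/
abbrev C3 : Type := EuclideanSpace ℂ (Fin 3)

section LeiLinSpaces

variable {V : Type*} [NormedAddCommGroup V] [NormedSpace ℂ V]

/-- The tempered distribution `f` has as Fourier transform the locally integrable function `g`, for
the convention `f̂(ξ) = ∫ e^{-i ξ·x} f(x) dx`. Mathlib's `𝓕` has the kernel `e^{-2π i ζ·x}`, so that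
`(𝓕 f)(ζ) = f̂(2πζ)`. The pairing with Schwartz functions is required to converge absolutely, which
is automatic as soon as `∫ |ξ|^s e^{a |ξ|^{1/σ}} |g(ξ)| dξ` is finite for some `a ≥ 0` and `s`. -/
def IsHat (f : 𝓢'(E3, V)) (g : E3 → V) : Prop :=
  LocallyIntegrable g ∧ ∀ φ : 𝓢(E3, ℂ),
    Integrable (fun ζ : E3 => φ ζ • g ((2 * Real.pi) • ζ)) ∧
      (𝓕 f) φ = ∫ ζ : E3, φ ζ • g ((2 * Real.pi) • ζ)

/-- The weight `|ξ|^s e^{a |ξ|^{1/σ}}`. -/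
noncomputable def leiLinWeight (a σ s : ℝ) (ξ : E3) : ℝ :=
  ‖ξ‖ ^ s * Real.exp (a * ‖ξ‖ ^ (1 / σ))

/-- `∫ |ξ|^s e^{a |ξ|^{1/σ}} |f̂(ξ)| dξ` if `f̂` is a locally integrable function (which is then
unique almost everywhere), and `∞` otherwise. -/
noncomputable def leiLinENorm (a σ s : ℝ) (f : 𝓢'(E3, V)) : ℝ≥0∞ :=
  ⨅ (g : E3 → V) (_ : IsHat f g), ∫⁻ ξ, ENNReal.ofReal (leiLinWeight a σ s ξ) * ‖g ξ‖ₑ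

theorem IsHat.ae_eq [CompleteSpace V] {f : 𝓢'(E3, V)} {g g' : E3 → V}
    (h : IsHat f g) (h' : IsHat f g') : g =ᵐ[volume] g' := by
  refine ae_eq_of_integral_contDiff_smul_eq h.1 h'.1 fun ψ hψ hc => ?_
  have hpi : (2 * Real.pi) ≠ 0 := by positivity
  have hc1 : HasCompactSupport (fun ζ : E3 => ((ψ ((2 * Real.pi) • ζ) : ℝ) : ℂ)) := by
    have : HasCompactSupport (fun ζ : E3 => ψ ((2 * Real.pi) • ζ)) := hc.comp_smul hpi
    exact this.comp_left (g := fun x : ℝ => (x : ℂ)) (by simp)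
  have hs1 : ContDiff ℝ ∞ (fun ζ : E3 => ((ψ ((2 * Real.pi) • ζ) : ℝ) : ℂ)) := by
    have : ContDiff ℝ ∞ (Complex.ofRealCLM ∘ fun ζ : E3 => ψ ((2 * Real.pi) • ζ)) := by fun_prop
    exact this
  have key : ∀ k : E3 → V,
      ∫ ζ : E3, (hc1.toSchwartzMap hs1) ζ • k ((2 * Real.pi) • ζ)
        = |((2 * Real.pi) ^ Module.finrank ℝ E3)⁻¹| • ∫ ξ, ψ ξ • k ξ := by
    intro k
    rw [← Measure.integral_comp_smul volume (fun ξ => ψ ξ • k ξ) (2 * Real.pi)]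
    refine integral_congr_ae (Eventually.of_forall fun ζ => ?_)
    simp
  have e := ((h.2 (hc1.toSchwartzMap hs1)).2).symm.trans (h'.2 (hc1.toSchwartzMap hs1)).2
  rw [key g, key g'] at e
  refine (smul_right_injective V ?_) e
  positivity

theorem leiLinENorm_eq [CompleteSpace V] (a σ s : ℝ) {f : 𝓢'(E3, V)} {g : E3 → V}
    (h : IsHat f g) :
    leiLinENorm a σ s f = ∫⁻ ξ, ENNReal.ofReal (leiLinWeight a σ s ξ) * ‖g ξ‖ₑ := by
  apply le_antisymm
  · exact iInf₂_le g h
  · refine le_iInf₂ fun g' h' => le_of_eq (lintegral_congr_ae ?_)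
    filter_upwards [h.ae_eq h'] with ξ hξ
    rw [hξ]

theorem exists_isHat_of_leiLinENorm_lt_top {a σ s : ℝ} {f : 𝓢'(E3, V)}
    (h : leiLinENorm a σ s f < ⊤) : ∃ g, IsHat f g := by
  by_contra hne
  push Not at hne
  simp [leiLinENorm, hne] at h

theorem IsHat.add {f₁ f₂ : 𝓢'(E3, V)} {g₁ g₂ : E3 → V} (h₁ : IsHat f₁ g₁) (h₂ : IsHat f₂ g₂) :
    IsHat (f₁ + f₂) (g₁ + g₂) := by
  refine ⟨h₁.1.add h₂.1, fun φ => ⟨?_, ?_⟩⟩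
  · refine ((h₁.2 φ).1.add (h₂.2 φ).1).congr (Eventually.of_forall fun ζ => ?_)
    simp [smul_add]
  · have e₁ := (h₁.2 φ).2
    have e₂ := (h₂.2 φ).2
    simp only [TemperedDistribution.fourier_apply] at e₁ e₂
    simp only [TemperedDistribution.fourier_apply, Pi.add_apply, smul_add]
    rw [integral_add (h₁.2 φ).1 (h₂.2 φ).1, ← e₁, ← e₂]
    rfl

theorem IsHat.smul {f : 𝓢'(E3, V)} {g : E3 → V} (c : ℂ) (h : IsHat f g) :
    IsHat (c • f) (c • g) := by
  refine ⟨h.1.smul c, fun φ => ⟨?_, ?_⟩⟩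
  · have := (h.2 φ).1.smul c
    refine this.congr (Eventually.of_forall fun ζ => ?_)
    simp [smul_comm c]
  · have e := (h.2 φ).2
    simp only [TemperedDistribution.fourier_apply] at e
    simp only [TemperedDistribution.fourier_apply, Pi.smul_apply, smul_comm _ c]
    rw [integral_smul, ← e]
    rfl

theorem isHat_zero : IsHat (0 : 𝓢'(E3, V)) 0 := by
  refine ⟨locallyIntegrable_zero, fun φ => ⟨by simp, ?_⟩⟩
  simp only [TemperedDistribution.fourier_apply, Pi.zero_apply, smul_zero, integral_zero]
  rfl

theorem measurable_leiLinWeight (a σ s : ℝ) : Measurable (leiLinWeight a σ s) := by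
  unfold leiLinWeight
  fun_prop

theorem leiLinENorm_add_le [CompleteSpace V] (a σ s : ℝ) (f₁ f₂ : 𝓢'(E3, V)) :
    leiLinENorm a σ s (f₁ + f₂) ≤ leiLinENorm a σ s f₁ + leiLinENorm a σ s f₂ := by
  by_cases t₁ : leiLinENorm a σ s f₁ < ⊤
  swap
  · simp [not_lt_top_iff.mp t₁]
  by_cases t₂ : leiLinENorm a σ s f₂ < ⊤
  swap
  · simp [not_lt_top_iff.mp t₂]
  obtain ⟨g₁, h₁⟩ := exists_isHat_of_leiLinENorm_lt_top t₁
  obtain ⟨g₂, h₂⟩ := exists_isHat_of_leiLinENorm_lt_top t₂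
  rw [leiLinENorm_eq a σ s h₁, leiLinENorm_eq a σ s h₂, leiLinENorm_eq a σ s (h₁.add h₂),
    ← lintegral_add_left']
  · refine lintegral_mono fun ξ => ?_
    rw [← mul_add]
    gcongr
    exact enorm_add_le _ _
  · exact (measurable_leiLinWeight a σ s).ennreal_ofReal.aemeasurable.mul
      h₁.1.aestronglyMeasurable.enorm

theorem leiLinENorm_smul [CompleteSpace V] (a σ s : ℝ) (c : ℂ) {f : 𝓢'(E3, V)}
    (t : leiLinENorm a σ s f < ⊤) :
    leiLinENorm a σ s (c • f) = ‖c‖ₑ * leiLinENorm a σ s f := by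
  obtain ⟨g, h⟩ := exists_isHat_of_leiLinENorm_lt_top t
  rw [leiLinENorm_eq a σ s h, leiLinENorm_eq a σ s (h.smul c), ← lintegral_const_mul' _ _ (by simp)]
  refine lintegral_congr fun ξ => ?_
  simp only [Pi.smul_apply, enorm_smul]
  ring

theorem leiLinENorm_zero [CompleteSpace V] (a σ s : ℝ) :
    leiLinENorm a σ s (0 : 𝓢'(E3, V)) = 0 := by
  rw [leiLinENorm_eq a σ s isHat_zero]
  simp

theorem eq_zero_of_leiLinENorm_eq_zero [CompleteSpace V] {a σ s : ℝ} {f : 𝓢'(E3, V)}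
    (h0 : leiLinENorm a σ s f = 0) : f = 0 := by
  obtain ⟨g, h⟩ := exists_isHat_of_leiLinENorm_lt_top (a := a) (σ := σ) (s := s) (f := f)
    (by simp [h0])
  rw [leiLinENorm_eq a σ s h] at h0
  replace h0 := (lintegral_eq_zero_iff'
    ((measurable_leiLinWeight a σ s).ennreal_ofReal.aemeasurable.mul
      h.1.aestronglyMeasurable.enorm)).mp h0
  have hne : ∀ᵐ ξ : E3, ξ ≠ 0 := by
    simp [ae_iff]
  have hg : g =ᵐ[volume] 0 := by
    filter_upwards [h0, hne] with ξ hξ hξ0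
    have hw : 0 < leiLinWeight a σ s ξ := by
      unfold leiLinWeight
      have : 0 < ‖ξ‖ := norm_pos_iff.mpr hξ0
      positivity
    have : ENNReal.ofReal (leiLinWeight a σ s ξ) ≠ 0 := by simpa using hw
    simpa [this] using hξ
  have hF : 𝓕 f = 0 := by
    ext φ
    rw [(h.2 φ).2]
    have hi := Measure.integral_comp_smul (volume : Measure E3)
      (fun ξ => φ ((2 * Real.pi)⁻¹ • ξ) • g ξ) (2 * Real.pi)
    have hpi : (2 * Real.pi) ≠ 0 := by positivity
    simp only [inv_smul_smul₀ hpi] at hi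
    rw [hi, integral_eq_zero_of_ae]
    · simp
    · filter_upwards [hg] with ξ hξ
      simp [hξ]
  have := congrArg (fun u : 𝓢'(E3, V) => 𝓕⁻ u) hF
  simp only [FourierTransform.fourierInv_fourier_eq] at this
  rw [this]
  ext φ
  simp only [TemperedDistribution.fourierInv_apply]
  rfl

variable (V) in
/-- The Lei–Lin–Gevrey space `𝒳^s_{a,σ}(ℝ³)` (with values in `V`) as a subspace of `𝓢'(ℝ³; V)`. -/
noncomputable def leiLinSubmodule [CompleteSpace V] (a σ s : ℝ) : Submodule ℂ 𝓢'(E3, V) where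
  carrier := {f | leiLinENorm a σ s f < ⊤}
  add_mem' h₁ h₂ := (leiLinENorm_add_le a σ s _ _).trans_lt (ENNReal.add_lt_top.mpr ⟨h₁, h₂⟩)
  zero_mem' := by
    change leiLinENorm a σ s (0 : 𝓢'(E3, V)) < ⊤
    simp [leiLinENorm_zero]
  smul_mem' c f h := by
    change leiLinENorm a σ s (c • f) < ⊤
    rw [leiLinENorm_smul a σ s c h]
    exact ENNReal.mul_lt_top (by simp) h

variable (V) in
/-- The space `𝒳^s_{a,σ}(ℝ³)`, normed by `∫ |ξ|^s e^{a |ξ|^{1/σ}} |f̂(ξ)| dξ`. A separate type, so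
that it does not carry the weak topology inherited from `𝓢'`. -/
def LeiLin [CompleteSpace V] (a σ s : ℝ) : Type _ := ↥(leiLinSubmodule V a σ s)

namespace LeiLin

variable [CompleteSpace V] {a σ s : ℝ}

/-- The underlying tempered distribution. -/
def toDistr (f : LeiLin V a σ s) : 𝓢'(E3, V) := f.1

noncomputable instance : AddCommGroup (LeiLin V a σ s) :=
  inferInstanceAs (AddCommGroup ↥(leiLinSubmodule V a σ s))

noncomputable instance : Module ℂ (LeiLin V a σ s) :=
  inferInstanceAs (Module ℂ ↥(leiLinSubmodule V a σ s))

noncomputable instance : Norm (LeiLin V a σ s) :=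
  ⟨fun f => (leiLinENorm a σ s f.toDistr).toReal⟩

theorem core : NormedSpace.Core ℂ (LeiLin V a σ s) where
  norm_nonneg f := ENNReal.toReal_nonneg
  norm_smul c f := by
    change (leiLinENorm a σ s (c • f.1)).toReal = ‖c‖ * (leiLinENorm a σ s f.1).toReal
    rw [leiLinENorm_smul a σ s c f.2]
    simp
  norm_triangle f g := by
    change (leiLinENorm a σ s (f.1 + g.1)).toReal
      ≤ (leiLinENorm a σ s f.1).toReal + (leiLinENorm a σ s g.1).toReal
    rw [← ENNReal.toReal_add (ne_of_lt f.2) (ne_of_lt g.2)]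
    exact ENNReal.toReal_mono (ENNReal.add_ne_top.mpr ⟨ne_of_lt f.2, ne_of_lt g.2⟩)
      (leiLinENorm_add_le a σ s _ _)
  norm_eq_zero_iff f := by
    change (leiLinENorm a σ s f.1).toReal = 0 ↔ f = 0
    rw [ENNReal.toReal_eq_zero_iff]
    constructor
    · rintro (h | h)
      · exact Subtype.ext (eq_zero_of_leiLinENorm_eq_zero h)
      · exact absurd h (ne_of_lt f.2)
    · rintro rfl
      exact Or.inl (leiLinENorm_zero a σ s)

noncomputable instance : NormedAddCommGroup (LeiLin V a σ s) :=
  NormedAddCommGroup.ofCore core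

noncomputable instance : NormedSpace ℂ (LeiLin V a σ s) :=
  NormedSpace.ofCore core

end LeiLin

end LeiLinSpaces

section Operators

variable {V : Type*} [NormedAddCommGroup V] [NormedSpace ℂ V]

open Classical in
/-- The Fourier transform `f̂` of `f` when it is a locally integrable function. -/
noncomputable def hat (f : 𝓢'(E3, V)) : E3 → V :=
  if h : ∃ g, IsHat f g then h.choose else 0

open Classical in
/-- The tempered distribution whose Fourier transform is the function `g`. -/
noncomputable def ofHat (g : E3 → V) : 𝓢'(E3, V) :=
  if h : ∃ f, IsHat f g then h.choose else 0

/-- The fractional heat semigroup `e^{-t(-Δ)^γ}`, the Fourier multiplier `e^{-t|ξ|^{2γ}}`. -/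
noncomputable def fracHeat (γ t : ℝ) (f : 𝓢'(E3, V)) : 𝓢'(E3, V) :=
  ofHat fun ξ => (Real.exp (-(t * ‖ξ‖ ^ (2 * γ))) : ℂ) • hat f ξ

/-- The Leray projector `ℙ`, with symbol `I - ξ ⊗ ξ / |ξ|²`. -/
noncomputable def leray (f : 𝓢'(E3, C3)) : 𝓢'(E3, C3) :=
  ofHat fun ξ => WithLp.toLp 2 fun j =>
    hat f ξ j - ((ξ j : ℝ) : ℂ) * (∑ k, ((ξ k : ℝ) : ℂ) * hat f ξ k) / ((‖ξ‖ ^ 2 : ℝ) : ℂ)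

/-- The pointwise product `f w` of a scalar `f` and a `V`-valued `w` with integrable Fourier
transforms (so both are bounded continuous functions): `(f w)^ = (2π)⁻³ f̂ * ŵ`. -/
noncomputable def distrMul (f : 𝓢'(E3, ℂ)) (w : 𝓢'(E3, V)) : 𝓢'(E3, V) :=
  ofHat fun ξ => (((2 * Real.pi) ^ 3 : ℝ) : ℂ)⁻¹ • ∫ η, hat f (ξ - η) • hat w η

/-- The `j`-th component of a vector-valued distribution. -/
noncomputable def component (j : Fin 3) (u : 𝓢'(E3, C3)) : 𝓢'(E3, ℂ) :=
  PointwiseConvergenceCLM.postcomp _ (EuclideanSpace.proj j : C3 →L[ℂ] ℂ) u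

/-- The `j`-th vector of the standard basis of `ℝ³`. -/
noncomputable def basisVec (j : Fin 3) : E3 := EuclideanSpace.single j (1 : ℝ)

/-- The divergence, in the sense of distributions. -/
noncomputable def divergence (u : 𝓢'(E3, C3)) : 𝓢'(E3, ℂ) := ∑ j, ∂_{basisVec j} (component j u)

/-- The transport term `u · ∇w = ∑ⱼ ∂ⱼ (uⱼ w)`, for `div u = 0`. -/
noncomputable def transport (u : 𝓢'(E3, C3)) (w : 𝓢'(E3, V)) : 𝓢'(E3, V) :=
  ∑ j, ∂_{basisVec j} (distrMul (component j u) w)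

/-- The buoyancy force `θ e₃ = (0, 0, θ)`. -/
noncomputable def buoyancy (θ : 𝓢'(E3, ℂ)) : 𝓢'(E3, C3) :=
  PointwiseConvergenceCLM.postcomp _
    ((ContinuousLinearMap.id ℂ ℂ).smulRight (EuclideanSpace.single 2 (1 : ℂ) : C3)) θ

/-- A scalar distribution is real-valued: real test functions have real pairings. -/
def IsRealDistr (f : 𝓢'(E3, ℂ)) : Prop :=
  ∀ φ : 𝓢(E3, ℂ), (∀ x, (φ x).im = 0) → (f φ).im = 0

end Operators

section Solutions

/-- Lebesgue measure on `[0, T]`. -/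
noncomputable def timeMeasure (T : ℝ) : Measure (Icc (0 : ℝ) T) :=
  Measure.comap (fun t => (t : ℝ)) volume

/-- Integrability and value of `∫₀ᵗ G τ dτ` in `𝓢'`, tested against every Schwartz function; the
time variable ranges over `[0, T]`. -/
def HasTimeIntegral {V : Type*} [NormedAddCommGroup V] [NormedSpace ℂ V] {T : ℝ}
    (t : Icc (0 : ℝ) T) (G : Icc (0 : ℝ) T → 𝓢'(E3, V)) (I : 𝓢'(E3, V)) : Prop :=
  ∀ φ : 𝓢(E3, ℂ), IntegrableOn (fun τ => G τ φ) (Iic t) (timeMeasure T) ∧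
    I φ = ∫ τ in Iic t, G τ φ ∂(timeMeasure T)

/-- `u ∈ L^p_T(𝒳^r_{a,σ})` for a distribution-valued `u` on `[0, T]`: almost everywhere `u` agrees
with a function that is `p`-integrable (strongly measurable) with values in `𝒳^r_{a,σ}`. -/
def MemLpLeiLin {V : Type*} [NormedAddCommGroup V] [NormedSpace ℂ V] [CompleteSpace V]
    (a σ r p : ℝ) {T : ℝ} (u : Icc (0 : ℝ) T → 𝓢'(E3, V)) : Prop :=
  ∃ w : Icc (0 : ℝ) T → LeiLin V a σ r,
    MemLp w (ENNReal.ofReal p) (timeMeasure T) ∧ ∀ᵐ t ∂(timeMeasure T), (w t).toDistr = u t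

/-- `(u, θ)` is a (real-valued, divergence-free) mild solution on `[0, T]` of the fractional
Boussinesq system, with initial data `(u₀, θ₀)`. -/
structure IsMildSolution (α β : ℝ) (u₀ : 𝓢'(E3, C3)) (θ₀ : 𝓢'(E3, ℂ)) {T : ℝ}
    (u : Icc (0 : ℝ) T → 𝓢'(E3, C3)) (θ : Icc (0 : ℝ) T → 𝓢'(E3, ℂ)) : Prop where
  real_velocity : ∀ t j, IsRealDistr (component j (u t))
  real_temperature : ∀ t, IsRealDistr (θ t)
  div_free : ∀ t, divergence (u t) = 0
  velocity : ∀ t, ∃ N L : 𝓢'(E3, C3),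
    HasTimeIntegral t
      (fun τ => fracHeat α ((t : ℝ) - τ) (leray (transport (u τ) (u τ)))) N ∧
    HasTimeIntegral t
      (fun τ => fracHeat α ((t : ℝ) - τ) (leray (buoyancy (θ τ)))) L ∧
    u t = fracHeat α t u₀ - N + L
  temperature : ∀ t, ∃ N : 𝓢'(E3, ℂ),
    HasTimeIntegral t (fun τ => fracHeat β ((t : ℝ) - τ) (transport (u τ) (θ τ))) N ∧
    θ t = fracHeat β t θ₀ - N

/-- `‖u‖_{L^∞_T(𝒳^s)} + ‖u‖_{L¹_T(𝒳^{s+2α})} + ‖θ‖_{L^∞_T(𝒳^s)} + ‖θ‖_{L¹_T(𝒳^{s+2β})}`. -/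
noncomputable def solutionNorm (a σ α β s : ℝ) {T : ℝ}
    (u : C(Icc (0 : ℝ) T, LeiLin C3 a σ s)) (θ : C(Icc (0 : ℝ) T, LeiLin ℂ a σ s)) : ℝ≥0∞ :=
  ENNReal.ofReal ‖u‖ + (∫⁻ t, leiLinENorm a σ (s + 2 * α) (u t).toDistr ∂(timeMeasure T))
    + ENNReal.ofReal ‖θ‖ + ∫⁻ t, leiLinENorm a σ (s + 2 * β) (θ t).toDistr ∂(timeMeasure T)

/-- `(u, θ)` is a mild solution in the class
`[C_T(𝒳^s) ∩ L¹_T(𝒳^{s+2α})] × [C_T(𝒳^s) ∩ L¹_T(𝒳^{s+2β})]`. -/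
def IsSolutionInClass (a σ α β s : ℝ) (u₀ : LeiLin C3 a σ s) (θ₀ : LeiLin ℂ a σ s) {T : ℝ}
    (u : C(Icc (0 : ℝ) T, LeiLin C3 a σ s)) (θ : C(Icc (0 : ℝ) T, LeiLin ℂ a σ s)) : Prop :=
  MemLpLeiLin a σ (s + 2 * α) 1 (fun t => (u t).toDistr) ∧
  MemLpLeiLin a σ (s + 2 * β) 1 (fun t => (θ t).toDistr) ∧
  IsMildSolution α β u₀.toDistr θ₀.toDistr (fun t => (u t).toDistr) (fun t => (θ t).toDistr)

/-- The critical index `q_{α,β}`. -/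
noncomputable def qIndex (α β : ℝ) : ℝ :=
  max (1 - 2 * α) (max (α * (1 - 2 * β) / β) (β * (1 - 2 * α) / α))

end Solutions

/-!
Everything is done on the Fourier side, where `𝒳^s_{a,σ}` is a weighted `L¹` space. The unknown is
not the solution but its forcing term `(F, G) = (-ℙ(u·∇u) + ℙ(θe₃), -u·∇θ)`, an element of
`L¹_T(𝒳^s)`: the Duhamel formula `duhamel` recovers `(u, θ)` from it for *every* time, and the
norm of `L^∞_T(𝒳^s) ∩ L¹_T(𝒳^{s+2γ})` (`energy`) of the result is at most twice
`‖u₀‖_{𝒳^s} + ‖F‖_{L¹_T(𝒳^s)}`, because `∫₀^∞ |ξ|^{2γ} e^{-t|ξ|^{2γ}} dt ≤ 1`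
(`energy_duhamel_le`).

The nonlinearity is estimated in `L¹_T(𝒳^s)`. For `-1 ≤ s ≤ 0` and `σ ≥ 1` the functions
`|ξ|^{s+1}` and `|ξ|^{1/σ}` are subadditive, so Young's inequality gives
`‖u·∇w‖_{𝒳^s} ≤ 3 (‖u‖_{𝒳^{s+1}} ‖w‖_{𝒳^0} + ‖u‖_{𝒳^0} ‖w‖_{𝒳^{s+1}})` (`xNorm_transportHat_le`).
The spaces `𝒳^{s+1}` and `𝒳^0` lie between `𝒳^s` and `𝒳^{s+2γ}`; interpolation and Hölder's
inequality in time bound the `L¹_T(𝒳^s)` norm by `κ` times the product of the energies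
(`timeNorm_transportHat_le`), where `κ` is a power of `T`. The exponents of `T` for the three pairs
`(u, u)`, `(u, θ)`, `(θ, u)` are nonnegative exactly if `s ≥ q_{α,β}` and positive exactly if
`s > q_{α,β}` (`one_sub_exponent_eq`). Above the critical index `κ` is therefore made small by the
choice of `T`; at the critical index smallness has to come from the data. Both cases are collected
in the structure `Admissible`.

Under these conditions the map from a forcing term to the nonlinearity of its Duhamel formula is a
contraction of a ball of `L¹_T(𝒳^s)` (`Admissible.exists_forcing`), and two forcing terms that
reproduce themselves agree as soon as the energies of both solutions are at most `C₁`
(`Admissible.forcing_unique`). The latter is used twice: for the uniqueness of mild solutions, whose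
Fourier transforms satisfy the Duhamel formula (`Admissible.eq_duhamel_of_isMildSolution`), and for
reality, as the conjugated reflection `conj F(t, -ξ)` is again a forcing term for the same
data (`Admissible.duhamel_reflect_eq`). The velocity is divergence free because the forcing is a
Leray projection, and the `L^p_T` bounds are interpolation again (`memLpLeiLin_of_energy_lt_top`).

The passage between distributions and functions rests on `IsHat`: all functions that occur are
integrable against `(1 + |ξ|²)⁻¹` (`TemperedIntegrable`), which is where `s ≥ -1` enters a second
time, and this is enough for them to be Fourier transforms and for the operators in the equation to
act as the expected multipliers. A continuous curve in `𝒳^s` has a jointly measurable Fourier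
transform (`exists_jointly_measurable_hat`), so that Tonelli's theorem applies to it.
-/

/-! ### Fourier transforms of tempered distributions -/

section FourierSide

variable {V : Type*} [NormedAddCommGroup V] [NormedSpace ℂ V]

/-- `(1 + |ξ|²)⁻¹ g` is integrable; such a `g` is the Fourier transform of a tempered
distribution. -/
def TemperedIntegrable (g : E3 → V) : Prop :=
  Integrable fun ξ => (1 + ‖ξ‖ ^ 2 : ℝ)⁻¹ • g ξ

theorem TemperedIntegrable.aestronglyMeasurable {g : E3 → V} (h : TemperedIntegrable g) :
    AEStronglyMeasurable g := by
  have : g = fun ξ => (1 + ‖ξ‖ ^ 2 : ℝ) • ((1 + ‖ξ‖ ^ 2 : ℝ)⁻¹ • g ξ) := by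
    ext1 ξ
    rw [smul_inv_smul₀ (by positivity)]
  rw [this]
  have hc : Continuous fun ξ : E3 => (1 + ‖ξ‖ ^ 2 : ℝ) := by fun_prop
  exact hc.aestronglyMeasurable.smul (Integrable.aestronglyMeasurable h)

theorem TemperedIntegrable.locallyIntegrable {g : E3 → V} (h : TemperedIntegrable g) :
    LocallyIntegrable g := by
  rw [locallyIntegrable_iff]
  intro k hk
  have := (h.integrableOn (s := k)).continuousOn_smul
    (f := fun ξ : E3 => (1 + ‖ξ‖ ^ 2 : ℝ)) (by fun_prop) hk
  refine this.congr (Eventually.of_forall fun ξ => ?_)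
  exact smul_inv_smul₀ (by positivity) _

/-- Schwartz functions absorb the weight of `TemperedIntegrable`, in the scaling of `IsHat`. -/
theorem schwartz_weight_bound (φ : 𝓢(E3, ℂ)) :
    ∃ C : ℝ, 0 ≤ C ∧ ∀ ζ : E3, ‖φ ζ‖ * (1 + ‖(2 * Real.pi) • ζ‖ ^ 2) ≤ C := by
  refine ⟨SchwartzMap.seminorm ℂ 0 0 φ + (2 * Real.pi) ^ 2 * SchwartzMap.seminorm ℂ 2 0 φ,
    by positivity, fun ζ => ?_⟩
  have h0 := SchwartzMap.norm_le_seminorm ℂ φ ζ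
  have h2 := SchwartzMap.norm_pow_mul_le_seminorm ℂ φ 2 ζ
  rw [norm_smul, Real.norm_of_nonneg (by positivity)]
  nlinarith [mul_le_mul_of_nonneg_left h2 (sq_nonneg (2 * Real.pi))]

theorem TemperedIntegrable.integrable_smul {g : E3 → V} (h : TemperedIntegrable g)
    (φ : 𝓢(E3, ℂ)) : Integrable fun ζ : E3 => φ ζ • g ((2 * Real.pi) • ζ) := by
  have hpi : (2 * Real.pi) ≠ 0 := by positivity
  obtain ⟨C, -, hC⟩ := schwartz_weight_bound φ
  have h1 : Integrable fun ζ : E3 =>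
      (1 + ‖(2 * Real.pi) • ζ‖ ^ 2 : ℝ)⁻¹ • g ((2 * Real.pi) • ζ) := Integrable.comp_smul h hpi
  have hc : Continuous fun ζ : E3 => φ ζ * ((1 + ‖(2 * Real.pi) • ζ‖ ^ 2 : ℝ) : ℂ) := by
    have := φ.continuous
    fun_prop
  have := h1.bdd_smul C hc.aestronglyMeasurable
    (Eventually.of_forall fun ζ => by
      rw [norm_mul, Complex.norm_real, Real.norm_of_nonneg (by positivity)]; exact hC ζ)
  refine this.congr (Eventually.of_forall fun ζ => ?_)
  simp only [Pi.smul_apply', mul_smul, Complex.coe_smul]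
  rw [smul_inv_smul₀ (by positivity)]

theorem TemperedIntegrable.exists_isHat [CompleteSpace V] {g : E3 → V}
    (h : TemperedIntegrable g) : ∃ f : 𝓢'(E3, V), IsHat f g := by
  have hpi : (2 * Real.pi) ≠ 0 := by positivity
  have h1 : Integrable fun ζ : E3 =>
      (1 + ‖(2 * Real.pi) • ζ‖ ^ 2 : ℝ)⁻¹ • g ((2 * Real.pi) • ζ) := Integrable.comp_smul h hpi
  -- `g (2πζ)` is a polynomial multiple of an integrable function, hence a tempered distribution
  let d : 𝓢'(E3, V) := TemperedDistribution.smulLeftCLM V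
    (fun ζ : E3 => ((1 + (2 * Real.pi) ^ 2 * ‖ζ‖ ^ 2 : ℝ) : ℂ))
    (Lp.toTemperedDistribution (memLp_one_iff_integrable.mpr h1).toLp)
  refine ⟨𝓕⁻ d, h.locallyIntegrable, fun φ => ⟨h.integrable_smul φ, ?_⟩⟩
  have ht : (fun ζ : E3 => ((1 + (2 * Real.pi) ^ 2 * ‖ζ‖ ^ 2 : ℝ) : ℂ)).HasTemperateGrowth := by
    fun_prop
  rw [FourierTransform.fourier_fourierInv_eq]
  simp only [d, TemperedDistribution.smulLeftCLM_apply_apply, Lp.toTemperedDistribution_apply]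
  refine integral_congr_ae ?_
  filter_upwards [(memLp_one_iff_integrable.mpr h1).coeFn_toLp] with ζ hζ
  rw [hζ, SchwartzMap.smulLeftCLM_apply_apply ht]
  have e : (2 * Real.pi) ^ 2 * ‖ζ‖ ^ 2 = ‖(2 * Real.pi) • ζ‖ ^ 2 := by
    rw [norm_smul, Real.norm_of_nonneg (by positivity), mul_pow (2 * Real.pi)]
  rw [e, smul_eq_mul, mul_comm, mul_smul, Complex.coe_smul, smul_inv_smul₀ (by positivity)]

theorem integral_comp_two_pi_congr {g g' : E3 → V} (h : g =ᵐ[volume] g') (φ : E3 → ℂ) :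
    (fun ζ : E3 => φ ζ • g ((2 * Real.pi) • ζ)) =ᵐ[volume]
      fun ζ : E3 => φ ζ • g' ((2 * Real.pi) • ζ) := by
  have hpi : (2 * Real.pi) ≠ 0 := by positivity
  have hq : Measure.QuasiMeasurePreserving (fun ζ : E3 => (2 * Real.pi) • ζ) volume volume := by
    refine ⟨by fun_prop, ?_⟩
    rw [Measure.map_addHaar_smul volume hpi]
    exact Measure.smul_absolutelyContinuous
  filter_upwards [hq.ae h] with ζ hζ
  rw [hζ]

theorem IsHat.congr_ae {f : 𝓢'(E3, V)} {g g' : E3 → V} (h : IsHat f g) (hg : g =ᵐ[volume] g') :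
    IsHat f g' := by
  refine ⟨h.1.congr hg, fun φ => ⟨(h.2 φ).1.congr (integral_comp_two_pi_congr hg φ), ?_⟩⟩
  rw [(h.2 φ).2]
  exact integral_congr_ae (integral_comp_two_pi_congr hg φ)

theorem IsHat.apply {f : 𝓢'(E3, V)} {g : E3 → V} (h : IsHat f g) (φ : 𝓢(E3, ℂ)) :
    f φ = ∫ ζ : E3, (𝓕⁻ φ) ζ • g ((2 * Real.pi) • ζ) := by
  rw [← (h.2 (𝓕⁻ φ)).2, TemperedDistribution.fourier_apply, FourierTransform.fourier_fourierInv_eq]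

theorem IsHat.distr_eq {f f' : 𝓢'(E3, V)} {g g' : E3 → V} (h : IsHat f g) (h' : IsHat f' g')
    (hg : g =ᵐ[volume] g') : f = f' := by
  ext φ
  rw [h.apply, h'.apply]
  exact integral_congr_ae (integral_comp_two_pi_congr hg _)

theorem IsHat.isHat_hat {f : 𝓢'(E3, V)} {g : E3 → V} (h : IsHat f g) : IsHat f (hat f) := by
  have : ∃ g, IsHat f g := ⟨g, h⟩
  unfold hat
  rw [dif_pos this]
  exact this.choose_spec

theorem IsHat.hat_ae_eq [CompleteSpace V] {f : 𝓢'(E3, V)} {g : E3 → V} (h : IsHat f g) :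
    hat f =ᵐ[volume] g := h.isHat_hat.ae_eq h

theorem IsHat.isHat_ofHat {f : 𝓢'(E3, V)} {g : E3 → V} (h : IsHat f g) : IsHat (ofHat g) g := by
  have : ∃ f, IsHat f g := ⟨f, h⟩
  unfold ofHat
  rw [dif_pos this]
  exact this.choose_spec

/-- The values of `hat` are known only almost everywhere, so `ofHat` is applied to a function `g'`
that agrees with the intended one only up to a null set. -/
theorem TemperedIntegrable.isHat_ofHat_congr [CompleteSpace V] {g g' : E3 → V}
    (h : TemperedIntegrable g) (hg : g' =ᵐ[volume] g) : IsHat (ofHat g') g := by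
  obtain ⟨f, hf⟩ := h.exists_isHat
  exact (hf.congr_ae hg.symm).isHat_ofHat.congr_ae hg

theorem TemperedIntegrable.mono {W : Type*} [NormedAddCommGroup W] [NormedSpace ℂ W]
    {g : E3 → V} {g' : E3 → W} (h : TemperedIntegrable g)
    (hm : AEStronglyMeasurable g') (c : ℝ) (hle : ∀ᵐ ξ, ‖g' ξ‖ ≤ c * ‖g ξ‖) :
    TemperedIntegrable g' := by
  refine Integrable.mono (Integrable.const_mul h.norm c) ?_ ?_
  · have : Measurable fun ξ : E3 => (1 + ‖ξ‖ ^ 2 : ℝ)⁻¹ := by fun_prop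
    exact this.aestronglyMeasurable.smul hm
  · filter_upwards [hle] with ξ hξ
    rw [norm_smul, norm_smul, Real.norm_of_nonneg (by positivity), Real.norm_eq_abs]
    refine le_trans ?_ (le_abs_self _)
    have : (0 : ℝ) ≤ (1 + ‖ξ‖ ^ 2)⁻¹ := by positivity
    nlinarith

theorem TemperedIntegrable.add {g g' : E3 → V} (h : TemperedIntegrable g)
    (h' : TemperedIntegrable g') : TemperedIntegrable (g + g') := by
  refine (Integrable.add h h').congr (Eventually.of_forall fun ξ => ?_)
  simp [smul_add]

theorem IsHat.neg {f : 𝓢'(E3, V)} {g : E3 → V} (h : IsHat f g) : IsHat (-f) (-g) := by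
  simpa using h.smul (-1)

theorem IsHat.sub {f₁ f₂ : 𝓢'(E3, V)} {g₁ g₂ : E3 → V} (h₁ : IsHat f₁ g₁) (h₂ : IsHat f₂ g₂) :
    IsHat (f₁ - f₂) (g₁ - g₂) := by
  simpa [sub_eq_add_neg] using h₁.add h₂.neg

theorem IsHat.sum {ι : Type*} (t : Finset ι) {f : ι → 𝓢'(E3, V)} {g : ι → E3 → V}
    (h : ∀ i ∈ t, IsHat (f i) (g i)) : IsHat (∑ i ∈ t, f i) (∑ i ∈ t, g i) := by
  classical
  induction t using Finset.induction_on with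
  | empty => simpa using isHat_zero
  | insert i t hi ih =>
    rw [Finset.sum_insert hi, Finset.sum_insert hi]
    exact (h i (Finset.mem_insert_self i t)).add
      (ih fun j hj => h j (Finset.mem_insert_of_mem hj))

theorem IsHat.postcomp [CompleteSpace V] {W : Type*} [NormedAddCommGroup W] [NormedSpace ℂ W]
    [CompleteSpace W] {f : 𝓢'(E3, V)} {g : E3 → V} (h : IsHat f g) (L : V →L[ℂ] W) :
    IsHat (PointwiseConvergenceCLM.postcomp _ L f) (fun ξ => L (g ξ)) := by
  refine ⟨?_, fun φ => ?_⟩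
  · rw [locallyIntegrable_iff]
    intro k hk
    exact L.integrable_comp ((locallyIntegrable_iff.mp h.1) k hk)
  · have hi := L.integrable_comp (h.2 φ).1
    simp only [map_smul] at hi
    refine ⟨hi, ?_⟩
    rw [TemperedDistribution.fourier_apply]
    change L (f (𝓕 φ)) = _
    rw [← TemperedDistribution.fourier_apply, (h.2 φ).2,
      ← ContinuousLinearMap.integral_comp_comm L (h.2 φ).1]
    simp only [map_smul]

theorem IsHat.lineDeriv {f : 𝓢'(E3, V)} {g : E3 → V} (h : IsHat f g) (j : Fin 3) :
    IsHat (∂_{basisVec j} f) (fun ξ => (Complex.I * ((ξ j : ℝ) : ℂ)) • g ξ) := by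
  have hin : ∀ ξ : E3, inner ℝ ξ (basisVec j) = ξ j := by
    intro ξ
    simp [basisVec, EuclideanSpace.inner_single_right]
  have ht : (fun ξ : E3 => inner ℝ ξ (basisVec j)).HasTemperateGrowth := by fun_prop
  have ht' : (fun ξ : E3 => ((inner ℝ ξ (basisVec j) : ℝ) : ℂ)).HasTemperateGrowth := by fun_prop
  refine ⟨?_, fun φ => ?_⟩
  · rw [locallyIntegrable_iff]
    intro k hk
    exact ((locallyIntegrable_iff.mp h.1) k hk).continuousOn_smul
      (f := fun ξ : E3 => Complex.I * ((ξ j : ℝ) : ℂ)) (by fun_prop) hk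
  · have e : ∀ ζ : E3, φ ζ • (Complex.I * ((((2 * Real.pi) • ζ) j : ℝ) : ℂ)) • g ((2 * Real.pi) • ζ)
        = ((2 * Real.pi * Complex.I) • SchwartzMap.smulLeftCLM ℂ
            (fun ξ : E3 => ((inner ℝ ξ (basisVec j) : ℝ) : ℂ)) φ) ζ • g ((2 * Real.pi) • ζ) := by
      intro ζ
      rw [_root_.smul_apply, SchwartzMap.smulLeftCLM_apply_apply ht', hin, smul_smul]
      congr 1
      simp
      ring
    refine ⟨?_, ?_⟩
    · simp_rw [e]
      exact (h.2 _).1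
    · simp_rw [e]
      rw [← (h.2 _).2, TemperedDistribution.fourier_lineDerivOp_eq]
      simp

end FourierSide

/-! ### The operators of the system on the Fourier side -/

section FourierMultipliers

variable {V : Type*} [NormedAddCommGroup V] [NormedSpace ℂ V]

/-- The symbol `I - ξ ⊗ ξ / |ξ|²` of the Leray projector, applied to `v`. -/
noncomputable def leraySymbol (ξ : E3) (v : C3) : C3 :=
  WithLp.toLp 2 fun j =>
    v j - ((ξ j : ℝ) : ℂ) * (∑ k, ((ξ k : ℝ) : ℂ) * v k) / ((‖ξ‖ ^ 2 : ℝ) : ℂ)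

theorem leraySymbol_apply (ξ : E3) (v : C3) (j : Fin 3) : leraySymbol ξ v j =
    v j - ((ξ j : ℝ) : ℂ) * (∑ k, ((ξ k : ℝ) : ℂ) * v k) / ((‖ξ‖ ^ 2 : ℝ) : ℂ) := rfl

theorem measurable_leraySymbol : Measurable fun p : E3 × C3 => leraySymbol p.1 p.2 := by
  unfold leraySymbol
  refine (WithLp.measurable_toLp 2 _).comp (measurable_pi_iff.mpr fun j => ?_)
  fun_prop

theorem leraySymbol_sub (ξ : E3) (v w : C3) :
    leraySymbol ξ (v - w) = leraySymbol ξ v - leraySymbol ξ w := by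
  ext j
  simp only [leraySymbol_apply, PiLp.sub_apply, mul_sub, Finset.sum_sub_distrib]
  ring

/-- The constant `1` would do, but `2` follows from the triangle inequality. -/
theorem norm_leraySymbol_le (ξ : E3) (v : C3) : ‖leraySymbol ξ v‖ ≤ 2 * ‖v‖ := by
  set x : C3 := WithLp.toLp 2 fun j => ((ξ j : ℝ) : ℂ) with hx
  have hxn : ‖x‖ = ‖ξ‖ := by
    simp [hx, EuclideanSpace.norm_eq]
  have hin : inner ℂ x v = ∑ k, ((ξ k : ℝ) : ℂ) * v k := by
    simp [hx, PiLp.inner_apply, mul_comm]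
  have e : leraySymbol ξ v = v - ((∑ k, ((ξ k : ℝ) : ℂ) * v k) / ((‖ξ‖ ^ 2 : ℝ) : ℂ)) • x := by
    ext j
    simp only [leraySymbol_apply, PiLp.sub_apply, PiLp.smul_apply, smul_eq_mul, hx]
    ring
  rw [e]
  refine (norm_sub_le _ _).trans ?_
  have h1 : ‖((∑ k, ((ξ k : ℝ) : ℂ) * v k) / ((‖ξ‖ ^ 2 : ℝ) : ℂ)) • x‖ ≤ ‖v‖ := by
    rcases eq_or_ne ξ 0 with rfl | hξ
    · simp
    have hpos : 0 < ‖ξ‖ := norm_pos_iff.mpr hξ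
    rw [norm_smul, norm_div, Complex.norm_real, Real.norm_of_nonneg (by positivity), hxn, ← hin]
    have := norm_inner_le_norm (𝕜 := ℂ) x v
    rw [hxn] at this
    rw [div_mul_eq_mul_div, div_le_iff₀ (by positivity)]
    nlinarith
  linarith

theorem sum_mul_leraySymbol (ξ : E3) (v : C3) :
    ∑ j, ((ξ j : ℝ) : ℂ) * leraySymbol ξ v j = 0 := by
  rcases eq_or_ne ξ 0 with rfl | hξ
  · simp
  have hpos : 0 < ‖ξ‖ := norm_pos_iff.mpr hξ
  have hn : ((‖ξ‖ ^ 2 : ℝ) : ℂ) = ∑ j, ((ξ j : ℝ) : ℂ) * ((ξ j : ℝ) : ℂ) := by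
    rw [EuclideanSpace.real_norm_sq_eq]
    push_cast
    exact Finset.sum_congr rfl fun j _ => by ring
  have hne : ((‖ξ‖ ^ 2 : ℝ) : ℂ) ≠ 0 := by
    exact_mod_cast (by positivity : ‖ξ‖ ^ 2 ≠ 0)
  simp only [leraySymbol_apply, mul_sub, Finset.sum_sub_distrib]
  have : ∀ j : Fin 3, ((ξ j : ℝ) : ℂ) * (((ξ j : ℝ) : ℂ) * (∑ k, ((ξ k : ℝ) : ℂ) * v k)
      / ((‖ξ‖ ^ 2 : ℝ) : ℂ)) = (((ξ j : ℝ) : ℂ) * ((ξ j : ℝ) : ℂ)) *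
        ((∑ k, ((ξ k : ℝ) : ℂ) * v k) / ((‖ξ‖ ^ 2 : ℝ) : ℂ)) := fun j => by ring
  simp only [this, ← Finset.sum_mul]
  rw [← hn, mul_div_cancel₀ _ hne, sub_self]

theorem TemperedIntegrable.leray {g : E3 → C3} (h : TemperedIntegrable g) :
    TemperedIntegrable fun ξ => leraySymbol ξ (g ξ) :=
  h.mono (measurable_leraySymbol.comp_aemeasurable
    (aemeasurable_id.prodMk h.aestronglyMeasurable.aemeasurable)).aestronglyMeasurable 2
    (Eventually.of_forall fun ξ => norm_leraySymbol_le ξ (g ξ))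

theorem IsHat.leray {f : 𝓢'(E3, C3)} {g : E3 → C3} (h : IsHat f g) (ht : TemperedIntegrable g) :
    IsHat (leray f) (fun ξ => leraySymbol ξ (g ξ)) := by
  refine ht.leray.isHat_ofHat_congr ?_
  filter_upwards [h.hat_ae_eq] with ξ hξ
  rw [hξ]
  rfl

theorem TemperedIntegrable.fracHeat {g : E3 → V} (h : TemperedIntegrable g) (γ : ℝ) {t : ℝ}
    (ht : 0 ≤ t) :
    TemperedIntegrable fun ξ => (Real.exp (-(t * ‖ξ‖ ^ (2 * γ))) : ℂ) • g ξ := by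
  have hm : Measurable fun ξ : E3 => ((Real.exp (-(t * ‖ξ‖ ^ (2 * γ))) : ℝ) : ℂ) := by fun_prop
  refine h.mono (hm.aestronglyMeasurable.smul h.aestronglyMeasurable) 1
    (Eventually.of_forall fun ξ => ?_)
  rw [norm_smul, Complex.norm_real, Real.norm_of_nonneg (by positivity)]
  gcongr
  rw [Real.exp_le_one_iff, neg_nonpos]
  positivity

theorem IsHat.fracHeat [CompleteSpace V] {f : 𝓢'(E3, V)} {g : E3 → V} (h : IsHat f g)
    (ht : TemperedIntegrable g) (γ : ℝ) {t : ℝ} (h0 : 0 ≤ t) :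
    IsHat (fracHeat γ t f) fun ξ => (Real.exp (-(t * ‖ξ‖ ^ (2 * γ))) : ℂ) • g ξ := by
  refine (ht.fracHeat γ h0).isHat_ofHat_congr ?_
  filter_upwards [h.hat_ae_eq] with ξ hξ
  rw [hξ]

theorem IsHat.component {f : 𝓢'(E3, C3)} {g : E3 → C3} (h : IsHat f g) (j : Fin 3) :
    IsHat (component j f) fun ξ => g ξ j :=
  h.postcomp (EuclideanSpace.proj j : C3 →L[ℂ] ℂ)

theorem IsHat.buoyancy {f : 𝓢'(E3, ℂ)} {g : E3 → ℂ} (h : IsHat f g) :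
    IsHat (buoyancy f) fun ξ => g ξ • (EuclideanSpace.single 2 (1 : ℂ) : C3) :=
  h.postcomp ((ContinuousLinearMap.id ℂ ℂ).smulRight (EuclideanSpace.single 2 (1 : ℂ) : C3))

theorem IsHat.divergence {f : 𝓢'(E3, C3)} {g : E3 → C3} (h : IsHat f g) :
    IsHat (divergence f) fun ξ => Complex.I * ∑ j, ((ξ j : ℝ) : ℂ) * g ξ j := by
  have := IsHat.sum Finset.univ fun (j : Fin 3) _ => (h.component j).lineDeriv j
  refine this.congr_ae (Eventually.of_forall fun ξ => ?_)
  simp [Finset.sum_apply, Finset.mul_sum, mul_assoc]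

theorem IsHat.divergence_eq_zero_iff {f : 𝓢'(E3, C3)} {g : E3 → C3} (h : IsHat f g) :
    _root_.divergence f = 0 ↔ ∀ᵐ ξ : E3, ∑ j, ((ξ j : ℝ) : ℂ) * g ξ j = 0 := by
  constructor
  · intro h0
    have h1 := h.divergence
    rw [h0] at h1
    filter_upwards [h1.ae_eq isHat_zero] with ξ hξ
    simpa using hξ
  · intro h0
    refine h.divergence.distr_eq isHat_zero ?_
    filter_upwards [h0] with ξ hξ
    simp [hξ]

/-- The Fourier transform of `∑ⱼ ∂ⱼ (uⱼ w)` in terms of `f = û` and `g = ŵ`. -/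
noncomputable def transportHat (f : E3 → C3) (g : E3 → V) (ξ : E3) : V :=
  ∑ j : Fin 3, (Complex.I * ((ξ j : ℝ) : ℂ)) •
    (((2 * Real.pi) ^ 3 : ℝ) : ℂ)⁻¹ • ∫ η, f (ξ - η) j • g η

theorem integrable_convolution_smul {f : E3 → ℂ} {g : E3 → V} (hf : Integrable f)
    (hg : Integrable g) : Integrable fun ξ => ∫ η, f (ξ - η) • g η :=
  hg.integrable_convolution (ContinuousLinearMap.lsmul ℂ ℂ).flip hf

theorem temperedIntegrable_mul_coord {h : E3 → V} (hh : Integrable h) (j : Fin 3) :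
    TemperedIntegrable fun ξ => (Complex.I * ((ξ j : ℝ) : ℂ)) • h ξ := by
  have hc : Continuous fun ξ : E3 => (Complex.I * ((ξ j : ℝ) : ℂ)) := by fun_prop
  have hw : Continuous fun ξ : E3 => (1 + ‖ξ‖ ^ 2 : ℝ)⁻¹ :=
    Continuous.inv₀ (by fun_prop) fun ξ => by positivity
  refine hh.mono (hw.aestronglyMeasurable.smul (hc.aestronglyMeasurable.smul
    hh.aestronglyMeasurable)) (Eventually.of_forall fun ξ => ?_)
  rw [norm_smul, norm_smul, norm_mul, Complex.norm_I, one_mul, Complex.norm_real,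
    Real.norm_of_nonneg (by positivity), ← mul_assoc]
  have h1 : ‖ξ j‖ ≤ ‖ξ‖ := PiLp.norm_apply_le ξ j
  have h2 : (1 + ‖ξ‖ ^ 2)⁻¹ * ‖ξ j‖ ≤ 1 := by
    rw [inv_mul_le_iff₀ (by positivity)]
    nlinarith [sq_nonneg (‖ξ‖ - 1)]
  nlinarith [norm_nonneg (h ξ)]

theorem TemperedIntegrable.transportHat {f : E3 → C3} {g : E3 → V} (hf : Integrable f)
    (hg : Integrable g) : TemperedIntegrable (transportHat f g) := by
  have h : ∀ j : Fin 3, TemperedIntegrable fun ξ => (Complex.I * ((ξ j : ℝ) : ℂ)) •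
      (((2 * Real.pi) ^ 3 : ℝ) : ℂ)⁻¹ • ∫ η, f (ξ - η) j • g η := fun j =>
    temperedIntegrable_mul_coord ((integrable_convolution_smul
      ((EuclideanSpace.proj j : C3 →L[ℂ] ℂ).integrable_comp hf) hg).smul _) j
  have := ((h 0).add (h 1)).add (h 2)
  convert! this using 1
  ext1 ξ
  simp [_root_.transportHat, Fin.sum_univ_three]

theorem isHat_distrMul [CompleteSpace V] {u : 𝓢'(E3, ℂ)} {w : 𝓢'(E3, V)}
    {f : E3 → ℂ} {g : E3 → V} (hu : IsHat u f) (hw : IsHat w g) (hf : Integrable f)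
    (hg : Integrable g) : IsHat (distrMul u w)
      fun ξ => (((2 * Real.pi) ^ 3 : ℝ) : ℂ)⁻¹ • ∫ η, f (ξ - η) • g η := by
  have hc := (integrable_convolution_smul hf hg).smul (((2 * Real.pi) ^ 3 : ℝ) : ℂ)⁻¹
  have ht : TemperedIntegrable
      fun ξ => (((2 * Real.pi) ^ 3 : ℝ) : ℂ)⁻¹ • ∫ η, f (ξ - η) • g η := by
    have hw : Continuous fun ξ : E3 => (1 + ‖ξ‖ ^ 2 : ℝ)⁻¹ :=
      Continuous.inv₀ (by fun_prop) fun ξ => by positivity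
    refine hc.mono (hw.aestronglyMeasurable.smul hc.aestronglyMeasurable)
      (Eventually.of_forall fun ξ => ?_)
    rw [norm_smul, Real.norm_of_nonneg (by positivity)]
    exact mul_le_of_le_one_left (norm_nonneg _)
      (inv_le_one_of_one_le₀ (by nlinarith [sq_nonneg ‖ξ‖]))
  refine ht.isHat_ofHat_congr (Eventually.of_forall fun ξ => ?_)
  change _ • _ = _ • _
  congr 1
  refine integral_congr_ae ?_
  filter_upwards [hw.hat_ae_eq,
    (quasiMeasurePreserving_sub_left volume ξ).ae hu.hat_ae_eq] with η h1 h2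
  rw [h1, h2]

theorem IsHat.transport [CompleteSpace V] {u : 𝓢'(E3, C3)} {w : 𝓢'(E3, V)}
    {f : E3 → C3} {g : E3 → V} (hu : IsHat u f) (hw : IsHat w g) (hf : Integrable f)
    (hg : Integrable g) : IsHat (transport u w) (transportHat f g) := by
  have := IsHat.sum Finset.univ fun (j : Fin 3) _ =>
    (isHat_distrMul (hu.component j) hw
      ((EuclideanSpace.proj j : C3 →L[ℂ] ℂ).integrable_comp hf) hg).lineDeriv j
  refine this.congr_ae (Eventually.of_forall fun ξ => ?_)
  simp [transportHat, Finset.sum_apply]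

end FourierMultipliers

/-! ### Real-valued distributions -/

section RealDistributions

theorem fourierInv_neg_of_real {φ : 𝓢(E3, ℂ)} (hφ : ∀ x, (φ x).im = 0) (ζ : E3) :
    (𝓕⁻ φ) (-ζ) = (starRingEnd ℂ) ((𝓕⁻ φ) ζ) := by
  rw [SchwartzMap.fourierInv_coe, Real.fourierInv_eq', Real.fourierInv_eq', ← integral_conj]
  refine integral_congr_ae (Eventually.of_forall fun v => ?_)
  simp only [smul_eq_mul, map_mul, ← Complex.exp_conj, Complex.conj_I, Complex.conj_ofReal,
    Complex.conj_eq_iff_im.mpr (hφ v), inner_neg_right]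
  congr 2
  push_cast
  ring

/-- Conjugation of the pairings with real test functions reflects and conjugates the Fourier
transform. -/
theorem IsHat.conj_apply {f : 𝓢'(E3, ℂ)} {g : E3 → ℂ} (h : IsHat f g) {φ : 𝓢(E3, ℂ)}
    (hφ : ∀ x, (φ x).im = 0) : (starRingEnd ℂ) (f φ) =
      ∫ ζ : E3, (𝓕⁻ φ) ζ • (starRingEnd ℂ) (g (-((2 * Real.pi) • ζ))) := by
  rw [h.apply, ← integral_conj, ← integral_neg_eq_self]
  refine integral_congr_ae (Eventually.of_forall fun ζ => ?_)
  simp only [smul_eq_mul, map_mul, fourierInv_neg_of_real hφ, Complex.conj_conj, smul_neg]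

/-- A distribution is real-valued exactly if its Fourier transform is Hermitian. -/
theorem IsHat.isRealDistr_iff {f : 𝓢'(E3, ℂ)} {g : E3 → ℂ} (h : IsHat f g)
    (ht : TemperedIntegrable g) :
    IsRealDistr f ↔ ∀ᵐ ξ : E3, (starRingEnd ℂ) (g (-ξ)) = g ξ := by
  constructor
  · intro hr
    have ht' : TemperedIntegrable fun ξ => (starRingEnd ℂ) (g (-ξ)) := by
      have h1 : Integrable fun ξ : E3 => (starRingEnd ℂ) ((1 + ‖ξ‖ ^ 2 : ℝ)⁻¹ • g ξ) :=
        Complex.conjCLE.toContinuousLinearMap.integrable_comp ht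
      refine h1.comp_neg.congr (Eventually.of_forall fun ξ => ?_)
      simp
    -- the pairing with `conj (g (-ξ))` agrees with `f` on real test functions, hence on all
    obtain ⟨f', hf'⟩ := ht'.exists_isHat
    have key : ∀ φ : 𝓢(E3, ℂ), (∀ x, (φ x).im = 0) → f' φ = f φ := by
      intro φ hφ
      rw [hf'.apply, ← h.conj_apply hφ]
      exact Complex.conj_eq_iff_im.mpr (hr φ hφ)
    have hff : f' = f := by
      ext φ
      let φ₁ : 𝓢(E3, ℂ) := SchwartzMap.postcompCLM (Complex.ofRealCLM ∘L Complex.reCLM) φ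
      let φ₂ : 𝓢(E3, ℂ) := SchwartzMap.postcompCLM (Complex.ofRealCLM ∘L Complex.imCLM) φ
      have hd : φ = φ₁ + Complex.I • φ₂ := by
        ext x
        simp [φ₁, φ₂, SchwartzMap.postcompCLM_apply, mul_comm Complex.I, Complex.re_add_im]
      rw [hd, map_add, map_add, map_smul, map_smul, key φ₁, key φ₂]
      · intro x; simp [φ₂, SchwartzMap.postcompCLM_apply]
      · intro x; simp [φ₁, SchwartzMap.postcompCLM_apply]
    rw [hff] at hf'
    exact hf'.ae_eq h
  · intro hr φ hφ
    rw [← Complex.conj_eq_iff_im, h.conj_apply hφ, h.apply]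
    exact integral_congr_ae (integral_comp_two_pi_congr (g := fun ξ => (starRingEnd ℂ) (g (-ξ)))
      hr _)

end RealDistributions

/-! ### Time integrals in the space of distributions -/

section TimeIntegrals

instance isFiniteMeasure_timeMeasure (T : ℝ) : IsFiniteMeasure (timeMeasure T) := by
  refine ⟨?_⟩
  rw [timeMeasure, comap_subtype_coe_apply measurableSet_Icc, image_univ, Subtype.range_coe]
  simp

instance nullSingletonClass_timeMeasure (T : ℝ) : NullSingletonClass (timeMeasure T) := by
  refine ⟨fun t => ?_⟩
  rw [timeMeasure, comap_subtype_coe_apply measurableSet_Icc]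
  simp

theorem timeMeasure_univ (T : ℝ) : timeMeasure T univ = ENNReal.ofReal T := by
  rw [timeMeasure, comap_subtype_coe_apply measurableSet_Icc, image_univ, Subtype.range_coe]
  simp

variable {V : Type*} [NormedAddCommGroup V] [NormedSpace ℂ V]

theorem HasTimeIntegral.unique {T : ℝ} {t : Icc (0 : ℝ) T} {G : Icc (0 : ℝ) T → 𝓢'(E3, V)}
    {I J : 𝓢'(E3, V)} (hI : HasTimeIntegral t G I) (hJ : HasTimeIntegral t G J) : I = J := by
  ext φ
  rw [(hI φ).2, (hJ φ).2]

theorem integral_comp_two_pi (ψ : E3 → ℂ) (g : E3 → V) :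
    ∫ ζ : E3, ψ ζ • g ((2 * Real.pi) • ζ)
      = |((2 * Real.pi) ^ Module.finrank ℝ E3)⁻¹| • ∫ ξ, ψ ((2 * Real.pi)⁻¹ • ξ) • g ξ := by
  have hpi : (2 * Real.pi) ≠ 0 := by positivity
  rw [← Measure.integral_comp_smul volume (fun ξ => ψ ((2 * Real.pi)⁻¹ • ξ) • g ξ) (2 * Real.pi)]
  simp only [inv_smul_smul₀ hpi]

/-- The time integral in `𝓢'` is the pointwise time integral of the Fourier transforms. -/
theorem exists_hasTimeIntegral [CompleteSpace V] {T : ℝ} (t : Icc (0 : ℝ) T)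
    {G : Icc (0 : ℝ) T → 𝓢'(E3, V)} {H : Icc (0 : ℝ) T → E3 → V}
    (hH : Integrable (fun p : Icc (0 : ℝ) T × E3 => (1 + ‖p.2‖ ^ 2 : ℝ)⁻¹ • H p.1 p.2)
      (((timeMeasure T).restrict (Iic t)).prod volume))
    (hG : ∀ᵐ τ ∂(timeMeasure T).restrict (Iic t), IsHat (G τ) (H τ)) :
    ∃ J, IsHat J (fun ξ => ∫ τ in Iic t, H τ ξ ∂timeMeasure T) ∧ HasTimeIntegral t G J := by
  have ht : TemperedIntegrable fun ξ => ∫ τ in Iic t, H τ ξ ∂timeMeasure T := by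
    refine hH.integral_prod_right.congr (Eventually.of_forall fun ξ => ?_)
    exact integral_smul (1 + ‖ξ‖ ^ 2 : ℝ)⁻¹ fun τ => H τ ξ
  obtain ⟨J, hJ⟩ := ht.exists_isHat
  refine ⟨J, hJ, fun φ => ?_⟩
  -- Fubini for the pairing with `φ`, after rescaling the frequency
  have hc : Integrable (fun p : Icc (0 : ℝ) T × E3 => (𝓕⁻ φ) ((2 * Real.pi)⁻¹ • p.2) • H p.1 p.2)
      (((timeMeasure T).restrict (Iic t)).prod volume) := by
    obtain ⟨C, -, hC⟩ := schwartz_weight_bound (𝓕⁻ φ)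
    have hcont : Continuous fun p : Icc (0 : ℝ) T × E3 =>
        (𝓕⁻ φ) ((2 * Real.pi)⁻¹ • p.2) * ((1 + ‖p.2‖ ^ 2 : ℝ) : ℂ) := by
      have := (𝓕⁻ φ).continuous
      fun_prop
    have hpi : (2 * Real.pi) ≠ 0 := by positivity
    have := hH.bdd_smul C hcont.aestronglyMeasurable (Eventually.of_forall fun p => by
      rw [norm_mul, Complex.norm_real, Real.norm_of_nonneg (by positivity)]
      have := hC ((2 * Real.pi)⁻¹ • p.2)
      rwa [smul_inv_smul₀ hpi] at this)
    refine this.congr (Eventually.of_forall fun p => ?_)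
    simp only [Pi.smul_apply', mul_smul, Complex.coe_smul]
    rw [smul_inv_smul₀ (by positivity)]
  have hGe : (fun τ => |((2 * Real.pi) ^ Module.finrank ℝ E3)⁻¹| •
      ∫ ξ, (𝓕⁻ φ) ((2 * Real.pi)⁻¹ • ξ) • H τ ξ)
        =ᵐ[(timeMeasure T).restrict (Iic t)] fun τ => G τ φ := by
    filter_upwards [hG] with τ hτ
    rw [hτ.apply, integral_comp_two_pi]
  refine ⟨(hc.integral_prod_left.smul _).congr hGe, ?_⟩
  rw [← integral_congr_ae hGe, integral_smul, integral_integral_swap hc, hJ.apply,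
    integral_comp_two_pi (𝓕⁻ φ : 𝓢(E3, ℂ)) fun ξ => ∫ τ in Iic t, H τ ξ ∂timeMeasure T]
  simp only [integral_smul]

end TimeIntegrals

/-! ### The weights and the norm of the Lei–Lin–Gevrey spaces -/

section Weights

theorem leiLinWeight_nonneg (a σ r : ℝ) (ξ : E3) : 0 ≤ leiLinWeight a σ r ξ := by
  unfold leiLinWeight
  positivity

theorem leiLinWeight_pos (a σ r : ℝ) {ξ : E3} (hξ : ξ ≠ 0) : 0 < leiLinWeight a σ r ξ := by
  unfold leiLinWeight
  have : 0 < ‖ξ‖ := norm_pos_iff.mpr hξ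
  positivity

theorem leiLinWeight_add (a σ r p : ℝ) {ξ : E3} (hξ : ξ ≠ 0) :
    leiLinWeight a σ (r + p) ξ = ‖ξ‖ ^ p * leiLinWeight a σ r ξ := by
  unfold leiLinWeight
  rw [Real.rpow_add (norm_pos_iff.mpr hξ)]
  ring

theorem one_le_leiLinWeight_zero {a σ : ℝ} (ha : 0 ≤ a) (ξ : E3) : 1 ≤ leiLinWeight a σ 0 ξ := by
  unfold leiLinWeight
  rw [Real.rpow_zero, one_mul]
  exact Real.one_le_exp (by positivity)

theorem ae_ne_zero : ∀ᵐ ξ : E3, ξ ≠ 0 := by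
  simp [ae_iff]

/-- The weight `|ξ|^s e^{a|ξ|^{1/σ}} |ξ|` is subadditive along `ξ = (ξ - η) + η`, up to the Gevrey
weights. -/
theorem leiLinWeight_mul_norm_le {a σ s : ℝ} (ha : 0 ≤ a) (hσ : 1 ≤ σ) (hs : -1 ≤ s) (hs0 : s ≤ 0)
    (ξ η : E3) : leiLinWeight a σ s ξ * ‖ξ‖ ≤
      leiLinWeight a σ (s + 1) (ξ - η) * leiLinWeight a σ 0 η
        + leiLinWeight a σ 0 (ξ - η) * leiLinWeight a σ (s + 1) η := by
  unfold leiLinWeight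
  have hz : ‖ξ‖ ≤ ‖ξ - η‖ + ‖η‖ := by simpa using norm_add_le (ξ - η) η
  have hx := norm_nonneg (ξ - η)
  have hy := norm_nonneg η
  have hz0 := norm_nonneg ξ
  generalize ‖ξ - η‖ = x at *
  generalize ‖η‖ = y at *
  generalize ‖ξ‖ = z at *
  have hσ0 : 0 ≤ 1 / σ := by positivity
  have hσ1 : 1 / σ ≤ 1 := by
    rw [div_le_one (by linarith)]
    exact hσ
  have h1 : z ^ s * z ≤ x ^ (s + 1) + y ^ (s + 1) := by
    rcases hz0.eq_or_lt with rfl | hzp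
    · rw [mul_zero]
      positivity
    · rw [← Real.rpow_add_one hzp.ne']
      exact (Real.rpow_le_rpow hz0 hz (by linarith)).trans
        (Real.rpow_add_le_add_rpow hx hy (by linarith) (by linarith))
  have h2 : Real.exp (a * z ^ (1 / σ)) ≤ Real.exp (a * x ^ (1 / σ)) * Real.exp (a * y ^ (1 / σ)) := by
    rw [← Real.exp_add, Real.exp_le_exp, ← mul_add]
    gcongr
    exact (Real.rpow_le_rpow hz0 hz hσ0).trans (Real.rpow_add_le_add_rpow hx hy hσ0 hσ1)
  rw [Real.rpow_zero, Real.rpow_zero]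
  calc z ^ s * Real.exp (a * z ^ (1 / σ)) * z = (z ^ s * z) * Real.exp (a * z ^ (1 / σ)) := by ring
    _ ≤ (x ^ (s + 1) + y ^ (s + 1)) *
        (Real.exp (a * x ^ (1 / σ)) * Real.exp (a * y ^ (1 / σ))) := by gcongr
    _ = _ := by ring

variable {V : Type*} [NormedAddCommGroup V]

/-- `∫ |ξ|^r e^{a|ξ|^{1/σ}} |g(ξ)| dξ`. -/
noncomputable def xNorm (a σ r : ℝ) (g : E3 → V) : ℝ≥0∞ :=
  ∫⁻ ξ, ENNReal.ofReal (leiLinWeight a σ r ξ) * ‖g ξ‖ₑ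

theorem measurable_ofReal_leiLinWeight (a σ r : ℝ) :
    Measurable fun ξ => ENNReal.ofReal (leiLinWeight a σ r ξ) :=
  (measurable_leiLinWeight a σ r).ennreal_ofReal

theorem xNorm_congr (a σ r : ℝ) {g g' : E3 → V} (h : g =ᵐ[volume] g') :
    xNorm a σ r g = xNorm a σ r g' :=
  lintegral_congr_ae (by filter_upwards [h] with ξ hξ; rw [hξ])

theorem xNorm_le_mul (a σ r : ℝ) {W : Type*} [NormedAddCommGroup W] {g : E3 → V} {g' : E3 → W}
    {c : ℝ≥0∞} (hc : c ≠ ⊤) (h : ∀ᵐ ξ, ‖g ξ‖ₑ ≤ c * ‖g' ξ‖ₑ) :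
    xNorm a σ r g ≤ c * xNorm a σ r g' := by
  unfold xNorm
  rw [← lintegral_const_mul' _ _ hc]
  refine lintegral_mono_ae ?_
  filter_upwards [h] with ξ hξ
  calc _ ≤ ENNReal.ofReal (leiLinWeight a σ r ξ) * (c * ‖g' ξ‖ₑ) := by gcongr
    _ = _ := by ring

theorem xNorm_add_le (a σ r : ℝ) {g g' : E3 → V} (hg : AEStronglyMeasurable g) :
    xNorm a σ r (fun ξ => g ξ + g' ξ) ≤ xNorm a σ r g + xNorm a σ r g' := by
  have hm : AEMeasurable fun ξ => ENNReal.ofReal (leiLinWeight a σ r ξ) * ‖g ξ‖ₑ :=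
    (measurable_ofReal_leiLinWeight a σ r).aemeasurable.mul hg.enorm
  unfold xNorm
  rw [← lintegral_add_left' hm]
  refine lintegral_mono fun ξ => ?_
  rw [← mul_add]
  gcongr
  exact enorm_add_le _ _

theorem xNorm_zero (a σ r : ℝ) : xNorm a σ r (fun _ : E3 => (0 : V)) = 0 := by
  simp [xNorm]

theorem ae_eq_zero_of_xNorm_eq_zero {a σ r : ℝ} {g : E3 → V} (hg : AEStronglyMeasurable g)
    (h : xNorm a σ r g = 0) : g =ᵐ[volume] 0 := by
  replace h := (lintegral_eq_zero_iff'
    ((measurable_ofReal_leiLinWeight a σ r).aemeasurable.mul hg.enorm)).mp h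
  filter_upwards [h, ae_ne_zero] with ξ hξ hξ0
  have : ENNReal.ofReal (leiLinWeight a σ r ξ) ≠ 0 := by
    simpa using leiLinWeight_pos a σ r hξ0
  simpa [this] using hξ

/-- Hölder's inequality in frequency. -/
theorem xNorm_interpolate (a σ s b : ℝ) {l : ℝ} (h0 : 0 ≤ l) (h1 : l ≤ 1) {g : E3 → V}
    (hg : AEStronglyMeasurable g) :
    xNorm a σ (s + l * b) g ≤ xNorm a σ s g ^ (1 - l) * xNorm a σ (s + b) g ^ l := by
  have hm : ∀ r, AEMeasurable fun ξ => ENNReal.ofReal (leiLinWeight a σ r ξ) * ‖g ξ‖ₑ := fun r =>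
    (measurable_ofReal_leiLinWeight a σ r).aemeasurable.mul hg.enorm
  refine le_trans (le_of_eq ?_) (ENNReal.lintegral_mul_norm_pow_le (hm s) (hm (s + b))
    (sub_nonneg.mpr h1) h0 (by ring))
  refine lintegral_congr_ae ?_
  filter_upwards [ae_ne_zero] with ξ hξ
  have hw := leiLinWeight_pos a σ s hξ
  have hn : 0 < ‖ξ‖ := norm_pos_iff.mpr hξ
  rw [ENNReal.mul_rpow_of_nonneg _ _ (sub_nonneg.mpr h1), ENNReal.mul_rpow_of_nonneg _ _ h0,
    ENNReal.ofReal_rpow_of_nonneg hw.le (sub_nonneg.mpr h1),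
    ENNReal.ofReal_rpow_of_nonneg (leiLinWeight_nonneg _ _ _ _) h0, leiLinWeight_add _ _ s b hξ,
    leiLinWeight_add _ _ s (l * b) hξ, mul_mul_mul_comm,
    ← ENNReal.rpow_add_of_nonneg _ _ (sub_nonneg.mpr h1) h0, ← ENNReal.ofReal_mul (by positivity)]
  have e : leiLinWeight a σ s ξ ^ (1 - l) * (‖ξ‖ ^ b * leiLinWeight a σ s ξ) ^ l
      = ‖ξ‖ ^ (l * b) * leiLinWeight a σ s ξ := by
    rw [Real.mul_rpow (by positivity) hw.le, ← Real.rpow_mul hn.le, mul_comm b l]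
    calc _ = ‖ξ‖ ^ (l * b) * (leiLinWeight a σ s ξ ^ (1 - l) * leiLinWeight a σ s ξ ^ l) := by ring
      _ = _ := by rw [← Real.rpow_add hw]; simp
  rw [e]
  simp

theorem integrable_of_xNorm_zero_lt_top {a σ : ℝ} (ha : 0 ≤ a) {g : E3 → V}
    (hg : AEStronglyMeasurable g) (h : xNorm a σ 0 g < ⊤) : Integrable g := by
  refine ⟨hg, lt_of_le_of_lt (lintegral_mono fun ξ => ?_) h⟩
  have : 1 ≤ ENNReal.ofReal (leiLinWeight a σ 0 ξ) := by
    simpa using one_le_leiLinWeight_zero (σ := σ) ha ξ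
  exact le_mul_of_one_le_left' this

/-- The condition `s ≤ 0` is used at low and `s ≥ -1` at high frequencies. -/
theorem inv_one_add_sq_le_leiLinWeight {a σ s : ℝ} (ha : 0 ≤ a) (hs : -1 ≤ s) (hs0 : s ≤ 0)
    {ξ : E3} (hξ : ξ ≠ 0) : (1 + ‖ξ‖ ^ 2)⁻¹ ≤ leiLinWeight a σ s ξ := by
  have hn : 0 < ‖ξ‖ := norm_pos_iff.mpr hξ
  have h1 : (1 + ‖ξ‖ ^ 2)⁻¹ ≤ ‖ξ‖ ^ s := by
    rcases le_total ‖ξ‖ 1 with h | h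
    · exact (inv_le_one_of_one_le₀ (by nlinarith)).trans
        (Real.one_le_rpow_of_pos_of_le_one_of_nonpos hn h hs0)
    · calc (1 + ‖ξ‖ ^ 2)⁻¹ ≤ ‖ξ‖⁻¹ := by
            apply inv_anti₀ hn
            nlinarith
        _ = ‖ξ‖ ^ (-1 : ℝ) := by rw [Real.rpow_neg_one]
        _ ≤ _ := Real.rpow_le_rpow_of_exponent_le h hs
  unfold leiLinWeight
  exact h1.trans (le_mul_of_one_le_right (by positivity) (Real.one_le_exp (by positivity)))

theorem temperedIntegrable_of_xNorm_lt_top [NormedSpace ℂ V] {a σ s : ℝ} (ha : 0 ≤ a)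
    (hs : -1 ≤ s) (hs0 : s ≤ 0) {g : E3 → V} (hg : AEStronglyMeasurable g)
    (h : xNorm a σ s g < ⊤) : TemperedIntegrable g := by
  have hw : Measurable fun ξ : E3 => (1 + ‖ξ‖ ^ 2 : ℝ)⁻¹ := by fun_prop
  refine ⟨hw.aestronglyMeasurable.smul hg, lt_of_le_of_lt (lintegral_mono_ae ?_) h⟩
  filter_upwards [ae_ne_zero] with ξ hξ
  rw [enorm_smul]
  gcongr
  rw [Real.enorm_eq_ofReal (by positivity)]
  exact ENNReal.ofReal_le_ofReal (inv_one_add_sq_le_leiLinWeight ha hs hs0 hξ)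

end Weights

/-! ### The transport term at a fixed time -/

section Bilinear

variable {V : Type*} [NormedAddCommGroup V]

/-- The convolution of nonnegative functions is integrated by Tonelli and translation
invariance. -/
theorem lintegral_convolution {F G : E3 → ℝ≥0∞} (hF : Measurable F) (hG : Measurable G) :
    ∫⁻ ξ, ∫⁻ η, F (ξ - η) * G η = (∫⁻ ξ, F ξ) * ∫⁻ η, G η := by
  rw [lintegral_lintegral_swap
    ((hF.comp (by fun_prop : Measurable fun p : E3 × E3 => p.1 - p.2)).mul
      (hG.comp measurable_snd)).aemeasurable]
  have : ∀ η, ∫⁻ ξ, F (ξ - η) * G η = (∫⁻ ξ, F ξ) * G η := by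
    intro η
    rw [lintegral_mul_const _ (by fun_prop), lintegral_sub_right_eq_self]
  simp_rw [this]
  rw [lintegral_const_mul _ hG]

theorem measurable_convolution {F G : E3 → ℝ≥0∞} (hF : Measurable F) (hG : Measurable G) :
    Measurable fun ξ => ∫⁻ η, F (ξ - η) * G η :=
  Measurable.lintegral_prod_right' (f := fun p : E3 × E3 => F (p.1 - p.2) * G p.2)
    ((hF.comp (by fun_prop : Measurable fun p : E3 × E3 => p.1 - p.2)).mul
      (hG.comp measurable_snd))

theorem lintegral_weight_convolution_le {a σ s : ℝ} (ha : 0 ≤ a) (hσ : 1 ≤ σ) (hs : -1 ≤ s)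
    (hs0 : s ≤ 0) {W : Type*} [NormedAddCommGroup W] {f : E3 → W} {g : E3 → V}
    (hf : StronglyMeasurable f) (hg : StronglyMeasurable g) :
    ∫⁻ ξ, ENNReal.ofReal (leiLinWeight a σ s ξ * ‖ξ‖) * ∫⁻ η, ‖f (ξ - η)‖ₑ * ‖g η‖ₑ
      ≤ xNorm a σ (s + 1) f * xNorm a σ 0 g + xNorm a σ 0 f * xNorm a σ (s + 1) g := by
  obtain ⟨F, hFd⟩ : ∃ F : ℝ → E3 → ℝ≥0∞,
    F = fun r ξ => ENNReal.ofReal (leiLinWeight a σ r ξ) * ‖f ξ‖ₑ := ⟨_, rfl⟩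
  obtain ⟨G, hGd⟩ : ∃ G : ℝ → E3 → ℝ≥0∞,
    G = fun r ξ => ENNReal.ofReal (leiLinWeight a σ r ξ) * ‖g ξ‖ₑ := ⟨_, rfl⟩
  have hF : ∀ r, Measurable (F r) := fun r => by
    rw [hFd]
    exact (measurable_ofReal_leiLinWeight a σ r).mul hf.enorm
  have hG : ∀ r, Measurable (G r) := fun r => by
    rw [hGd]
    exact (measurable_ofReal_leiLinWeight a σ r).mul hg.enorm
  have hXF : ∀ r, xNorm a σ r f = ∫⁻ ξ, F r ξ := fun r => by rw [hFd]; rfl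
  have hXG : ∀ r, xNorm a σ r g = ∫⁻ ξ, G r ξ := fun r => by rw [hGd]; rfl
  have hfm : Measurable fun ξ => ‖f ξ‖ₑ := hf.enorm
  have hgm : Measurable fun ξ => ‖g ξ‖ₑ := hg.enorm
  rw [hXF, hXF, hXG, hXG, ← lintegral_convolution (hF (s + 1)) (hG 0),
    ← lintegral_convolution (hF 0) (hG (s + 1)),
    ← lintegral_add_left (measurable_convolution (hF (s + 1)) (hG 0))]
  refine lintegral_mono fun ξ => ?_
  have hm1 : Measurable fun η => F (s + 1) (ξ - η) * G 0 η :=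
    ((hF _).comp (measurable_const.sub measurable_id)).mul (hG 0)
  have hm2 : Measurable fun η => ‖f (ξ - η)‖ₑ * ‖g η‖ₑ :=
    (hfm.comp (measurable_const.sub measurable_id)).mul hgm
  rw [← lintegral_const_mul _ hm2, ← lintegral_add_left hm1]
  refine lintegral_mono fun η => ?_
  have h := ENNReal.ofReal_le_ofReal (leiLinWeight_mul_norm_le ha hσ hs hs0 ξ η)
  rw [ENNReal.ofReal_add (mul_nonneg (leiLinWeight_nonneg _ _ _ _) (leiLinWeight_nonneg _ _ _ _))
    (mul_nonneg (leiLinWeight_nonneg _ _ _ _) (leiLinWeight_nonneg _ _ _ _)),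
    ENNReal.ofReal_mul (q := leiLinWeight a σ 0 η) (leiLinWeight_nonneg _ _ _ _),
    ENNReal.ofReal_mul (q := leiLinWeight a σ (s + 1) η) (leiLinWeight_nonneg _ _ _ _)] at h
  rw [hFd, hGd]
  calc _ ≤ (ENNReal.ofReal (leiLinWeight a σ (s + 1) (ξ - η)) *
        ENNReal.ofReal (leiLinWeight a σ 0 η) + ENNReal.ofReal (leiLinWeight a σ 0 (ξ - η)) *
        ENNReal.ofReal (leiLinWeight a σ (s + 1) η)) * (‖f (ξ - η)‖ₑ * ‖g η‖ₑ) := by gcongr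
    _ = _ := by ring

variable [NormedSpace ℂ V]

theorem enorm_transportHat_le (f : E3 → C3) (g : E3 → V) (ξ : E3) :
    ‖transportHat f g ξ‖ₑ ≤ 3 * (ENNReal.ofReal ‖ξ‖ * ∫⁻ η, ‖f (ξ - η)‖ₑ * ‖g η‖ₑ) := by
  have h1 : ∀ j : Fin 3, ‖(Complex.I * ((ξ j : ℝ) : ℂ)) •
      (((2 * Real.pi) ^ 3 : ℝ) : ℂ)⁻¹ • ∫ η, f (ξ - η) j • g η‖ₑ
        ≤ ENNReal.ofReal ‖ξ‖ * ∫⁻ η, ‖f (ξ - η)‖ₑ * ‖g η‖ₑ := by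
    intro j
    rw [enorm_smul, enorm_smul]
    have h2 : ‖(Complex.I * ((ξ j : ℝ) : ℂ))‖ₑ ≤ ENNReal.ofReal ‖ξ‖ := by
      rw [← ofReal_norm, norm_mul, Complex.norm_I, one_mul, Complex.norm_real]
      exact ENNReal.ofReal_le_ofReal (PiLp.norm_apply_le ξ j)
    have h3 : ‖(((2 * Real.pi) ^ 3 : ℝ) : ℂ)⁻¹‖ₑ ≤ 1 := by
      rw [← ofReal_norm, norm_inv, Complex.norm_real, Real.norm_of_nonneg (by positivity),
        ENNReal.ofReal_le_one]
      exact inv_le_one_of_one_le₀ (one_le_pow₀ (by linarith [Real.pi_gt_three]))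
    have h4 : ‖∫ η, f (ξ - η) j • g η‖ₑ ≤ ∫⁻ η, ‖f (ξ - η)‖ₑ * ‖g η‖ₑ := by
      refine (enorm_integral_le_lintegral_enorm _).trans (lintegral_mono fun η => ?_)
      rw [enorm_smul]
      gcongr
      exact enorm_le_iff_norm_le.mpr (PiLp.norm_apply_le (f (ξ - η)) j)
    calc _ ≤ ENNReal.ofReal ‖ξ‖ * (1 * ∫⁻ η, ‖f (ξ - η)‖ₑ * ‖g η‖ₑ) := by gcongr
      _ = _ := by rw [one_mul]
  unfold transportHat
  refine (enorm_sum_le _ _).trans ((Finset.sum_le_sum fun j _ => h1 j).trans ?_)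
  simp

/-- The product estimate at a fixed time; the derivative in the transport term is carried by one
factor, which is measured in `𝒳^{s+1}`. -/
theorem xNorm_transportHat_le {a σ s : ℝ} (ha : 0 ≤ a) (hσ : 1 ≤ σ) (hs : -1 ≤ s)
    (hs0 : s ≤ 0) {f : E3 → C3} {g : E3 → V}
    (hf : StronglyMeasurable f) (hg : StronglyMeasurable g) :
    xNorm a σ s (transportHat f g)
      ≤ 3 * (xNorm a σ (s + 1) f * xNorm a σ 0 g + xNorm a σ 0 f * xNorm a σ (s + 1) g) := by
  refine le_trans ?_ (mul_le_mul_right (lintegral_weight_convolution_le ha hσ hs hs0 hf hg) 3)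
  rw [← lintegral_const_mul' _ _ (by simp)]
  refine lintegral_mono fun ξ => ?_
  rw [ENNReal.ofReal_mul (leiLinWeight_nonneg _ _ _ _)]
  calc _ ≤ ENNReal.ofReal (leiLinWeight a σ s ξ) *
        (3 * (ENNReal.ofReal ‖ξ‖ * ∫⁻ η, ‖f (ξ - η)‖ₑ * ‖g η‖ₑ)) := by
        gcongr
        exact enorm_transportHat_le f g ξ
    _ = _ := by ring

theorem ae_integrable_convolution {f : E3 → C3} {g : E3 → V} (hf : Integrable f)
    (hg : Integrable g) : ∀ᵐ ξ, ∀ j : Fin 3, Integrable fun η => f (ξ - η) j • g η := by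
  rw [ae_all_iff]
  intro j
  have hfj : Integrable fun ξ => f ξ j :=
    (EuclideanSpace.proj j : C3 →L[ℂ] ℂ).integrable_comp hf
  have h := Integrable.ae_convolution_exists (μ := (volume : Measure E3))
    (ContinuousLinearMap.lsmul ℂ ℂ : ℂ →L[ℂ] V →L[ℂ] V).flip hg hfj
  filter_upwards [h] with ξ hξ
  exact hξ

/-- Bilinearity of the transport term, at those frequencies where the convolutions converge. -/
theorem transportHat_sub_ae {f f' : E3 → C3} {g g' : E3 → V} (hf : Integrable f)
    (hf' : Integrable f') (hg : Integrable g) (hg' : Integrable g') :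
    ∀ᵐ ξ, transportHat f g ξ - transportHat f' g' ξ
      = transportHat (f - f') g ξ + transportHat f' (g - g') ξ := by
  filter_upwards [ae_integrable_convolution hf hg, ae_integrable_convolution hf' hg',
    ae_integrable_convolution hf' hg] with ξ h1 h2 h3
  unfold transportHat
  rw [← Finset.sum_sub_distrib, ← Finset.sum_add_distrib]
  refine Finset.sum_congr rfl fun j _ => ?_
  rw [← smul_sub, ← smul_sub, ← smul_add, ← smul_add]
  congr 2
  simp only [Pi.sub_apply, PiLp.sub_apply, sub_smul, smul_sub]
  rw [integral_sub (h1 j) (h3 j), integral_sub (h3 j) (h2 j)]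
  abel

end Bilinear

/-! ### Space-time norms -/

section SpaceTimeNorms

variable {V : Type*} [NormedAddCommGroup V] {T : ℝ}

/-- `sup_t ∫ |ξ|^s e^{a|ξ|^{1/σ}} |U(t, ξ)| dξ`, a supremum over every time. -/
noncomputable def supNorm (a σ s : ℝ) (U : Icc (0 : ℝ) T → E3 → V) : ℝ≥0∞ :=
  ⨆ t, xNorm a σ s (U t)

/-- `∫₀ᵀ ∫ |ξ|^r e^{a|ξ|^{1/σ}} |U(t, ξ)| dξ dt`. -/
noncomputable def timeNorm (a σ r : ℝ) (U : Icc (0 : ℝ) T → E3 → V) : ℝ≥0∞ :=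
  ∫⁻ t, xNorm a σ r (U t) ∂timeMeasure T

/-- The norm of `L^∞_T(𝒳^s) ∩ L¹_T(𝒳^{s+2γ})` on the Fourier side. -/
noncomputable def energy (a σ s γ : ℝ) (U : Icc (0 : ℝ) T → E3 → V) : ℝ≥0∞ :=
  supNorm a σ s U + timeNorm a σ (s + 2 * γ) U

theorem section_stronglyMeasurable {U : Icc (0 : ℝ) T → E3 → V}
    (hU : StronglyMeasurable (Function.uncurry U)) (t : Icc (0 : ℝ) T) :
    StronglyMeasurable (U t) :=
  hU.comp_measurable measurable_prodMk_left

theorem measurable_weight_enorm (a σ r : ℝ) {U : Icc (0 : ℝ) T → E3 → V}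
    (hU : StronglyMeasurable (Function.uncurry U)) :
    Measurable fun p : Icc (0 : ℝ) T × E3 =>
      ENNReal.ofReal (leiLinWeight a σ r p.2) * ‖U p.1 p.2‖ₑ :=
  ((measurable_ofReal_leiLinWeight a σ r).comp measurable_snd).mul hU.enorm

theorem measurable_xNorm (a σ r : ℝ) {U : Icc (0 : ℝ) T → E3 → V}
    (hU : StronglyMeasurable (Function.uncurry U)) : Measurable fun t => xNorm a σ r (U t) :=
  (measurable_weight_enorm a σ r hU).lintegral_prod_right'

theorem timeNorm_eq_lintegral_swap (a σ r : ℝ) {U : Icc (0 : ℝ) T → E3 → V}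
    (hU : StronglyMeasurable (Function.uncurry U)) : timeNorm a σ r U =
      ∫⁻ ξ, ENNReal.ofReal (leiLinWeight a σ r ξ) * ∫⁻ t, ‖U t ξ‖ₑ ∂timeMeasure T := by
  unfold timeNorm xNorm
  rw [lintegral_lintegral_swap (measurable_weight_enorm a σ r hU).aemeasurable]
  refine lintegral_congr fun ξ => ?_
  exact lintegral_const_mul' _ _ (by simp)

theorem timeNorm_le_supNorm (a σ s : ℝ) (U : Icc (0 : ℝ) T → E3 → V) :
    timeNorm a σ s U ≤ ENNReal.ofReal T * supNorm a σ s U := by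
  calc timeNorm a σ s U ≤ ∫⁻ _, supNorm a σ s U ∂timeMeasure T :=
        lintegral_mono fun t => le_iSup (fun t => xNorm a σ s (U t)) t
    _ = _ := by rw [lintegral_const, timeMeasure_univ, mul_comm]

theorem timeNorm_le_mul (a σ r : ℝ) {W : Type*} [NormedAddCommGroup W]
    {U : Icc (0 : ℝ) T → E3 → V} {U' : Icc (0 : ℝ) T → E3 → W} {c : ℝ≥0∞} (hc : c ≠ ⊤)
    (h : ∀ t ξ, ‖U t ξ‖ₑ ≤ c * ‖U' t ξ‖ₑ) : timeNorm a σ r U ≤ c * timeNorm a σ r U' := by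
  unfold timeNorm
  rw [← lintegral_const_mul' _ _ hc]
  exact lintegral_mono fun t => xNorm_le_mul a σ r hc (Eventually.of_forall (h t))

theorem timeNorm_add_le (a σ r : ℝ) {U U' : Icc (0 : ℝ) T → E3 → V}
    (hU : StronglyMeasurable (Function.uncurry U)) :
    timeNorm a σ r (fun t ξ => U t ξ + U' t ξ) ≤ timeNorm a σ r U + timeNorm a σ r U' := by
  unfold timeNorm
  rw [← lintegral_add_left (measurable_xNorm a σ r hU)]
  exact lintegral_mono fun t =>
    xNorm_add_le a σ r (section_stronglyMeasurable hU t).aestronglyMeasurable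

theorem timeNorm_congr (a σ r : ℝ) {U U' : Icc (0 : ℝ) T → E3 → V}
    (h : ∀ᵐ t ∂timeMeasure T, U t =ᵐ[volume] U' t) : timeNorm a σ r U = timeNorm a σ r U' :=
  lintegral_congr_ae (by filter_upwards [h] with t ht; exact xNorm_congr a σ r ht)

theorem timeNorm_neg (a σ r : ℝ) (U : Icc (0 : ℝ) T → E3 → V) :
    timeNorm a σ r (fun t ξ => -U t ξ) = timeNorm a σ r U := by
  simp [timeNorm, xNorm]

theorem ae_lintegral_lt_top_of_timeNorm {a σ s : ℝ} {F : Icc (0 : ℝ) T → E3 → V}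
    (hF : StronglyMeasurable (Function.uncurry F)) (h : timeNorm a σ s F < ⊤) :
    ∀ᵐ ξ, ∫⁻ τ, ‖F τ ξ‖ₑ ∂timeMeasure T < ⊤ := by
  rw [timeNorm_eq_lintegral_swap a σ s hF] at h
  have hm : Measurable fun ξ => ∫⁻ τ, ‖F τ ξ‖ₑ ∂timeMeasure T := hF.enorm.lintegral_prod_left'
  filter_upwards [ae_lt_top ((measurable_ofReal_leiLinWeight a σ s).mul hm) h.ne, ae_ne_zero]
    with ξ hξ h0
  have hw : ENNReal.ofReal (leiLinWeight a σ s ξ) ≠ 0 := by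
    simpa using leiLinWeight_pos a σ s h0
  by_contra hne
  rw [not_lt_top_iff] at hne
  simp [hne, hw] at hξ

end SpaceTimeNorms

/-! ### Time integrals of the heat kernel -/

section HeatKernel

/-- The kernel `e^{-x c}` for `x ≥ 0`, extended by zero. -/
noncomputable def decayKernel (c x : ℝ) : ℝ≥0∞ :=
  if 0 ≤ x then ENNReal.ofReal (Real.exp (-(x * c))) else 0

theorem decayKernel_le_one {c : ℝ} (hc : 0 ≤ c) (x : ℝ) : decayKernel c x ≤ 1 := by
  unfold decayKernel
  split_ifs with hx
  · rw [ENNReal.ofReal_le_one, Real.exp_le_one_iff, neg_nonpos]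
    positivity
  · simp

theorem measurable_decayKernel : Measurable fun p : ℝ × ℝ => decayKernel p.1 p.2 := by
  unfold decayKernel
  refine Measurable.ite (measurableSet_le measurable_const measurable_snd) ?_ measurable_const
  fun_prop

/-- `∫₀^∞ c e^{-xc} dx ≤ 1`, with equality unless `c = 0`. -/
theorem mul_lintegral_decayKernel_le {c : ℝ} (hc : 0 ≤ c) (T τ : ℝ) :
    ENNReal.ofReal c * ∫⁻ t : Icc (0 : ℝ) T, decayKernel c ((t : ℝ) - τ) ∂timeMeasure T ≤ 1 := by
  rcases hc.eq_or_lt with rfl | hc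
  · simp
  have h1 : ∫⁻ t : Icc (0 : ℝ) T, decayKernel c ((t : ℝ) - τ) ∂timeMeasure T
      ≤ ∫⁻ x : ℝ, decayKernel c (x - τ) := by
    have := (MeasurableEmbedding.subtype_coe (measurableSet_Icc (a := (0 : ℝ)) (b := T))).lintegral_map
      (μ := timeMeasure T) (fun x : ℝ => decayKernel c (x - τ))
    rw [← this, timeMeasure, map_comap_subtype_coe measurableSet_Icc]
    exact setLIntegral_le_lintegral _ _
  rw [lintegral_sub_right_eq_self] at h1
  refine (mul_le_mul_right h1 _).trans (le_of_eq ?_)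
  rw [← lintegral_const_mul' _ _ (by simp),
    ← ProbabilityTheory.lintegral_exponentialPDF_eq_one hc]
  refine lintegral_congr fun x => ?_
  rw [ProbabilityTheory.exponentialPDF_eq, decayKernel]
  split_ifs with hx
  · rw [← ENNReal.ofReal_mul hc.le, mul_comm c x]
  · simp

end HeatKernel

/-! ### The Duhamel formula -/

section Duhamel

variable {V : Type*} [NormedAddCommGroup V] [NormedSpace ℂ V] {T : ℝ}

/-- The Fourier transform of `e^{-t(-Δ)^γ} u₀ + ∫₀ᵗ e^{-(t-τ)(-Δ)^γ} F(τ) dτ`, where `g = û₀` and `F`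
stands for its own Fourier transform. -/
noncomputable def duhamel (γ : ℝ) (g : E3 → V) (F : Icc (0 : ℝ) T → E3 → V) (t : Icc (0 : ℝ) T)
    (ξ : E3) : V :=
  (Real.exp (-((t : ℝ) * ‖ξ‖ ^ (2 * γ))) : ℂ) • g ξ +
    ∫ τ in Iic t, (Real.exp (-(((t : ℝ) - τ) * ‖ξ‖ ^ (2 * γ))) : ℂ) • F τ ξ ∂timeMeasure T

theorem stronglyMeasurable_duhamel (γ : ℝ) {g : E3 → V} {F : Icc (0 : ℝ) T → E3 → V}
    (hg : StronglyMeasurable g) (hF : StronglyMeasurable (Function.uncurry F)) :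
    StronglyMeasurable (Function.uncurry (duhamel γ g F)) := by
  have h1 : Measurable fun p : Icc (0 : ℝ) T × E3 =>
      ((Real.exp (-((p.1 : ℝ) * ‖p.2‖ ^ (2 * γ))) : ℝ) : ℂ) := by fun_prop
  have h2 : Measurable fun q : (Icc (0 : ℝ) T × E3) × Icc (0 : ℝ) T =>
      ((Real.exp (-(((q.1.1 : ℝ) - q.2) * ‖q.1.2‖ ^ (2 * γ))) : ℝ) : ℂ) := by fun_prop
  have h3 : StronglyMeasurable fun q : (Icc (0 : ℝ) T × E3) × Icc (0 : ℝ) T => F q.2 q.1.2 :=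
    hF.comp_measurable (g := fun q : (Icc (0 : ℝ) T × E3) × Icc (0 : ℝ) T => (q.2, q.1.2))
      (by fun_prop)
  have hset : MeasurableSet {q : (Icc (0 : ℝ) T × E3) × Icc (0 : ℝ) T | q.2 ≤ q.1.1} :=
    measurableSet_le (by fun_prop) (by fun_prop)
  have h4 := ((h2.stronglyMeasurable.smul h3).indicator hset).integral_prod_right'
    (ν := timeMeasure T)
  convert! (h1.stronglyMeasurable.smul (hg.comp_measurable measurable_snd)).add h4 using 1
  ext1 p
  simp only [Function.uncurry, duhamel, Pi.add_apply, Pi.smul_apply', Function.comp_apply]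
  rw [← integral_indicator measurableSet_Iic]
  rfl

theorem enorm_duhamel_le (γ : ℝ) (g : E3 → V) (F : Icc (0 : ℝ) T → E3 → V) (t : Icc (0 : ℝ) T)
    (ξ : E3) : ‖duhamel γ g F t ξ‖ₑ ≤ decayKernel (‖ξ‖ ^ (2 * γ)) ((t : ℝ) - 0) * ‖g ξ‖ₑ
      + ∫⁻ τ, decayKernel (‖ξ‖ ^ (2 * γ)) ((t : ℝ) - τ) * ‖F τ ξ‖ₑ ∂timeMeasure T := by
  have he : ∀ x : ℝ, ‖(Real.exp x : ℂ)‖ₑ = ENNReal.ofReal (Real.exp x) := fun x => by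
    rw [← ofReal_norm, Complex.norm_real, Real.norm_of_nonneg (Real.exp_pos x).le]
  refine (enorm_add_le _ _).trans (add_le_add (le_of_eq ?_) ?_)
  · rw [enorm_smul, he, decayKernel, sub_zero, if_pos t.2.1]
  · refine (enorm_integral_le_lintegral_enorm _).trans ?_
    rw [← lintegral_indicator measurableSet_Iic]
    refine lintegral_mono fun τ => ?_
    by_cases h : τ ≤ t
    · rw [indicator_of_mem (mem_Iic.mpr h), enorm_smul, he, decayKernel,
        if_pos (sub_nonneg.mpr (Subtype.coe_le_coe.mpr h))]
    · rw [indicator_of_notMem (by simpa using h)]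
      simp

theorem enorm_duhamel_le_add (γ : ℝ) (g : E3 → V) (F : Icc (0 : ℝ) T → E3 → V)
    (t : Icc (0 : ℝ) T) (ξ : E3) :
    ‖duhamel γ g F t ξ‖ₑ ≤ ‖g ξ‖ₑ + ∫⁻ τ, ‖F τ ξ‖ₑ ∂timeMeasure T := by
  refine (enorm_duhamel_le γ g F t ξ).trans (add_le_add ?_ (lintegral_mono fun τ => ?_)) <;>
  exact mul_le_of_le_one_left' (decayKernel_le_one (by positivity) _)

theorem supNorm_duhamel_le (a σ s γ : ℝ) {g : E3 → V} {F : Icc (0 : ℝ) T → E3 → V}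
    (hg : StronglyMeasurable g) (hF : StronglyMeasurable (Function.uncurry F)) :
    supNorm a σ s (duhamel γ g F) ≤ xNorm a σ s g + timeNorm a σ s F := by
  have hm : Measurable fun ξ => ENNReal.ofReal (leiLinWeight a σ s ξ) * ‖g ξ‖ₑ :=
    (measurable_ofReal_leiLinWeight a σ s).mul hg.enorm
  refine iSup_le fun t => ?_
  rw [timeNorm_eq_lintegral_swap a σ s hF]
  unfold xNorm
  rw [← lintegral_add_left hm]
  refine lintegral_mono fun ξ => ?_
  rw [← mul_add]
  gcongr
  exact enorm_duhamel_le_add γ g F t ξ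

/-- Parabolic smoothing: the time integral of `|ξ|^{2γ} e^{-t|ξ|^{2γ}}` is at most one. -/
theorem timeNorm_duhamel_le (a σ s γ : ℝ) {g : E3 → V} {F : Icc (0 : ℝ) T → E3 → V}
    (hg : StronglyMeasurable g) (hF : StronglyMeasurable (Function.uncurry F)) :
    timeNorm a σ (s + 2 * γ) (duhamel γ g F) ≤ xNorm a σ s g + timeNorm a σ s F := by
  have hm : Measurable fun ξ => ENNReal.ofReal (leiLinWeight a σ s ξ) * ‖g ξ‖ₑ :=
    (measurable_ofReal_leiLinWeight a σ s).mul hg.enorm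
  rw [timeNorm_eq_lintegral_swap a σ _ (stronglyMeasurable_duhamel γ hg hF),
    timeNorm_eq_lintegral_swap a σ s hF]
  unfold xNorm
  rw [← lintegral_add_left hm]
  refine lintegral_mono_ae ?_
  filter_upwards [ae_ne_zero] with ξ hξ
  rw [← mul_add, leiLinWeight_add _ _ s (2 * γ) hξ, mul_comm (‖ξ‖ ^ (2 * γ)),
    ENNReal.ofReal_mul (leiLinWeight_nonneg _ _ _ _), mul_assoc]
  gcongr
  set c : ℝ := ‖ξ‖ ^ (2 * γ) with hcdef
  have hc : 0 ≤ c := by positivity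
  have hFξ : Measurable fun τ => ‖F τ ξ‖ₑ :=
    (hF.comp_measurable (g := fun τ => (τ, ξ)) (by fun_prop)).enorm
  have hK : Measurable fun p : Icc (0 : ℝ) T × Icc (0 : ℝ) T => decayKernel c ((p.1 : ℝ) - p.2) :=
    measurable_decayKernel.comp
      (by fun_prop : Measurable fun p : Icc (0 : ℝ) T × Icc (0 : ℝ) T => (c, (p.1 : ℝ) - p.2))
  have hK' : ∀ x : ℝ, Measurable fun t : Icc (0 : ℝ) T => decayKernel c ((t : ℝ) - x) := fun x =>
    measurable_decayKernel.comp
      (by fun_prop : Measurable fun t : Icc (0 : ℝ) T => (c, (t : ℝ) - x))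
  calc ENNReal.ofReal c * ∫⁻ t, ‖duhamel γ g F t ξ‖ₑ ∂timeMeasure T
      ≤ ENNReal.ofReal c * ∫⁻ t : Icc (0 : ℝ) T, (decayKernel c ((t : ℝ) - 0) * ‖g ξ‖ₑ
          + ∫⁻ τ, decayKernel c ((t : ℝ) - τ) * ‖F τ ξ‖ₑ ∂timeMeasure T) ∂timeMeasure T := by
        gcongr with t
        exact enorm_duhamel_le γ g F t ξ
    _ = (ENNReal.ofReal c * ∫⁻ t : Icc (0 : ℝ) T, decayKernel c ((t : ℝ) - 0) ∂timeMeasure T)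
            * ‖g ξ‖ₑ
          + ∫⁻ τ : Icc (0 : ℝ) T, (ENNReal.ofReal c *
              ∫⁻ t : Icc (0 : ℝ) T, decayKernel c ((t : ℝ) - τ) ∂timeMeasure T) * ‖F τ ξ‖ₑ
                ∂timeMeasure T := by
        rw [lintegral_add_left ((hK' 0).mul_const _), mul_add, lintegral_mul_const _ (hK' 0),
          mul_assoc, lintegral_lintegral_swap (hK.mul (hFξ.comp measurable_snd)).aemeasurable,
          ← lintegral_const_mul' _ _ (by simp)]
        congr 1
        refine lintegral_congr fun τ => ?_
        rw [lintegral_mul_const _ (hK' τ), mul_assoc]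
    _ ≤ ‖g ξ‖ₑ + ∫⁻ τ, ‖F τ ξ‖ₑ ∂timeMeasure T := by
        refine add_le_add ?_ (lintegral_mono fun τ => ?_) <;>
        exact mul_le_of_le_one_left' (mul_lintegral_decayKernel_le hc T _)

theorem energy_duhamel_le (a σ s γ : ℝ) {g : E3 → V} {F : Icc (0 : ℝ) T → E3 → V}
    (hg : StronglyMeasurable g) (hF : StronglyMeasurable (Function.uncurry F)) :
    energy a σ s γ (duhamel γ g F) ≤ 2 * (xNorm a σ s g + timeNorm a σ s F) := by
  rw [two_mul]
  exact add_le_add (supNorm_duhamel_le a σ s γ hg hF) (timeNorm_duhamel_le a σ s γ hg hF)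

theorem integrable_kernel_smul {γ : ℝ} {F : Icc (0 : ℝ) T → E3 → V}
    (hF : StronglyMeasurable (Function.uncurry F)) {ξ : E3}
    (h : ∫⁻ τ, ‖F τ ξ‖ₑ ∂timeMeasure T < ⊤) (t : Icc (0 : ℝ) T) :
    IntegrableOn (fun τ : Icc (0 : ℝ) T =>
      (Real.exp (-(((t : ℝ) - τ) * ‖ξ‖ ^ (2 * γ))) : ℂ) • F τ ξ) (Iic t) (timeMeasure T) := by
  have h1 : StronglyMeasurable fun τ => F τ ξ :=
    hF.comp_measurable (g := fun τ => (τ, ξ)) (by fun_prop)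
  have h2 : Measurable fun τ : Icc (0 : ℝ) T =>
      ((Real.exp (-(((t : ℝ) - τ) * ‖ξ‖ ^ (2 * γ))) : ℝ) : ℂ) := by fun_prop
  have h3 : Integrable (fun τ => F τ ξ) (timeMeasure T) := ⟨h1.aestronglyMeasurable, h⟩
  refine Integrable.mono (h3.integrableOn (s := Iic t)) (h2.stronglyMeasurable.smul h1).aestronglyMeasurable
    ?_
  filter_upwards [ae_restrict_mem measurableSet_Iic] with τ hτ
  have hτ' : (τ : ℝ) ≤ t := hτ
  rw [norm_smul, Complex.norm_real, Real.norm_of_nonneg (Real.exp_pos _).le]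
  refine mul_le_of_le_one_left (norm_nonneg _) ?_
  rw [Real.exp_le_one_iff, neg_nonpos]
  have := sub_nonneg.mpr hτ'
  positivity

theorem duhamel_sub_ae {a σ s γ : ℝ} {g : E3 → V} {F F' : Icc (0 : ℝ) T → E3 → V}
    (hF : StronglyMeasurable (Function.uncurry F)) (hF' : StronglyMeasurable (Function.uncurry F'))
    (h : timeNorm a σ s F < ⊤) (h' : timeNorm a σ s F' < ⊤) :
    ∀ᵐ ξ, ∀ t, duhamel γ g F t ξ - duhamel γ g F' t ξ
      = duhamel γ 0 (fun τ ξ => F τ ξ - F' τ ξ) t ξ := by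
  filter_upwards [ae_lintegral_lt_top_of_timeNorm hF h, ae_lintegral_lt_top_of_timeNorm hF' h']
    with ξ h1 h2 t
  unfold duhamel
  rw [add_sub_add_left_eq_sub, ← integral_sub (integrable_kernel_smul hF h1 t)
    (integrable_kernel_smul hF' h2 t)]
  simp [smul_sub]

end Duhamel

/-! ### The bilinear estimate on a time interval -/

section BilinearInTime

variable {V : Type*} [NormedAddCommGroup V] {T : ℝ}

/-- Hölder's inequality in time for two functions that are dominated by geometric means of a
bounded and an integrable function. -/
theorem lintegral_mul_le_of_geometric_mean {X : Type*} [MeasurableSpace X] {m : Measure X}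
    {f g A B : X → ℝ≥0∞} {S R : ℝ≥0∞} {l k : ℝ} (hA : Measurable A) (hB : Measurable B)
    (hl : 0 ≤ l) (hk : 0 ≤ k) (hlk : l + k ≤ 1) (hf : ∀ t, f t ≤ S ^ (1 - l) * A t ^ l)
    (hg : ∀ t, g t ≤ R ^ (1 - k) * B t ^ k) :
    ∫⁻ t, f t * g t ∂m
      ≤ m univ ^ (1 - (l + k)) * ((S + ∫⁻ t, A t ∂m) * (R + ∫⁻ t, B t ∂m)) := by
  have h1 : ∫⁻ t, A t ^ l * B t ^ k ∂m
      ≤ (∫⁻ t, A t ∂m) ^ l * (∫⁻ t, B t ∂m) ^ k * m univ ^ (1 - (l + k)) := by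
    have := ENNReal.lintegral_prod_norm_pow_le (μ := m) (Finset.univ : Finset (Fin 3))
      (f := ![A, B, fun _ => 1]) (p := ![l, k, 1 - (l + k)])
      (by
        intro i _
        fin_cases i
        · exact hA.aemeasurable
        · exact hB.aemeasurable
        · exact aemeasurable_const)
      (by simp [Fin.sum_univ_three])
      (by
        intro i _
        fin_cases i
        · exact hl
        · exact hk
        · exact sub_nonneg.mpr hlk)
    simpa [Fin.prod_univ_three] using this
  have split : ∀ {x y : ℝ≥0∞} {p : ℝ}, 0 ≤ p → p ≤ 1 → x ^ (1 - p) * y ^ p ≤ x + y := by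
    intro x y p h0 h1
    calc x ^ (1 - p) * y ^ p ≤ (x + y) ^ (1 - p) * (x + y) ^ p := by
          have := sub_nonneg.mpr h1
          gcongr
          · exact le_self_add
          · exact le_add_self
      _ = x + y := by
          rw [← ENNReal.rpow_add_of_nonneg _ _ (sub_nonneg.mpr h1) h0]
          simp
  calc ∫⁻ t, f t * g t ∂m
      ≤ ∫⁻ t, (S ^ (1 - l) * R ^ (1 - k)) * (A t ^ l * B t ^ k) ∂m := by
        refine lintegral_mono fun t => (mul_le_mul' (hf t) (hg t)).trans (le_of_eq ?_)
        ring
    _ = (S ^ (1 - l) * R ^ (1 - k)) * ∫⁻ t, A t ^ l * B t ^ k ∂m :=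
        lintegral_const_mul _ ((hA.pow_const l).mul (hB.pow_const k))
    _ ≤ (S ^ (1 - l) * R ^ (1 - k)) *
          ((∫⁻ t, A t ∂m) ^ l * (∫⁻ t, B t ∂m) ^ k * m univ ^ (1 - (l + k))) := by gcongr
    _ = m univ ^ (1 - (l + k)) * ((S ^ (1 - l) * (∫⁻ t, A t ∂m) ^ l) *
          (R ^ (1 - k) * (∫⁻ t, B t ∂m) ^ k)) := by ring
    _ ≤ _ := by
        gcongr
        · exact split hl (by linarith)
        · exact split hk (by linarith)

theorem xNorm_le_geometric_mean (a σ s : ℝ) {γ r : ℝ} (hγ : 1 / 2 ≤ γ) (h0 : 0 ≤ (r - s) / (2 * γ))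
    (h1 : (r - s) / (2 * γ) ≤ 1) {U : Icc (0 : ℝ) T → E3 → V}
    (hU : StronglyMeasurable (Function.uncurry U)) (t : Icc (0 : ℝ) T) :
    xNorm a σ r (U t) ≤ supNorm a σ s U ^ (1 - (r - s) / (2 * γ))
      * xNorm a σ (s + 2 * γ) (U t) ^ ((r - s) / (2 * γ)) := by
  have h := xNorm_interpolate a σ s (2 * γ) h0 h1
    (section_stronglyMeasurable hU t).aestronglyMeasurable
  have e : s + (r - s) / (2 * γ) * (2 * γ) = r := by
    have : γ ≠ 0 := by linarith
    field_simp
    ring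
  rw [e] at h
  refine h.trans ?_
  have := sub_nonneg.mpr h1
  gcongr
  exact le_iSup (fun t => xNorm a σ s (U t)) t

variable [NormedSpace ℂ V]

/-- The bilinear estimate. The hypotheses on `κ` encode that the exponents given by interpolation
between `L^∞_T(𝒳^s)` and `L¹_T(𝒳^{s+2γ})` are admissible in Hölder's inequality in time. -/
theorem timeNorm_transportHat_le {a σ s α γ : ℝ} (ha : 0 ≤ a) (hσ : 1 ≤ σ) (hs : -1 ≤ s)
    (hs0 : s ≤ 0) (hα : 1 / 2 ≤ α) (hγ : 1 / 2 ≤ γ) {κ : ℝ≥0∞}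
    (h1 : 1 / (2 * α) + -s / (2 * γ) ≤ 1) (h2 : -s / (2 * α) + 1 / (2 * γ) ≤ 1)
    (hκ1 : ENNReal.ofReal T ^ (1 - (1 / (2 * α) + -s / (2 * γ))) ≤ κ)
    (hκ2 : ENNReal.ofReal T ^ (1 - (-s / (2 * α) + 1 / (2 * γ))) ≤ κ)
    {U : Icc (0 : ℝ) T → E3 → C3} {W : Icc (0 : ℝ) T → E3 → V}
    (hU : StronglyMeasurable (Function.uncurry U)) (hW : StronglyMeasurable (Function.uncurry W)) :
    timeNorm a σ s (fun t => transportHat (U t) (W t))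
      ≤ 6 * κ * (energy a σ s α U * energy a σ s γ W) := by
  have hα0 : 0 < 2 * α := by linarith
  have hγ0 : 0 < 2 * γ := by linarith
  have q1 : ∀ {x : ℝ}, 0 < 2 * x → 0 ≤ 1 / (2 * x) := fun h => by positivity
  have q2 : ∀ {x : ℝ}, 0 < 2 * x → 0 ≤ -s / (2 * x) := fun h =>
    div_nonneg (by linarith) h.le
  have q3 : ∀ {x : ℝ}, 1 / 2 ≤ x → 1 / (2 * x) ≤ 1 := fun h => by
    rw [div_le_one (by linarith)]
    linarith
  have q4 : ∀ {x : ℝ}, 1 / 2 ≤ x → -s / (2 * x) ≤ 1 := fun h => by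
    rw [div_le_one (by linarith)]
    linarith
  have gU1 := xNorm_le_geometric_mean a σ s (γ := α) (r := s + 1) hα (by simpa using q1 hα0)
    (by simpa using q3 hα) hU
  have gU0 := xNorm_le_geometric_mean a σ s (γ := α) (r := 0) hα (by simpa using q2 hα0)
    (by simpa using q4 hα) hU
  have gW1 := xNorm_le_geometric_mean a σ s (γ := γ) (r := s + 1) hγ (by simpa using q1 hγ0)
    (by simpa using q3 hγ) hW
  have gW0 := xNorm_le_geometric_mean a σ s (γ := γ) (r := 0) hγ (by simpa using q2 hγ0)
    (by simpa using q4 hγ) hW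
  simp only [add_sub_cancel_left, zero_sub] at gU1 gU0 gW1 gW0
  have mU := measurable_xNorm a σ (s + 2 * α) hU
  have mW := measurable_xNorm a σ (s + 2 * γ) hW
  have mUW : Measurable fun t => xNorm a σ (s + 1) (U t) * xNorm a σ 0 (W t) :=
    (measurable_xNorm a σ (s + 1) hU).mul (measurable_xNorm a σ 0 hW)
  have b1 := lintegral_mul_le_of_geometric_mean (m := timeMeasure T) mU mW (q1 hα0) (q2 hγ0) h1
    gU1 gW0
  have b2 := lintegral_mul_le_of_geometric_mean (m := timeMeasure T) mU mW (q2 hα0) (q1 hγ0) h2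
    gU0 gW1
  rw [timeMeasure_univ] at b1 b2
  calc timeNorm a σ s (fun t => transportHat (U t) (W t))
      ≤ ∫⁻ t, 3 * (xNorm a σ (s + 1) (U t) * xNorm a σ 0 (W t)
          + xNorm a σ 0 (U t) * xNorm a σ (s + 1) (W t)) ∂timeMeasure T :=
        lintegral_mono fun t => xNorm_transportHat_le ha hσ hs hs0
          (section_stronglyMeasurable hU t) (section_stronglyMeasurable hW t)
    _ = 3 * ((∫⁻ t, xNorm a σ (s + 1) (U t) * xNorm a σ 0 (W t) ∂timeMeasure T)
          + ∫⁻ t, xNorm a σ 0 (U t) * xNorm a σ (s + 1) (W t) ∂timeMeasure T) := by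
        rw [lintegral_const_mul' _ _ (by simp), lintegral_add_left mUW]
    _ ≤ 3 * (κ * (energy a σ s α U * energy a σ s γ W)
          + κ * (energy a σ s α U * energy a σ s γ W)) := by
        gcongr
        · exact b1.trans (mul_le_mul_left hκ1 _)
        · exact b2.trans (mul_le_mul_left hκ2 _)
    _ = _ := by ring

end BilinearInTime

/-! ### The forcing term -/

section Forcing

/-- Parameters for which the bilinear estimates hold on `[0, T]` with constant `κ`, and for which
the Duhamel iteration contracts on solutions of energy at most `C₁`. The fields `exp_uu`, `exp_ut`,
`exp_tu` say that the exponents from interpolation are admissible in Hölder's inequality in time,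
the first letter naming the factor that is measured in `𝒳^{s+1}`; `le_uu`, `le_ut`, `le_tu` bound
the remaining powers of `T` by `κ`. -/
structure Admissible (a σ α β s T : ℝ) (κ C₁ : ℝ≥0∞) : Prop where
  ha : 0 ≤ a
  hσ : 1 ≤ σ
  hα : 1 / 2 ≤ α
  hβ : 1 / 2 ≤ β
  hs : -1 ≤ s
  hs0 : s ≤ 0
  exp_uu : 1 / (2 * α) + -s / (2 * α) ≤ 1
  exp_ut : 1 / (2 * α) + -s / (2 * β) ≤ 1
  exp_tu : -s / (2 * α) + 1 / (2 * β) ≤ 1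
  le_uu : ENNReal.ofReal T ^ (1 - (1 / (2 * α) + -s / (2 * α))) ≤ κ
  le_ut : ENNReal.ofReal T ^ (1 - (1 / (2 * α) + -s / (2 * β))) ≤ κ
  le_tu : ENNReal.ofReal T ^ (1 - (-s / (2 * α) + 1 / (2 * β))) ≤ κ
  κ_ne_top : κ ≠ ⊤
  C₁_ne_top : C₁ ≠ ⊤
  small : 8 * (24 * κ * C₁ + 2 * ENNReal.ofReal T) ≤ 1

/-- The Fourier transform of `-ℙ(u · ∇u) + ℙ(θ e₃)`. -/
noncomputable def forcingU {T : ℝ} (U : Icc (0 : ℝ) T → E3 → C3) (Θ : Icc (0 : ℝ) T → E3 → ℂ)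
    (t : Icc (0 : ℝ) T) (ξ : E3) : C3 :=
  -leraySymbol ξ (transportHat (U t) (U t) ξ)
    + leraySymbol ξ (Θ t ξ • (EuclideanSpace.single 2 (1 : ℂ) : C3))

/-- The Fourier transform of `-u · ∇θ`. -/
noncomputable def forcingT {T : ℝ} (U : Icc (0 : ℝ) T → E3 → C3) (Θ : Icc (0 : ℝ) T → E3 → ℂ)
    (t : Icc (0 : ℝ) T) (ξ : E3) : ℂ :=
  -transportHat (U t) (Θ t) ξ

variable {T : ℝ}

theorem stronglyMeasurable_transportHat {V : Type*} [NormedAddCommGroup V] [NormedSpace ℂ V]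
    {U : Icc (0 : ℝ) T → E3 → C3} {W : Icc (0 : ℝ) T → E3 → V}
    (hU : StronglyMeasurable (Function.uncurry U)) (hW : StronglyMeasurable (Function.uncurry W)) :
    StronglyMeasurable (Function.uncurry fun t => transportHat (U t) (W t)) := by
  have h1 : ∀ j : Fin 3, StronglyMeasurable fun p : Icc (0 : ℝ) T × E3 =>
      ∫ η, U p.1 (p.2 - η) j • W p.1 η := by
    intro j
    have hUj : StronglyMeasurable fun q : (Icc (0 : ℝ) T × E3) × E3 => U q.1.1 (q.1.2 - q.2) j :=
      (EuclideanSpace.proj j : C3 →L[ℂ] ℂ).continuous.comp_stronglyMeasurable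
        (hU.comp_measurable (g := fun q : (Icc (0 : ℝ) T × E3) × E3 => (q.1.1, q.1.2 - q.2))
          (by fun_prop))
    have hWj : StronglyMeasurable fun q : (Icc (0 : ℝ) T × E3) × E3 => W q.1.1 q.2 :=
      hW.comp_measurable (g := fun q : (Icc (0 : ℝ) T × E3) × E3 => (q.1.1, q.2)) (by fun_prop)
    exact (hUj.smul hWj).integral_prod_right' (ν := volume)
  have h2 : ∀ j : Fin 3, StronglyMeasurable fun p : Icc (0 : ℝ) T × E3 =>
      Complex.I * ((p.2 j : ℝ) : ℂ) := fun j =>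
    Continuous.stronglyMeasurable (by fun_prop)
  have h3 := fun j : Fin 3 => (h2 j).smul ((h1 j).const_smul (((2 * Real.pi) ^ 3 : ℝ) : ℂ)⁻¹)
  convert! ((h3 0).add (h3 1)).add (h3 2) using 1
  ext1 p
  simp [Function.uncurry, transportHat, Fin.sum_univ_three]

theorem stronglyMeasurable_leray {F : Icc (0 : ℝ) T → E3 → C3}
    (hF : StronglyMeasurable (Function.uncurry F)) :
    StronglyMeasurable (Function.uncurry fun t ξ => leraySymbol ξ (F t ξ)) :=
  (measurable_leraySymbol.comp (measurable_snd.prodMk hF.measurable)).stronglyMeasurable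

theorem stronglyMeasurable_buoyancy {Θ : Icc (0 : ℝ) T → E3 → ℂ}
    (hΘ : StronglyMeasurable (Function.uncurry Θ)) : StronglyMeasurable (Function.uncurry
      fun t ξ => Θ t ξ • (EuclideanSpace.single 2 (1 : ℂ) : C3)) :=
  hΘ.smul_const (EuclideanSpace.single 2 (1 : ℂ) : C3)

theorem stronglyMeasurable_forcingU {U : Icc (0 : ℝ) T → E3 → C3} {Θ : Icc (0 : ℝ) T → E3 → ℂ}
    (hU : StronglyMeasurable (Function.uncurry U)) (hΘ : StronglyMeasurable (Function.uncurry Θ)) :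
    StronglyMeasurable (Function.uncurry (forcingU U Θ)) :=
  (stronglyMeasurable_leray (stronglyMeasurable_transportHat hU hU)).neg.add
    (stronglyMeasurable_leray (stronglyMeasurable_buoyancy hΘ))

theorem stronglyMeasurable_forcingT {U : Icc (0 : ℝ) T → E3 → C3} {Θ : Icc (0 : ℝ) T → E3 → ℂ}
    (hU : StronglyMeasurable (Function.uncurry U)) (hΘ : StronglyMeasurable (Function.uncurry Θ)) :
    StronglyMeasurable (Function.uncurry (forcingT U Θ)) :=
  (stronglyMeasurable_transportHat hU hΘ).neg

theorem enorm_leraySymbol_le (ξ : E3) (v : C3) : ‖leraySymbol ξ v‖ₑ ≤ 2 * ‖v‖ₑ := by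
  have h := ENNReal.ofReal_le_ofReal (norm_leraySymbol_le ξ v)
  rwa [ENNReal.ofReal_mul (by norm_num), ofReal_norm, ofReal_norm, ENNReal.ofReal_ofNat] at h

theorem timeNorm_leray_le (a σ r : ℝ) (F : Icc (0 : ℝ) T → E3 → C3) :
    timeNorm a σ r (fun t ξ => leraySymbol ξ (F t ξ)) ≤ 2 * timeNorm a σ r F :=
  timeNorm_le_mul a σ r (by simp) fun _ ξ => enorm_leraySymbol_le ξ _

theorem timeNorm_leray_buoyancy_le (a σ s : ℝ) (Θ : Icc (0 : ℝ) T → E3 → ℂ) :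
    timeNorm a σ s (fun t ξ => leraySymbol ξ (Θ t ξ • (EuclideanSpace.single 2 (1 : ℂ) : C3)))
      ≤ 2 * ENNReal.ofReal T * supNorm a σ s Θ := by
  have h : timeNorm a σ s (fun t ξ => Θ t ξ • (EuclideanSpace.single 2 (1 : ℂ) : C3))
      ≤ 1 * timeNorm a σ s Θ := timeNorm_le_mul a σ s (by simp) fun t ξ => by
    rw [enorm_smul, ← ofReal_norm (EuclideanSpace.single 2 (1 : ℂ) : C3)]
    simp
  calc _ ≤ 2 * timeNorm a σ s (fun t ξ => Θ t ξ • (EuclideanSpace.single 2 (1 : ℂ) : C3)) :=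
        timeNorm_leray_le a σ s _
    _ ≤ 2 * (1 * timeNorm a σ s Θ) := by gcongr
    _ ≤ 2 * (1 * (ENNReal.ofReal T * supNorm a σ s Θ)) := by
        gcongr
        exact timeNorm_le_supNorm a σ s Θ
    _ = _ := by ring

theorem supNorm_le_energy (a σ s γ : ℝ) {V : Type*} [NormedAddCommGroup V]
    (U : Icc (0 : ℝ) T → E3 → V) : supNorm a σ s U ≤ energy a σ s γ U := le_self_add

variable {a σ α β s : ℝ} {κ C₁ : ℝ≥0∞}

theorem Admissible.bilinear_uu (A : Admissible a σ α β s T κ C₁) {U W : Icc (0 : ℝ) T → E3 → C3}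
    (hU : StronglyMeasurable (Function.uncurry U)) (hW : StronglyMeasurable (Function.uncurry W)) :
    timeNorm a σ s (fun t => transportHat (U t) (W t))
      ≤ 6 * κ * (energy a σ s α U * energy a σ s α W) :=
  timeNorm_transportHat_le A.ha A.hσ A.hs A.hs0 A.hα A.hα A.exp_uu (by linarith [A.exp_uu]) A.le_uu
    (by simpa only [add_comm] using A.le_uu) hU hW

theorem Admissible.bilinear_ut (A : Admissible a σ α β s T κ C₁) {U : Icc (0 : ℝ) T → E3 → C3}
    {Θ : Icc (0 : ℝ) T → E3 → ℂ} (hU : StronglyMeasurable (Function.uncurry U))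
    (hΘ : StronglyMeasurable (Function.uncurry Θ)) :
    timeNorm a σ s (fun t => transportHat (U t) (Θ t))
      ≤ 6 * κ * (energy a σ s α U * energy a σ s β Θ) :=
  timeNorm_transportHat_le A.ha A.hσ A.hs A.hs0 A.hα A.hβ A.exp_ut A.exp_tu A.le_ut A.le_tu hU hΘ

theorem timeNorm_forcing_le_energy (A : Admissible a σ α β s T κ C₁) {U : Icc (0 : ℝ) T → E3 → C3}
    {Θ : Icc (0 : ℝ) T → E3 → ℂ} (hU : StronglyMeasurable (Function.uncurry U))
    (hΘ : StronglyMeasurable (Function.uncurry Θ)) :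
    timeNorm a σ s (forcingU U Θ) + timeNorm a σ s (forcingT U Θ)
      ≤ (12 * κ * (energy a σ s α U + energy a σ s β Θ) + 2 * ENNReal.ofReal T)
        * (energy a σ s α U + energy a σ s β Θ) := by
  have h1 : timeNorm a σ s (forcingU U Θ) ≤ 2 * (6 * κ * (energy a σ s α U * energy a σ s α U))
      + 2 * ENNReal.ofReal T * energy a σ s β Θ := by
    refine (timeNorm_add_le a σ s (stronglyMeasurable_leray
      (stronglyMeasurable_transportHat hU hU)).neg).trans (add_le_add ?_ ?_)
    · rw [timeNorm_neg]
      refine (timeNorm_leray_le a σ s _).trans ?_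
      gcongr
      exact A.bilinear_uu hU hU
    · refine (timeNorm_leray_buoyancy_le a σ s Θ).trans ?_
      gcongr
      exact supNorm_le_energy a σ s β Θ
  have h2 : timeNorm a σ s (forcingT U Θ) ≤ 6 * κ * (energy a σ s α U * energy a σ s β Θ) := by
    unfold forcingT
    rw [timeNorm_neg]
    exact A.bilinear_ut hU hΘ
  generalize energy a σ s α U = x at *
  generalize energy a σ s β Θ = y at *
  calc _ ≤ 2 * (6 * κ * (x * x)) + 2 * ENNReal.ofReal T * y + 6 * κ * (x * y) := add_le_add h1 h2
    _ ≤ (2 * (6 * κ * (x * x)) + 2 * ENNReal.ofReal T * y + 6 * κ * (x * y))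
        + (18 * κ * (x * y) + 12 * κ * (y * y) + 2 * ENNReal.ofReal T * x) := le_self_add
    _ = _ := by ring

/-- Finite energy puts `U t` in `𝒳^0` at almost every time, so that products are defined. -/
theorem ae_integrable_section {V : Type*} [NormedAddCommGroup V] {γ : ℝ} (ha : 0 ≤ a)
    (hs : -1 ≤ s) (hs0 : s ≤ 0) (hγ : 1 / 2 ≤ γ) {U : Icc (0 : ℝ) T → E3 → V}
    (hU : StronglyMeasurable (Function.uncurry U)) (h : energy a σ s γ U < ⊤) :
    ∀ᵐ t ∂timeMeasure T, Integrable (U t) := by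
  have h1 : supNorm a σ s U < ⊤ := lt_of_le_of_lt le_self_add h
  have h2 : timeNorm a σ (s + 2 * γ) U < ⊤ := lt_of_le_of_lt le_add_self h
  have e0 : 0 ≤ (0 - s) / (2 * γ) := div_nonneg (by linarith) (by linarith)
  have e1 : (0 - s) / (2 * γ) ≤ 1 := by
    rw [div_le_one (by linarith)]
    linarith
  filter_upwards [ae_lt_top (measurable_xNorm a σ _ hU) h2.ne] with t ht
  refine integrable_of_xNorm_zero_lt_top (σ := σ) ha
    (section_stronglyMeasurable hU t).aestronglyMeasurable ?_
  exact (xNorm_le_geometric_mean a σ s hγ e0 e1 hU t).trans_lt (ENNReal.mul_lt_top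
    (ENNReal.rpow_lt_top_of_nonneg (sub_nonneg.mpr e1) h1.ne)
    (ENNReal.rpow_lt_top_of_nonneg e0 ht.ne))

theorem timeNorm_transportHat_sub_le {V : Type*} [NormedAddCommGroup V] [NormedSpace ℂ V]
    {U U' : Icc (0 : ℝ) T → E3 → C3} {W W' : Icc (0 : ℝ) T → E3 → V}
    (hU : StronglyMeasurable (Function.uncurry U)) (hU' : StronglyMeasurable (Function.uncurry U'))
    (hW : StronglyMeasurable (Function.uncurry W))
    (iU : ∀ᵐ t ∂timeMeasure T, Integrable (U t)) (iU' : ∀ᵐ t ∂timeMeasure T, Integrable (U' t))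
    (iW : ∀ᵐ t ∂timeMeasure T, Integrable (W t)) (iW' : ∀ᵐ t ∂timeMeasure T, Integrable (W' t)) :
    timeNorm a σ s (fun t ξ => transportHat (U t) (W t) ξ - transportHat (U' t) (W' t) ξ)
      ≤ timeNorm a σ s (fun t => transportHat (U t - U' t) (W t))
        + timeNorm a σ s (fun t => transportHat (U' t) (W t - W' t)) := by
  refine le_trans (le_of_eq (timeNorm_congr a σ s ?_))
    (timeNorm_add_le a σ s (stronglyMeasurable_transportHat (U := fun t => U t - U' t)
      (hU.sub hU') hW))
  filter_upwards [iU, iU', iW, iW'] with t h1 h2 h3 h4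
  exact transportHat_sub_ae h1 h2 h3 h4

theorem timeNorm_forcing_sub_le_energy (A : Admissible a σ α β s T κ C₁)
    {U U' : Icc (0 : ℝ) T → E3 → C3} {Θ Θ' : Icc (0 : ℝ) T → E3 → ℂ}
    (hU : StronglyMeasurable (Function.uncurry U)) (hΘ : StronglyMeasurable (Function.uncurry Θ))
    (hU' : StronglyMeasurable (Function.uncurry U'))
    (hΘ' : StronglyMeasurable (Function.uncurry Θ'))
    (h : energy a σ s α U + energy a σ s β Θ ≤ C₁)
    (h' : energy a σ s α U' + energy a σ s β Θ' ≤ C₁) :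
    timeNorm a σ s (fun t ξ => forcingU U Θ t ξ - forcingU U' Θ' t ξ)
        + timeNorm a σ s (fun t ξ => forcingT U Θ t ξ - forcingT U' Θ' t ξ)
      ≤ (24 * κ * C₁ + 2 * ENNReal.ofReal T) *
        (energy a σ s α (fun t => U t - U' t) + energy a σ s β (fun t => Θ t - Θ' t)) := by
  have ft : ∀ {x y : ℝ≥0∞}, x + y ≤ C₁ → x < ⊤ ∧ y < ⊤ := fun h =>
    ⟨lt_of_le_of_lt (le_self_add.trans h) A.C₁_ne_top.lt_top,
      lt_of_le_of_lt (le_add_self.trans h) A.C₁_ne_top.lt_top⟩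
  have iU := ae_integrable_section A.ha A.hs A.hs0 A.hα hU (ft h).1
  have iU' := ae_integrable_section A.ha A.hs A.hs0 A.hα hU' (ft h').1
  have iΘ := ae_integrable_section A.ha A.hs A.hs0 A.hβ hΘ (ft h).2
  have iΘ' := ae_integrable_section A.ha A.hs A.hs0 A.hβ hΘ' (ft h').2
  have hdU : StronglyMeasurable (Function.uncurry fun t => U t - U' t) := hU.sub hU'
  have hdΘ : StronglyMeasurable (Function.uncurry fun t => Θ t - Θ' t) := hΘ.sub hΘ'
  have h1 : timeNorm a σ s (fun t ξ => forcingU U Θ t ξ - forcingU U' Θ' t ξ)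
      ≤ 2 * (6 * κ * (energy a σ s α (fun t => U t - U' t) * energy a σ s α U)
          + 6 * κ * (energy a σ s α U' * energy a σ s α (fun t => U t - U' t)))
        + 2 * ENNReal.ofReal T * energy a σ s β (fun t => Θ t - Θ' t) := by
    have e : (fun (t : Icc (0 : ℝ) T) ξ => forcingU U Θ t ξ - forcingU U' Θ' t ξ) = fun t ξ =>
        -leraySymbol ξ (transportHat (U t) (U t) ξ - transportHat (U' t) (U' t) ξ)
          + leraySymbol ξ ((Θ t - Θ' t) ξ • (EuclideanSpace.single 2 (1 : ℂ) : C3)) := by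
      ext1 t; ext1 ξ
      simp only [forcingU, leraySymbol_sub, Pi.sub_apply, sub_smul]
      abel
    have hD : StronglyMeasurable (Function.uncurry fun (t : Icc (0 : ℝ) T) ξ =>
        transportHat (U t) (U t) ξ - transportHat (U' t) (U' t) ξ) :=
      (stronglyMeasurable_transportHat hU hU).sub (stronglyMeasurable_transportHat hU' hU')
    have hL : StronglyMeasurable (Function.uncurry fun (t : Icc (0 : ℝ) T) ξ =>
        -leraySymbol ξ (transportHat (U t) (U t) ξ - transportHat (U' t) (U' t) ξ)) :=
      (stronglyMeasurable_leray hD).neg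
    rw [e]
    refine (timeNorm_add_le a σ s hL).trans (add_le_add ?_ ?_)
    · rw [timeNorm_neg]
      refine (timeNorm_leray_le a σ s _).trans ?_
      gcongr
      exact (timeNorm_transportHat_sub_le hU hU' hU iU iU' iU iU').trans
        (add_le_add (A.bilinear_uu hdU hU) (A.bilinear_uu hU' hdU))
    · refine (timeNorm_leray_buoyancy_le a σ s _).trans ?_
      gcongr
      exact supNorm_le_energy a σ s β _
  have h2 : timeNorm a σ s (fun t ξ => forcingT U Θ t ξ - forcingT U' Θ' t ξ)
      ≤ 6 * κ * (energy a σ s α (fun t => U t - U' t) * energy a σ s β Θ)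
        + 6 * κ * (energy a σ s α U' * energy a σ s β (fun t => Θ t - Θ' t)) := by
    have e : (fun (t : Icc (0 : ℝ) T) ξ => forcingT U Θ t ξ - forcingT U' Θ' t ξ) = fun t ξ =>
        -(transportHat (U t) (Θ t) ξ - transportHat (U' t) (Θ' t) ξ) := by
      ext1 t; ext1 ξ
      simp only [forcingT]
      ring
    rw [e, timeNorm_neg]
    exact (timeNorm_transportHat_sub_le hU hU' hΘ iU iU' iΘ iΘ').trans
      (add_le_add (A.bilinear_ut hdU hΘ) (A.bilinear_ut hU' hdΘ))
  generalize energy a σ s α (fun t => U t - U' t) = dx at *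
  generalize energy a σ s β (fun t => Θ t - Θ' t) = dy at *
  generalize energy a σ s α U = x at *
  generalize energy a σ s β Θ = y at *
  generalize energy a σ s α U' = x' at *
  generalize energy a σ s β Θ' = y' at *
  have hx : x ≤ C₁ := le_self_add.trans h
  have hx' : x' ≤ C₁ := le_self_add.trans h'
  calc _ ≤ _ := add_le_add h1 h2
    _ = 12 * κ * (dx * x) + 12 * κ * (x' * dx) + 6 * κ * (dx * y) + 6 * κ * (x' * dy)
        + 2 * ENNReal.ofReal T * dy := by ring
    _ ≤ 12 * κ * (dx * x) + 12 * κ * (x' * dx) + 6 * κ * (dx * y) + 6 * κ * (x' * dy)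
        + 2 * ENNReal.ofReal T * dy + (6 * κ * (dx * y) + 2 * ENNReal.ofReal T * dx) := le_self_add
    _ = 12 * κ * (dx * (x + y)) + 12 * κ * (x' * dx) + 6 * κ * (x' * dy)
        + 2 * ENNReal.ofReal T * (dx + dy) := by ring
    _ ≤ 12 * κ * (dx * C₁) + 12 * κ * (C₁ * dx) + 6 * κ * (C₁ * dy)
        + 2 * ENNReal.ofReal T * (dx + dy) := by gcongr
    _ ≤ 12 * κ * (dx * C₁) + 12 * κ * (C₁ * dx) + 6 * κ * (C₁ * dy)
        + 2 * ENNReal.ofReal T * (dx + dy) + 18 * κ * (C₁ * dy) := le_self_add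
    _ = _ := by ring

end Forcing

/-! ### The fixed point -/

section FixedPoint

variable {T a σ α β s : ℝ} {κ C₁ : ℝ≥0∞}

theorem lt_top_of_add_le {x y z : ℝ≥0∞} (h : x + y ≤ z) (hz : z ≠ ⊤) : x < ⊤ ∧ y < ⊤ :=
  ⟨lt_of_le_of_lt (le_self_add.trans h) hz.lt_top, lt_of_le_of_lt (le_add_self.trans h) hz.lt_top⟩

theorem energy_congr (a σ s γ : ℝ) {V : Type*} [NormedAddCommGroup V]
    {U U' : Icc (0 : ℝ) T → E3 → V} (h : ∀ t, U t =ᵐ[volume] U' t) :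
    energy a σ s γ U = energy a σ s γ U' := by
  unfold energy supNorm
  rw [timeNorm_congr a σ _ (Eventually.of_forall h)]
  congr 1
  exact iSup_congr fun t => xNorm_congr a σ s (h t)

theorem energy_duhamel_sub_le {V : Type*} [NormedAddCommGroup V] [NormedSpace ℂ V] (γ : ℝ)
    (g : E3 → V) {F F' : Icc (0 : ℝ) T → E3 → V}
    (hF : StronglyMeasurable (Function.uncurry F)) (hF' : StronglyMeasurable (Function.uncurry F'))
    (h : timeNorm a σ s F < ⊤) (h' : timeNorm a σ s F' < ⊤) :
    energy a σ s γ (fun t => duhamel γ g F t - duhamel γ g F' t)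
      ≤ 2 * timeNorm a σ s (fun t ξ => F t ξ - F' t ξ) := by
  have hsub : StronglyMeasurable (Function.uncurry fun t ξ => F t ξ - F' t ξ) := hF.sub hF'
  have e := energy_congr a σ s γ (U := fun t => duhamel γ g F t - duhamel γ g F' t)
    (U' := duhamel γ 0 fun t ξ => F t ξ - F' t ξ) fun t => by
      filter_upwards [duhamel_sub_ae (γ := γ) (g := g) hF hF' h h'] with ξ hξ
      exact hξ t
  rw [e]
  refine (energy_duhamel_le a σ s γ stronglyMeasurable_zero hsub).trans ?_
  have : xNorm a σ s (0 : E3 → V) = 0 := xNorm_zero a σ s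
  rw [this, zero_add]

theorem Admissible.timeNorm_forcing_le (A : Admissible a σ α β s T κ C₁)
    {U : Icc (0 : ℝ) T → E3 → C3} {Θ : Icc (0 : ℝ) T → E3 → ℂ}
    (hU : StronglyMeasurable (Function.uncurry U)) (hΘ : StronglyMeasurable (Function.uncurry Θ))
    (h : energy a σ s α U + energy a σ s β Θ ≤ C₁) :
    8 * (timeNorm a σ s (forcingU U Θ) + timeNorm a σ s (forcingT U Θ))
      ≤ energy a σ s α U + energy a σ s β Θ := by
  have h1 := timeNorm_forcing_le_energy A hU hΘ
  generalize energy a σ s α U + energy a σ s β Θ = x at *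
  calc _ ≤ 8 * ((12 * κ * x + 2 * ENNReal.ofReal T) * x) := by gcongr
    _ ≤ 8 * ((12 * κ * C₁ + 2 * ENNReal.ofReal T) * x) := by gcongr
    _ ≤ 8 * ((12 * κ * C₁ + 2 * ENNReal.ofReal T) * x) + 8 * (12 * κ * C₁ * x) := le_self_add
    _ = 8 * (24 * κ * C₁ + 2 * ENNReal.ofReal T) * x := by ring
    _ ≤ 1 * x := by gcongr; exact A.small
    _ = x := one_mul x

theorem Admissible.timeNorm_forcing_sub_le (A : Admissible a σ α β s T κ C₁) {g₁ : E3 → C3}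
    {g₂ : E3 → ℂ} (hg₁ : StronglyMeasurable g₁) (hg₂ : StronglyMeasurable g₂)
    {F F' : Icc (0 : ℝ) T → E3 → C3} {G G' : Icc (0 : ℝ) T → E3 → ℂ}
    (hF : StronglyMeasurable (Function.uncurry F)) (hF' : StronglyMeasurable (Function.uncurry F'))
    (hG : StronglyMeasurable (Function.uncurry G)) (hG' : StronglyMeasurable (Function.uncurry G'))
    (fF : timeNorm a σ s F < ⊤) (fF' : timeNorm a σ s F' < ⊤)
    (fG : timeNorm a σ s G < ⊤) (fG' : timeNorm a σ s G' < ⊤)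
    (h : energy a σ s α (duhamel α g₁ F) + energy a σ s β (duhamel β g₂ G) ≤ C₁)
    (h' : energy a σ s α (duhamel α g₁ F') + energy a σ s β (duhamel β g₂ G') ≤ C₁) :
    4 * (timeNorm a σ s (fun t ξ => forcingU (duhamel α g₁ F) (duhamel β g₂ G) t ξ
          - forcingU (duhamel α g₁ F') (duhamel β g₂ G') t ξ)
        + timeNorm a σ s (fun t ξ => forcingT (duhamel α g₁ F) (duhamel β g₂ G) t ξ
          - forcingT (duhamel α g₁ F') (duhamel β g₂ G') t ξ))
      ≤ timeNorm a σ s (fun t ξ => F t ξ - F' t ξ)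
        + timeNorm a σ s (fun t ξ => G t ξ - G' t ξ) := by
  have h1 := timeNorm_forcing_sub_le_energy A (stronglyMeasurable_duhamel α hg₁ hF)
    (stronglyMeasurable_duhamel β hg₂ hG) (stronglyMeasurable_duhamel α hg₁ hF')
    (stronglyMeasurable_duhamel β hg₂ hG') h h'
  have h2 := energy_duhamel_sub_le α g₁ hF hF' fF fF'
  have h3 := energy_duhamel_sub_le β g₂ hG hG' fG fG'
  refine (mul_le_mul_right h1 4).trans ?_
  generalize timeNorm a σ s (fun t ξ => F t ξ - F' t ξ) = x at *
  generalize timeNorm a σ s (fun t ξ => G t ξ - G' t ξ) = y at *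
  calc _ ≤ 4 * ((24 * κ * C₁ + 2 * ENNReal.ofReal T) * (2 * x + 2 * y)) := by gcongr
    _ = 8 * (24 * κ * C₁ + 2 * ENNReal.ofReal T) * (x + y) := by ring
    _ ≤ 1 * (x + y) := by gcongr; exact A.small
    _ = x + y := one_mul _

theorem ae_eq_zero_of_timeNorm_eq_zero {V : Type*} [NormedAddCommGroup V] {F : Icc (0 : ℝ) T → E3 → V}
    (hF : StronglyMeasurable (Function.uncurry F)) (h : timeNorm a σ s F = 0) :
    ∀ᵐ t ∂timeMeasure T, F t =ᵐ[volume] 0 := by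
  filter_upwards [(lintegral_eq_zero_iff (measurable_xNorm a σ s hF)).mp h] with t ht
  exact ae_eq_zero_of_xNorm_eq_zero (section_stronglyMeasurable hF t).aestronglyMeasurable ht

/-- Two forcing terms that reproduce themselves through the Duhamel formula with the same data
agree, if both solutions have energy at most `C₁`. -/
theorem Admissible.forcing_unique (A : Admissible a σ α β s T κ C₁) {g₁ : E3 → C3}
    {g₂ : E3 → ℂ} (hg₁ : StronglyMeasurable g₁) (hg₂ : StronglyMeasurable g₂)
    {F F' : Icc (0 : ℝ) T → E3 → C3} {G G' : Icc (0 : ℝ) T → E3 → ℂ}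
    (hF : StronglyMeasurable (Function.uncurry F)) (hF' : StronglyMeasurable (Function.uncurry F'))
    (hG : StronglyMeasurable (Function.uncurry G)) (hG' : StronglyMeasurable (Function.uncurry G'))
    (fF : timeNorm a σ s F < ⊤) (fF' : timeNorm a σ s F' < ⊤)
    (fG : timeNorm a σ s G < ⊤) (fG' : timeNorm a σ s G' < ⊤)
    (h : energy a σ s α (duhamel α g₁ F) + energy a σ s β (duhamel β g₂ G) ≤ C₁)
    (h' : energy a σ s α (duhamel α g₁ F') + energy a σ s β (duhamel β g₂ G') ≤ C₁)
    (eF : ∀ᵐ t ∂timeMeasure T, F t =ᵐ[volume] forcingU (duhamel α g₁ F) (duhamel β g₂ G) t)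
    (eF' : ∀ᵐ t ∂timeMeasure T, F' t =ᵐ[volume] forcingU (duhamel α g₁ F') (duhamel β g₂ G') t)
    (eG : ∀ᵐ t ∂timeMeasure T, G t =ᵐ[volume] forcingT (duhamel α g₁ F) (duhamel β g₂ G) t)
    (eG' : ∀ᵐ t ∂timeMeasure T, G' t =ᵐ[volume] forcingT (duhamel α g₁ F') (duhamel β g₂ G') t) :
    (∀ᵐ t ∂timeMeasure T, F t =ᵐ[volume] F' t) ∧ ∀ᵐ t ∂timeMeasure T, G t =ᵐ[volume] G' t := by
  have key := A.timeNorm_forcing_sub_le hg₁ hg₂ hF hF' hG hG' fF fF' fG fG' h h'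
  have e1 := timeNorm_congr a σ s (U := fun t ξ => F t ξ - F' t ξ)
    (U' := fun t ξ => forcingU (duhamel α g₁ F) (duhamel β g₂ G) t ξ
          - forcingU (duhamel α g₁ F') (duhamel β g₂ G') t ξ) (by
      filter_upwards [eF, eF'] with t h1 h2
      filter_upwards [h1, h2] with ξ h3 h4
      rw [h3, h4])
  have e2 := timeNorm_congr a σ s (U := fun t ξ => G t ξ - G' t ξ)
    (U' := fun t ξ => forcingT (duhamel α g₁ F) (duhamel β g₂ G) t ξ
          - forcingT (duhamel α g₁ F') (duhamel β g₂ G') t ξ) (by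
      filter_upwards [eG, eG'] with t h1 h2
      filter_upwards [h1, h2] with ξ h3 h4
      rw [h3, h4])
  rw [← e1, ← e2] at key
  have hsF : StronglyMeasurable (Function.uncurry fun t ξ => F t ξ - F' t ξ) := hF.sub hF'
  have hsG : StronglyMeasurable (Function.uncurry fun t ξ => G t ξ - G' t ξ) := hG.sub hG'
  have fsub : ∀ {V : Type} [NormedAddCommGroup V] {H H' : Icc (0 : ℝ) T → E3 → V},
      StronglyMeasurable (Function.uncurry H) → timeNorm a σ s H < ⊤ → timeNorm a σ s H' < ⊤ →
      timeNorm a σ s (fun t ξ => H t ξ - H' t ξ) < ⊤ := by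
    intro V _ H H' hH h1 h2
    have := timeNorm_add_le a σ s (U' := fun t ξ => -H' t ξ) hH
    simp only [← sub_eq_add_neg, timeNorm_neg] at this
    exact this.trans_lt (ENNReal.add_lt_top.mpr ⟨h1, h2⟩)
  have f1 := fsub hF fF fF'
  have f2 := fsub hG fG fG'
  have hzero : timeNorm a σ s (fun t ξ => F t ξ - F' t ξ)
      + timeNorm a σ s (fun t ξ => G t ξ - G' t ξ) = 0 := by
    have hfin := (ENNReal.add_lt_top.mpr ⟨f1, f2⟩).ne
    generalize timeNorm a σ s (fun t ξ => F t ξ - F' t ξ)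
      + timeNorm a σ s (fun t ξ => G t ξ - G' t ξ) = x at *
    lift x to NNReal using hfin
    have key' : 4 * x ≤ x := by exact_mod_cast key
    have : x = 0 := by
      have h0 : (0 : ℝ) ≤ x := x.2
      have h1 : 4 * (x : ℝ) ≤ x := by exact_mod_cast key'
      exact NNReal.coe_eq_zero.mp (by linarith)
    simp [this]
  rw [add_eq_zero] at hzero
  refine ⟨?_, ?_⟩
  · filter_upwards [ae_eq_zero_of_timeNorm_eq_zero hsF hzero.1] with t ht
    filter_upwards [ht] with ξ hξ
    exact sub_eq_zero.mp hξ
  · filter_upwards [ae_eq_zero_of_timeNorm_eq_zero hsG hzero.2] with t ht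
    filter_upwards [ht] with ξ hξ
    exact sub_eq_zero.mp hξ

/-- The measure `|ξ|^s e^{a|ξ|^{1/σ}} dξ dt`. -/
noncomputable def spaceTimeMeasure (a σ s T : ℝ) : Measure (Icc (0 : ℝ) T × E3) :=
  (timeMeasure T).prod (volume.withDensity fun ξ => ENNReal.ofReal (leiLinWeight a σ s ξ))

theorem lintegral_spaceTimeMeasure {V : Type*} [NormedAddCommGroup V]
    {F : Icc (0 : ℝ) T → E3 → V} (hF : StronglyMeasurable (Function.uncurry F)) :
    ∫⁻ p, ‖Function.uncurry F p‖ₑ ∂spaceTimeMeasure a σ s T = timeNorm a σ s F := by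
  rw [spaceTimeMeasure, lintegral_prod _ hF.enorm.aemeasurable]
  refine lintegral_congr fun t => ?_
  exact lintegral_withDensity_eq_lintegral_mul _ (measurable_ofReal_leiLinWeight a σ s)
    (section_stronglyMeasurable hF t).enorm

theorem ae_of_ae_spaceTimeMeasure {p : Icc (0 : ℝ) T × E3 → Prop}
    (h : ∀ᵐ q ∂spaceTimeMeasure a σ s T, p q) :
    ∀ᵐ t ∂timeMeasure T, ∀ᵐ ξ : E3, p (t, ξ) := by
  filter_upwards [Measure.ae_ae_of_ae_prod h] with t ht
  refine (withDensity_absolutelyContinuous' (measurable_ofReal_leiLinWeight a σ s).aemeasurable ?_)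
    ht
  filter_upwards [ae_ne_zero] with ξ hξ
  simpa using leiLinWeight_pos a σ s hξ

theorem edist_eq_timeNorm {V : Type*} [NormedAddCommGroup V]
    {f f' : Lp V 1 (spaceTimeMeasure a σ s T)} {F F' : Icc (0 : ℝ) T → E3 → V}
    (hF : StronglyMeasurable (Function.uncurry F)) (hF' : StronglyMeasurable (Function.uncurry F'))
    (h : f =ᵐ[spaceTimeMeasure a σ s T] Function.uncurry F)
    (h' : f' =ᵐ[spaceTimeMeasure a σ s T] Function.uncurry F') :
    edist f f' = timeNorm a σ s (fun t ξ => F t ξ - F' t ξ) := by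
  have hs : StronglyMeasurable (Function.uncurry fun t ξ => F t ξ - F' t ξ) := hF.sub hF'
  rw [Lp.edist_def, eLpNorm_one_eq_lintegral_enorm, ← lintegral_spaceTimeMeasure hs]
  refine lintegral_congr_ae ?_
  filter_upwards [h, h'] with p h1 h2
  simp only [Pi.sub_apply, h1, h2]
  rfl

theorem edist_zero_eq_timeNorm {V : Type*} [NormedAddCommGroup V]
    {f : Lp V 1 (spaceTimeMeasure a σ s T)} {F : Icc (0 : ℝ) T → E3 → V}
    (hF : StronglyMeasurable (Function.uncurry F))
    (h : f =ᵐ[spaceTimeMeasure a σ s T] Function.uncurry F) :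
    edist f 0 = timeNorm a σ s F := by
  rw [edist_eq_timeNorm (F' := fun _ _ => 0) hF stronglyMeasurable_zero h (Lp.coeFn_zero _ _ _)]
  simp

/-- The forcing term is a fixed point of the composition of the Duhamel formula with the
nonlinearity, a contraction of `L¹([0, T]; 𝒳^s)` near the origin. -/
theorem Admissible.exists_forcing (A : Admissible a σ α β s T κ C₁) {g₁ : E3 → C3}
    {g₂ : E3 → ℂ} (hg₁ : StronglyMeasurable g₁) (hg₂ : StronglyMeasurable g₂)
    (hd : 6 * (xNorm a σ s g₁ + xNorm a σ s g₂) ≤ C₁) :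
    ∃ (F : Icc (0 : ℝ) T → E3 → C3) (G : Icc (0 : ℝ) T → E3 → ℂ),
      StronglyMeasurable (Function.uncurry F) ∧ StronglyMeasurable (Function.uncurry G) ∧
      timeNorm a σ s F ≤ xNorm a σ s g₁ + xNorm a σ s g₂ ∧
      timeNorm a σ s G ≤ xNorm a σ s g₁ + xNorm a σ s g₂ ∧
      (∀ᵐ t ∂timeMeasure T, F t =ᵐ[volume] forcingU (duhamel α g₁ F) (duhamel β g₂ G) t) ∧
      ∀ᵐ t ∂timeMeasure T, G t =ᵐ[volume] forcingT (duhamel α g₁ F) (duhamel β g₂ G) t := by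
  set ν := spaceTimeMeasure a σ s T with hν
  set d := xNorm a σ s g₁ + xNorm a σ s g₂ with hdd
  have hdtop : d < ⊤ := by
    refine lt_of_le_of_lt ?_ (lt_of_le_of_lt hd A.C₁_ne_top.lt_top)
    exact le_mul_of_one_le_left' (by norm_num)
  have hRm : ∀ {V : Type} [NormedAddCommGroup V] (f : Lp V 1 ν),
      StronglyMeasurable (Function.uncurry fun t ξ => f (t, ξ)) := fun f => Lp.stronglyMeasurable f
  have hRe : ∀ {V : Type} [NormedAddCommGroup V] (f : Lp V 1 ν),
      f =ᵐ[ν] Function.uncurry fun t ξ => f (t, ξ) := fun f => Eventually.of_forall fun p => rfl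
  have hRn : ∀ {V : Type} [NormedAddCommGroup V] (f : Lp V 1 ν),
      edist f 0 = timeNorm a σ s fun t ξ => f (t, ξ) := fun f => edist_zero_eq_timeNorm (hRm f) (hRe f)
  have hRt : ∀ {V : Type} [NormedAddCommGroup V] (f : Lp V 1 ν),
      timeNorm a σ s (fun t ξ => f (t, ξ)) < ⊤ := fun f => by
    rw [← hRn]
    exact edist_lt_top _ _
  let DU : Lp C3 1 ν × Lp ℂ 1 ν → Icc (0 : ℝ) T → E3 → C3 :=
    fun z => duhamel α g₁ fun t ξ => z.1 (t, ξ)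
  let DT : Lp C3 1 ν × Lp ℂ 1 ν → Icc (0 : ℝ) T → E3 → ℂ :=
    fun z => duhamel β g₂ fun t ξ => z.2 (t, ξ)
  have hDU : ∀ z, StronglyMeasurable (Function.uncurry (DU z)) := fun z =>
    stronglyMeasurable_duhamel α hg₁ (hRm z.1)
  have hDT : ∀ z, StronglyMeasurable (Function.uncurry (DT z)) := fun z =>
    stronglyMeasurable_duhamel β hg₂ (hRm z.2)
  have hE : ∀ z, energy a σ s α (DU z) + energy a σ s β (DT z)
      ≤ 2 * (d + (edist z.1 0 + edist z.2 0)) := fun z => by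
    rw [hRn, hRn]
    refine (add_le_add (energy_duhamel_le a σ s α hg₁ (hRm z.1))
      (energy_duhamel_le a σ s β hg₂ (hRm z.2))).trans (le_of_eq ?_)
    rw [hdd]
    ring
  have hEt : ∀ z, energy a σ s α (DU z) + energy a σ s β (DT z) < ⊤ := fun z =>
    (hE z).trans_lt (ENNReal.mul_lt_top (by simp) (ENNReal.add_lt_top.mpr
      ⟨hdtop, ENNReal.add_lt_top.mpr ⟨edist_lt_top _ _, edist_lt_top _ _⟩⟩))
  have hNt : ∀ z, timeNorm a σ s (forcingU (DU z) (DT z))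
      + timeNorm a σ s (forcingT (DU z) (DT z)) < ⊤ := fun z => by
    refine (timeNorm_forcing_le_energy A (hDU z) (hDT z)).trans_lt (ENNReal.mul_lt_top ?_ (hEt z))
    exact ENNReal.add_lt_top.mpr ⟨ENNReal.mul_lt_top (ENNReal.mul_lt_top (by simp)
      A.κ_ne_top.lt_top) (hEt z), ENNReal.mul_lt_top (by simp) (by simp)⟩
  have hΦ : ∀ z : Lp C3 1 ν × Lp ℂ 1 ν, ∃ z' : Lp C3 1 ν × Lp ℂ 1 ν,
      z'.1 =ᵐ[ν] Function.uncurry (forcingU (DU z) (DT z)) ∧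
      z'.2 =ᵐ[ν] Function.uncurry (forcingT (DU z) (DT z)) := by
    intro z
    have m1 := stronglyMeasurable_forcingU (hDU z) (hDT z)
    have m2 := stronglyMeasurable_forcingT (hDU z) (hDT z)
    have l1 : MemLp (Function.uncurry (forcingU (DU z) (DT z))) 1 ν := by
      refine ⟨m1.aestronglyMeasurable, ?_⟩
      rw [eLpNorm_one_eq_lintegral_enorm, lintegral_spaceTimeMeasure m1]
      exact lt_of_le_of_lt le_self_add (hNt z)
    have l2 : MemLp (Function.uncurry (forcingT (DU z) (DT z))) 1 ν := by
      refine ⟨m2.aestronglyMeasurable, ?_⟩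
      rw [eLpNorm_one_eq_lintegral_enorm, lintegral_spaceTimeMeasure m2]
      exact lt_of_le_of_lt le_add_self (hNt z)
    exact ⟨(l1.toLp, l2.toLp), l1.coeFn_toLp, l2.coeFn_toLp⟩
  choose Φ hΦ1 hΦ2 using hΦ
  -- on the ball of radius `d` the energy is at most `2 (d + d + d)`
  have hEC : ∀ z ∈ Metric.closedEBall (0 : Lp C3 1 ν × Lp ℂ 1 ν) d,
      energy a σ s α (DU z) + energy a σ s β (DT z) ≤ 6 * d := by
    intro z hz
    rw [Metric.mem_closedEBall, Prod.edist_eq, max_le_iff] at hz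
    calc _ ≤ 2 * (d + (d + d)) := (hE z).trans (by
          gcongr
          · exact hz.1
          · exact hz.2)
      _ = 6 * d := by ring
  -- the nonlinearity has norm at most an eighth of the energy, and `6 d / 8 ≤ d`
  have hmaps : MapsTo Φ (Metric.closedEBall 0 d) (Metric.closedEBall 0 d) := by
    intro z hz
    have h1 := (A.timeNorm_forcing_le (hDU z) (hDT z) ((hEC z hz).trans hd)).trans (hEC z hz)
    rw [← edist_zero_eq_timeNorm (stronglyMeasurable_forcingU (hDU z) (hDT z)) (hΦ1 z),
      ← edist_zero_eq_timeNorm (stronglyMeasurable_forcingT (hDU z) (hDT z)) (hΦ2 z)] at h1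
    have h2 : edist (Φ z).1 0 + edist (Φ z).2 0 ≤ d := by
      refine (ENNReal.mul_le_mul_iff_right (a := 8) (by simp) (by simp)).mp (h1.trans ?_)
      gcongr
      norm_num
    rw [Metric.mem_closedEBall, Prod.edist_eq, max_le_iff]
    exact ⟨le_self_add.trans h2, le_add_self.trans h2⟩
  -- the factor `1/4` for the sum of the two components gives `1/2` for their maximum
  have hcontr : ContractingWith (1 / 2) (hmaps.restrict Φ _ _) := by
    refine ⟨by rw [div_lt_one (by norm_num)]; norm_num, fun ⟨z, hz⟩ ⟨z', hz'⟩ => ?_⟩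
    have h1 := A.timeNorm_forcing_sub_le hg₁ hg₂ (hRm z.1) (hRm z'.1) (hRm z.2) (hRm z'.2)
      (hRt _) (hRt _) (hRt _) (hRt _) ((hEC z hz).trans hd) ((hEC z' hz').trans hd)
    rw [← edist_eq_timeNorm (hRm z.1) (hRm z'.1) (hRe _) (hRe _),
      ← edist_eq_timeNorm (hRm z.2) (hRm z'.2) (hRe _) (hRe _),
      ← edist_eq_timeNorm (stronglyMeasurable_forcingU (hDU z) (hDT z))
        (stronglyMeasurable_forcingU (hDU z') (hDT z')) (hΦ1 z) (hΦ1 z'),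
      ← edist_eq_timeNorm (stronglyMeasurable_forcingT (hDU z) (hDT z))
        (stronglyMeasurable_forcingT (hDU z') (hDT z')) (hΦ2 z) (hΦ2 z')] at h1
    change edist (Φ z) (Φ z') ≤ ((1 / 2 : NNReal) : ℝ≥0∞) * edist z z'
    have h2 : edist (Φ z) (Φ z') ≤ edist (Φ z).1 (Φ z').1 + edist (Φ z).2 (Φ z').2 := by
      rw [Prod.edist_eq]
      exact max_le le_self_add le_add_self
    have h3 : edist z.1 z'.1 + edist z.2 z'.2 ≤ 2 * edist z z' := by
      rw [two_mul, Prod.edist_eq]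
      exact add_le_add (le_max_left _ _) (le_max_right _ _)
    have h4 : 2 * (2 * edist (Φ z) (Φ z')) ≤ 2 * edist z z' := by
      calc 2 * (2 * edist (Φ z) (Φ z')) = 4 * edist (Φ z) (Φ z') := by ring
        _ ≤ _ := (mul_le_mul_right h2 4).trans (h1.trans h3)
    have h5 := (ENNReal.mul_le_mul_iff_right (a := 2) (by simp) (by simp)).mp h4
    have h6 : ((1 / 2 : NNReal) : ℝ≥0∞) = 2⁻¹ := by
      rw [one_div, ENNReal.coe_inv (by norm_num)]
      rfl
    calc edist (Φ z) (Φ z') = 2⁻¹ * (2 * edist (Φ z) (Φ z')) := by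
          rw [← mul_assoc, ENNReal.inv_mul_cancel (by simp) (by simp), one_mul]
      _ ≤ _ := by
          rw [h6]
          gcongr
  obtain ⟨z, hz, hfix, -, -⟩ := hcontr.exists_fixedPoint'
    (Metric.isClosed_closedEBall.isComplete) hmaps (x := 0) (by simp) (edist_ne_top _ _)
  have hz' := hz
  rw [Metric.mem_closedEBall, Prod.edist_eq, max_le_iff] at hz'
  refine ⟨fun t ξ => z.1 (t, ξ), fun t ξ => z.2 (t, ξ), hRm z.1, hRm z.2, ?_, ?_, ?_, ?_⟩
  · rw [← hRn]
    exact hz'.1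
  · rw [← hRn]
    exact hz'.2
  · have h := hΦ1 z
    rw [hfix] at h
    exact ae_of_ae_spaceTimeMeasure h
  · have h := hΦ2 z
    rw [hfix] at h
    exact ae_of_ae_spaceTimeMeasure h

end FixedPoint

/-! ### Elements of the Lei–Lin–Gevrey spaces -/

section LeiLinElements

variable {V : Type*} [NormedAddCommGroup V] [NormedSpace ℂ V] [CompleteSpace V] {a σ r : ℝ}

theorem LeiLin.exists_isHat (f : LeiLin V a σ r) :
    ∃ g : E3 → V, StronglyMeasurable g ∧ IsHat f.toDistr g := by
  obtain ⟨g, h⟩ := exists_isHat_of_leiLinENorm_lt_top f.2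
  have hm := h.1.aestronglyMeasurable
  exact ⟨hm.mk, hm.stronglyMeasurable_mk, h.congr_ae hm.ae_eq_mk⟩

theorem LeiLin.ofReal_norm_eq (f : LeiLin V a σ r) :
    ENNReal.ofReal ‖f‖ = leiLinENorm a σ r f.toDistr :=
  ENNReal.ofReal_toReal (ne_of_lt f.2)

theorem LeiLin.ofReal_norm_eq_xNorm {f : LeiLin V a σ r} {g : E3 → V} (h : IsHat f.toDistr g) :
    ENNReal.ofReal ‖f‖ = xNorm a σ r g :=
  f.ofReal_norm_eq.trans (leiLinENorm_eq a σ r h)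

theorem LeiLin.ofReal_norm_sub_eq_xNorm {f f' : LeiLin V a σ r} {g g' : E3 → V}
    (h : IsHat f.toDistr g) (h' : IsHat f'.toDistr g') :
    ENNReal.ofReal ‖f - f'‖ = xNorm a σ r (g - g') :=
  LeiLin.ofReal_norm_eq_xNorm (f := f - f') (h.sub h')

theorem LeiLin.ext_distr {f f' : LeiLin V a σ r} (h : f.toDistr = f'.toDistr) : f = f' :=
  Subtype.ext h

theorem exists_leiLin {f : 𝓢'(E3, V)} {g : E3 → V} (h : IsHat f g) (hx : xNorm a σ r g < ⊤) :
    ∃ w : LeiLin V a σ r, w.toDistr = f :=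
  ⟨⟨f, by
    change leiLinENorm a σ r f < ⊤
    rw [leiLinENorm_eq a σ r h]
    exact hx⟩, rfl⟩

end LeiLinElements

/-! ### Joint measurability of Fourier transforms of curves -/

section JointMeasurability

variable {V : Type*} [NormedAddCommGroup V] {a σ s T : ℝ}

/-- A sequence that converges fast in `𝒳^s` converges almost everywhere on the Fourier side. -/
theorem ae_tendsto_of_xNorm_le {g : E3 → V} {G : ℕ → E3 → V} (hg : AEStronglyMeasurable g)
    (hG : ∀ n, AEStronglyMeasurable (G n)) {B : ℕ → ℝ≥0∞} (hB : ∑' n, B n ≠ ⊤)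
    (h : ∀ n, xNorm a σ s (G n - g) ≤ B n) :
    ∀ᵐ ξ, Tendsto (fun n => G n ξ) atTop (𝓝 (g ξ)) := by
  have hm : ∀ n, AEMeasurable fun ξ => ENNReal.ofReal (leiLinWeight a σ s ξ) * ‖(G n - g) ξ‖ₑ :=
    fun n => (measurable_ofReal_leiLinWeight a σ s).aemeasurable.mul ((hG n).sub hg).enorm
  have h1 : ∫⁻ ξ, ∑' n, ENNReal.ofReal (leiLinWeight a σ s ξ) * ‖(G n - g) ξ‖ₑ ≠ ⊤ := by
    rw [lintegral_tsum hm]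
    exact ne_top_of_le_ne_top hB (ENNReal.tsum_le_tsum h)
  filter_upwards [ae_lt_top' (AEMeasurable.tsum hm) h1, ae_ne_zero] with ξ hξ h0
  rw [ENNReal.tsum_mul_left] at hξ
  have hw : ENNReal.ofReal (leiLinWeight a σ s ξ) ≠ 0 := by
    simpa using leiLinWeight_pos a σ s h0
  have h2 : ∑' n, ‖(G n - g) ξ‖ₑ ≠ ⊤ := by
    intro h3
    rw [h3, ENNReal.mul_top hw] at hξ
    exact lt_irrefl _ hξ
  have h3 := ENNReal.tendsto_atTop_zero_of_tsum_ne_top h2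
  rw [tendsto_iff_edist_tendsto_0]
  simpa [edist_eq_enorm_sub] using h3

variable [NormedSpace ℂ V] [CompleteSpace V] [SecondCountableTopology V]

/-- A continuous curve in `𝒳^s` has a jointly measurable Fourier transform. -/
theorem exists_jointly_measurable_hat (u : C(Icc (0 : ℝ) T, LeiLin V a σ s)) :
    ∃ U : Icc (0 : ℝ) T → E3 → V, StronglyMeasurable (Function.uncurry U) ∧
      ∀ t, IsHat (u t).toDistr (U t) := by
  borelize V
  choose h hh hhat using fun t => (u t).exists_isHat
  -- `u` is uniformly approximated by its values on a grid of mesh `δ`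
  have happrox : ∀ n : ℕ, ∃ W : Icc (0 : ℝ) T → E3 → V,
      StronglyMeasurable (Function.uncurry W) ∧ ∀ t, xNorm a σ s (W t - h t) ≤ 2⁻¹ ^ n := by
    intro n
    obtain ⟨δ, hδ, hu⟩ := Metric.uniformContinuous_iff.mp
      (CompactSpace.uniformContinuous_of_continuous u.continuous) ((2 : ℝ)⁻¹ ^ n) (by positivity)
    set e := δ / 2 with he
    have he0 : 0 < e := by positivity
    let grid : ℕ → E3 → V := fun k =>
      if hk : (k : ℝ) * e ∈ Icc (0 : ℝ) T then h ⟨k * e, hk⟩ else 0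
    have hgrid : Measurable fun q : ℕ × E3 => grid q.1 q.2 := by
      refine measurable_from_prod_countable_right fun k => ?_
      by_cases hk : (k : ℝ) * e ∈ Icc (0 : ℝ) T
      · simp only [grid, hk, dite_true]
        exact (hh _).measurable
      · simp only [grid, hk, dite_false]
        exact measurable_const
    refine ⟨fun t ξ => grid ⌊(t : ℝ) / e⌋₊ ξ, ?_, fun t => ?_⟩
    · refine Measurable.stronglyMeasurable ?_
      exact hgrid.comp ((Nat.measurable_floor.comp
        (by fun_prop : Measurable fun p : Icc (0 : ℝ) T × E3 => (p.1 : ℝ) / e)).prodMk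
          measurable_snd)
    · have h1 : (⌊(t : ℝ) / e⌋₊ : ℝ) * e ≤ t := by
        rw [← le_div_iff₀ he0]
        exact Nat.floor_le (div_nonneg t.2.1 he0.le)
      have h2 : (t : ℝ) < (⌊(t : ℝ) / e⌋₊ + 1) * e := by
        rw [← div_lt_iff₀ he0]
        exact Nat.lt_floor_add_one _
      have hk : (⌊(t : ℝ) / e⌋₊ : ℝ) * e ∈ Icc (0 : ℝ) T := ⟨by positivity, h1.trans t.2.2⟩
      have hW : (fun ξ => grid ⌊(t : ℝ) / e⌋₊ ξ) = h ⟨_, hk⟩ := by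
        simp only [grid, hk, dite_true]
      change xNorm a σ s ((fun ξ => grid ⌊(t : ℝ) / e⌋₊ ξ) - h t) ≤ _
      rw [hW, ← LeiLin.ofReal_norm_sub_eq_xNorm (hhat _) (hhat t)]
      have hd : dist (⟨_, hk⟩ : Icc (0 : ℝ) T) t < δ := by
        rw [Subtype.dist_eq, Real.dist_eq, abs_lt]
        constructor <;> simp only <;> nlinarith
      have := (hu hd).le
      rw [dist_eq_norm] at this
      refine (ENNReal.ofReal_le_ofReal this).trans (le_of_eq ?_)
      rw [ENNReal.ofReal_pow (by norm_num), ENNReal.ofReal_inv_of_pos (by norm_num)]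
      norm_num
  choose W hWm hW using happrox
  have hconv : ∀ t, ∀ᵐ ξ, Tendsto (fun n => W n t ξ) atTop (𝓝 (h t ξ)) := fun t =>
    ae_tendsto_of_xNorm_le (hh t).aestronglyMeasurable
      (fun n => (section_stronglyMeasurable (hWm n) t).aestronglyMeasurable)
      (B := fun n => 2⁻¹ ^ n) (by simp [ENNReal.tsum_geometric]) fun n => hW n t
  -- the limit is taken where it exists, which is almost everywhere at every fixed time
  let S : Set (Icc (0 : ℝ) T × E3) :=
    {p | ∃ l, Tendsto (fun n => Function.uncurry (W n) p) atTop (𝓝 l)}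
  have hS : MeasurableSet S := measurableSet_exists_tendsto fun n => (hWm n).measurable
  have hlim : ∀ p, ∃ l, Tendsto (fun n => S.indicator (Function.uncurry (W n)) p) atTop (𝓝 l) := by
    intro p
    by_cases hp : p ∈ S
    · obtain ⟨l, hl⟩ := hp
      exact ⟨l, by simpa [indicator_of_mem (show p ∈ S from ⟨l, hl⟩)] using hl⟩
    · exact ⟨0, by simp [indicator_of_notMem hp]⟩
  choose L hL using hlim
  refine ⟨fun t ξ => L (t, ξ), ?_, fun t => (hhat t).congr_ae ?_⟩
  · exact stronglyMeasurable_of_tendsto atTop (fun n => (hWm n).indicator hS)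
      (tendsto_pi_nhds.mpr hL)
  · filter_upwards [hconv t] with ξ hξ
    have hp : (t, ξ) ∈ S := ⟨_, hξ⟩
    have := hL (t, ξ)
    simp only [indicator_of_mem hp] at this
    exact tendsto_nhds_unique hξ this

end JointMeasurability

/-! ### Continuity in time of the Duhamel formula -/

section DuhamelCurve

variable {V : Type*} [NormedAddCommGroup V] [NormedSpace ℂ V] {a σ s T : ℝ}

theorem continuous_duhamel {γ : ℝ} (g : E3 → V) {F : Icc (0 : ℝ) T → E3 → V}
    (hF : StronglyMeasurable (Function.uncurry F)) {ξ : E3}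
    (h : ∫⁻ τ, ‖F τ ξ‖ₑ ∂timeMeasure T < ⊤) : Continuous fun t => duhamel γ g F t ξ := by
  have hFξ : StronglyMeasurable fun τ => F τ ξ :=
    hF.comp_measurable (g := fun τ => (τ, ξ)) (by fun_prop)
  have hint : Integrable (fun τ => F τ ξ) (timeMeasure T) := ⟨hFξ.aestronglyMeasurable, h⟩
  have hk : ∀ t : Icc (0 : ℝ) T, Measurable fun τ : Icc (0 : ℝ) T =>
      ((Real.exp (-(((t : ℝ) - τ) * ‖ξ‖ ^ (2 * γ))) : ℝ) : ℂ) := fun t => by fun_prop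
  unfold duhamel
  refine Continuous.add (by fun_prop) ?_
  simp_rw [← integral_indicator measurableSet_Iic]
  rw [continuous_iff_continuousAt]
  intro t₀
  refine continuousAt_of_dominated (bound := fun τ => ‖F τ ξ‖) ?_ ?_ hint.norm ?_
  · refine Eventually.of_forall fun t => ?_
    exact (((hk t).stronglyMeasurable.smul hFξ).indicator measurableSet_Iic).aestronglyMeasurable
  · refine Eventually.of_forall fun t => Eventually.of_forall fun τ => ?_
    by_cases hτ : τ ≤ t
    · have hτ' : (τ : ℝ) ≤ t := hτ
      rw [indicator_of_mem (mem_Iic.mpr hτ), norm_smul, Complex.norm_real,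
        Real.norm_of_nonneg (Real.exp_pos _).le]
      refine mul_le_of_le_one_left (norm_nonneg _) ?_
      rw [Real.exp_le_one_iff, neg_nonpos]
      have := sub_nonneg.mpr hτ'
      positivity
    · rw [indicator_of_notMem (by simpa using hτ)]
      simp
  · filter_upwards [(measure_eq_zero_iff_ae_notMem.mp (measure_singleton t₀) :
      ∀ᵐ τ ∂timeMeasure T, τ ∉ ({t₀} : Set (Icc (0 : ℝ) T)))] with τ hτ
    have hc : ContinuousAt (fun t : Icc (0 : ℝ) T =>
        (Real.exp (-(((t : ℝ) - τ) * ‖ξ‖ ^ (2 * γ))) : ℂ) • F τ ξ) t₀ := by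
      have : Continuous fun t : Icc (0 : ℝ) T =>
        ((Real.exp (-(((t : ℝ) - τ) * ‖ξ‖ ^ (2 * γ))) : ℝ) : ℂ) := by fun_prop
      exact (this.smul continuous_const).continuousAt
    rcases lt_or_gt_of_ne (fun h => hτ (by simpa using h) : τ ≠ t₀) with hlt | hgt
    · refine hc.congr ?_
      filter_upwards [Ioi_mem_nhds hlt] with t ht
      rw [indicator_of_mem (mem_Iic.mpr (le_of_lt ht))]
    · refine (continuousAt_const (y := (0 : V))).congr ?_
      filter_upwards [Iio_mem_nhds hgt] with t ht
      rw [indicator_of_notMem (by simpa using ht)]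

variable [CompleteSpace V]

/-- The Duhamel formula defines a continuous curve in `𝒳^s`. -/
theorem exists_continuousMap_duhamel (ha : 0 ≤ a) (hs : -1 ≤ s) (hs0 : s ≤ 0) (γ : ℝ)
    {g : E3 → V} {F : Icc (0 : ℝ) T → E3 → V} (hg : StronglyMeasurable g)
    (hF : StronglyMeasurable (Function.uncurry F)) (fg : xNorm a σ s g < ⊤)
    (fF : timeNorm a σ s F < ⊤) :
    ∃ u : C(Icc (0 : ℝ) T, LeiLin V a σ s), ∀ t, IsHat (u t).toDistr (duhamel γ g F t) := by
  have hD := stronglyMeasurable_duhamel γ hg hF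
  have hfin : ∀ t, xNorm a σ s (duhamel γ g F t) < ⊤ := fun t =>
    lt_of_le_of_lt ((le_iSup (fun t => xNorm a σ s (duhamel γ g F t)) t).trans
      (supNorm_duhamel_le a σ s γ hg hF)) (ENNReal.add_lt_top.mpr ⟨fg, fF⟩)
  have hex : ∀ t, ∃ w : LeiLin V a σ s, IsHat w.toDistr (duhamel γ g F t) := fun t => by
    obtain ⟨f, hf⟩ := (temperedIntegrable_of_xNorm_lt_top ha hs hs0
      (section_stronglyMeasurable hD t).aestronglyMeasurable (hfin t)).exists_isHat
    obtain ⟨w, hw⟩ := exists_leiLin hf (hfin t)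
    exact ⟨w, hw ▸ hf⟩
  choose u hu using hex
  refine ⟨⟨u, ?_⟩, hu⟩
  rw [continuous_iff_continuousAt]
  intro t₀
  rw [ContinuousAt, tendsto_iff_norm_sub_tendsto_zero]
  have key : Tendsto (fun t => xNorm a σ s (duhamel γ g F t - duhamel γ g F t₀)) (𝓝 t₀) (𝓝 0) := by
    -- dominated convergence in frequency
    set b : E3 → ℝ≥0∞ := fun ξ => ENNReal.ofReal (leiLinWeight a σ s ξ) *
      (2 * (‖g ξ‖ₑ + ∫⁻ τ, ‖F τ ξ‖ₑ ∂timeMeasure T)) with hb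
    have hbfin : ∫⁻ ξ, b ξ ≠ ⊤ := by
      have hm : Measurable fun ξ => ENNReal.ofReal (leiLinWeight a σ s ξ) * ‖g ξ‖ₑ :=
        (measurable_ofReal_leiLinWeight a σ s).mul hg.enorm
      have e : ∫⁻ ξ, b ξ = 2 * (xNorm a σ s g + timeNorm a σ s F) := by
        rw [timeNorm_eq_lintegral_swap a σ s hF, xNorm, ← lintegral_add_left hm,
          ← lintegral_const_mul' _ _ (by simp)]
        refine lintegral_congr fun ξ => ?_
        rw [hb]
        ring
      rw [e]
      exact (ENNReal.mul_lt_top (by simp) (ENNReal.add_lt_top.mpr ⟨fg, fF⟩)).ne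
    have h0 : (0 : ℝ≥0∞) = ∫⁻ _ : E3, 0 := by simp
    rw [h0]
    refine tendsto_lintegral_filter_of_dominated_convergence b ?_ ?_ hbfin ?_
    · refine Eventually.of_forall fun t => ?_
      exact (measurable_ofReal_leiLinWeight a σ s).mul
        ((section_stronglyMeasurable hD t).sub (section_stronglyMeasurable hD t₀)).enorm
    · refine Eventually.of_forall fun t => Eventually.of_forall fun ξ => ?_
      rw [hb]
      refine mul_le_mul_right ((enorm_sub_le).trans ?_) _
      rw [two_mul]
      exact add_le_add (enorm_duhamel_le_add γ g F t ξ) (enorm_duhamel_le_add γ g F t₀ ξ)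
    · filter_upwards [ae_lintegral_lt_top_of_timeNorm hF fF] with ξ hξ
      have hc := ((continuous_duhamel (γ := γ) g hF hξ).sub continuous_const).enorm.tendsto t₀
        (f := fun t => ‖duhamel γ g F t ξ - duhamel γ g F t₀ ξ‖ₑ)
      have := ENNReal.Tendsto.const_mul (a := ENNReal.ofReal (leiLinWeight a σ s ξ)) hc
        (Or.inr ENNReal.ofReal_ne_top)
      simpa using this
  have := (ENNReal.tendsto_toReal ENNReal.zero_ne_top).comp key
  refine this.congr fun t => ?_
  simp only [Function.comp_apply]
  rw [← LeiLin.ofReal_norm_sub_eq_xNorm (hu t) (hu t₀), ENNReal.toReal_ofReal (norm_nonneg _)]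

end DuhamelCurve

/-! ### Integrability in time with values in smaller spaces -/

section TimeIntegrability

variable {V : Type*} [NormedAddCommGroup V] {a σ s r T : ℝ}

/-- Low frequencies gain derivatives. -/
theorem xNorm_indicator_ball_le (a σ : ℝ) {s r : ℝ} (hr : s ≤ r) (n : ℕ) (g : E3 → V) :
    xNorm a σ r ({ξ : E3 | ‖ξ‖ ≤ n}.indicator g)
      ≤ ENNReal.ofReal ((n : ℝ) ^ (r - s)) * xNorm a σ s g := by
  unfold xNorm
  rw [← lintegral_const_mul' _ _ (by simp)]
  refine lintegral_mono_ae ?_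
  filter_upwards [ae_ne_zero] with ξ h0
  by_cases hξ : ‖ξ‖ ≤ n
  · rw [indicator_of_mem (by exact hξ), ← mul_assoc, ← ENNReal.ofReal_mul (by positivity)]
    gcongr
    have e := leiLinWeight_add a σ s (r - s) h0
    rw [add_sub_cancel] at e
    rw [e]
    have := leiLinWeight_nonneg a σ s ξ
    gcongr
  · rw [indicator_of_notMem (by exact hξ)]
    simp

theorem tendsto_xNorm_indicator_ball {g : E3 → V} (hg : StronglyMeasurable g)
    (h : xNorm a σ r g < ⊤) :
    Tendsto (fun n : ℕ => xNorm a σ r ({ξ : E3 | ‖ξ‖ ≤ n}.indicator g - g)) atTop (𝓝 0) := by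
  have hS : ∀ n : ℕ, MeasurableSet {ξ : E3 | ‖ξ‖ ≤ n} := fun n =>
    measurableSet_le measurable_norm measurable_const
  rw [← lintegral_zero (μ := (volume : Measure E3))]
  refine tendsto_lintegral_of_dominated_convergence
    (fun ξ => ENNReal.ofReal (leiLinWeight a σ r ξ) * ‖g ξ‖ₑ) (fun n => ?_) (fun n => ?_) h.ne ?_
  · exact (measurable_ofReal_leiLinWeight a σ r).mul ((hg.indicator (hS n)).sub hg).enorm
  · refine Eventually.of_forall fun ξ => ?_
    refine mul_le_mul_right ?_ _
    by_cases hξ : ‖ξ‖ ≤ n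
    · rw [Pi.sub_apply, indicator_of_mem (by exact hξ)]
      simp
    · rw [Pi.sub_apply, indicator_of_notMem (by exact hξ)]
      simp
  · refine Eventually.of_forall fun ξ => tendsto_const_nhds.congr' ?_
    filter_upwards [eventually_ge_atTop ⌈‖ξ‖⌉₊] with n hn
    have hξ : ‖ξ‖ ≤ (n : ℝ) := (Nat.le_ceil _).trans (by exact_mod_cast hn)
    rw [Pi.sub_apply, indicator_of_mem (show ξ ∈ {ξ : E3 | ‖ξ‖ ≤ (n : ℝ)} from hξ)]
    simp

variable [NormedSpace ℂ V] [CompleteSpace V]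

/-- A continuous curve in `𝒳^s` that takes values in the smaller space `𝒳^r` at almost every time is
strongly measurable in `𝒳^r`: it is a limit of its frequency truncations, which are continuous
in `𝒳^r`. -/
theorem exists_aestronglyMeasurable_leiLin (ha : 0 ≤ a) (hs : -1 ≤ s) (hs0 : s ≤ 0) (hr : s ≤ r)
    (u : C(Icc (0 : ℝ) T, LeiLin V a σ s)) {U : Icc (0 : ℝ) T → E3 → V}
    (hU : StronglyMeasurable (Function.uncurry U)) (hu : ∀ t, IsHat (u t).toDistr (U t))
    (h : ∀ᵐ t ∂timeMeasure T, xNorm a σ r (U t) < ⊤) :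
    ∃ w : Icc (0 : ℝ) T → LeiLin V a σ r, AEStronglyMeasurable w (timeMeasure T) ∧
      ∀ᵐ t ∂timeMeasure T, (w t).toDistr = (u t).toDistr := by
  classical
  have hS : ∀ n : ℕ, MeasurableSet {ξ : E3 | ‖ξ‖ ≤ n} := fun n =>
    measurableSet_le measurable_norm measurable_const
  have hUm := section_stronglyMeasurable hU
  have hfin : ∀ t, xNorm a σ s (U t) < ⊤ := fun t => by
    rw [← LeiLin.ofReal_norm_eq_xNorm (hu t)]
    exact ENNReal.ofReal_lt_top
  have hex : ∀ (n : ℕ) t, ∃ w : LeiLin V a σ r,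
      IsHat w.toDistr ({ξ : E3 | ‖ξ‖ ≤ n}.indicator (U t)) := fun n t => by
    have ht := temperedIntegrable_of_xNorm_lt_top ha hs hs0 (hUm t).aestronglyMeasurable (hfin t)
    obtain ⟨f, hf⟩ := (ht.mono ((hUm t).indicator (hS n)).aestronglyMeasurable 1
      (Eventually.of_forall fun ξ => by
        rw [one_mul]
        exact norm_indicator_le_norm_self _ _)).exists_isHat
    obtain ⟨w, hw⟩ := exists_leiLin hf ((xNorm_indicator_ball_le a σ hr n (U t)).trans_lt
      (ENNReal.mul_lt_top ENNReal.ofReal_lt_top (hfin t)))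
    exact ⟨w, hw ▸ hf⟩
  choose W hW using hex
  have hWc : ∀ n, Continuous (W n) := fun n => by
    rw [continuous_iff_continuousAt]
    intro t₀
    rw [ContinuousAt, tendsto_iff_norm_sub_tendsto_zero]
    have h1 : Tendsto (fun t => (n : ℝ) ^ (r - s) * ‖u t - u t₀‖) (𝓝 t₀) (𝓝 0) := by
      have := (tendsto_iff_norm_sub_tendsto_zero.mp (u.continuous.tendsto t₀)).const_mul
        ((n : ℝ) ^ (r - s))
      simpa using this
    refine squeeze_zero (fun _ => norm_nonneg _) (fun t => ?_) h1
    rw [← ENNReal.ofReal_le_ofReal_iff (by positivity), ENNReal.ofReal_mul (by positivity),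
      LeiLin.ofReal_norm_sub_eq_xNorm (hW n t) (hW n t₀),
      LeiLin.ofReal_norm_sub_eq_xNorm (hu t) (hu t₀), ← indicator_sub']
    exact xNorm_indicator_ball_le a σ hr n _
  let w : Icc (0 : ℝ) T → LeiLin V a σ r := fun t =>
    if ht : xNorm a σ r (U t) < ⊤ then (exists_leiLin (hu t) ht).choose else 0
  have hw : ∀ t, xNorm a σ r (U t) < ⊤ → (w t).toDistr = (u t).toDistr := fun t ht => by
    simp only [w, ht, dite_true]
    exact (exists_leiLin (hu t) ht).choose_spec
  refine ⟨w, aestronglyMeasurable_of_tendsto_ae atTop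
    (fun n => (hWc n).aestronglyMeasurable) ?_, ?_⟩
  · filter_upwards [h] with t ht
    rw [tendsto_iff_norm_sub_tendsto_zero]
    have hwt : IsHat (w t).toDistr (U t) := hw t ht ▸ hu t
    have h1 := (ENNReal.tendsto_toReal ENNReal.zero_ne_top).comp
      (tendsto_xNorm_indicator_ball (hUm t) ht)
    refine h1.congr fun n => ?_
    simp only [Function.comp_apply]
    rw [← LeiLin.ofReal_norm_sub_eq_xNorm (hW n t) hwt, ENNReal.toReal_ofReal (norm_nonneg _)]
  · filter_upwards [h] with t ht
    exact hw t ht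

/-- Interpolation between `L^∞_T(𝒳^s)` and `L¹_T(𝒳^{s+2γ})`. -/
theorem memLpLeiLin_of_energy_lt_top (ha : 0 ≤ a) (hs : -1 ≤ s) (hs0 : s ≤ 0) {γ p : ℝ}
    (hγ : 0 ≤ γ) (hp : 1 ≤ p)
    (u : C(Icc (0 : ℝ) T, LeiLin V a σ s)) {U : Icc (0 : ℝ) T → E3 → V}
    (hU : StronglyMeasurable (Function.uncurry U)) (hu : ∀ t, IsHat (u t).toDistr (U t))
    (h : energy a σ s γ U < ⊤) :
    MemLpLeiLin a σ (s + 2 * γ / p) p fun t => (u t).toDistr := by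
  have hp0 : 0 < p := by linarith
  have h1 : supNorm a σ s U < ⊤ := lt_of_le_of_lt le_self_add h
  have h2 : timeNorm a σ (s + 2 * γ) U < ⊤ := lt_of_le_of_lt le_add_self h
  have hle : ∀ t, xNorm a σ (s + 2 * γ / p) (U t) ≤
      supNorm a σ s U ^ (1 - p⁻¹) * xNorm a σ (s + 2 * γ) (U t) ^ p⁻¹ := fun t => by
    have hp1 : p⁻¹ ≤ 1 := inv_le_one_of_one_le₀ hp
    have := xNorm_interpolate a σ s (2 * γ) (inv_nonneg.mpr hp0.le) hp1
      (section_stronglyMeasurable hU t).aestronglyMeasurable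
    rw [show p⁻¹ * (2 * γ) = 2 * γ / p by ring] at this
    refine this.trans (mul_le_mul_left ?_ _)
    exact ENNReal.rpow_le_rpow (le_iSup (fun t => xNorm a σ s (U t)) t) (sub_nonneg.mpr hp1)
  have hp1 : 0 ≤ 1 - p⁻¹ := sub_nonneg.mpr (inv_le_one_of_one_le₀ hp)
  have hfin : ∀ᵐ t ∂timeMeasure T, xNorm a σ (s + 2 * γ / p) (U t) < ⊤ := by
    filter_upwards [ae_lt_top (measurable_xNorm a σ (s + 2 * γ) hU) h2.ne] with t ht
    exact (hle t).trans_lt (ENNReal.mul_lt_top (ENNReal.rpow_lt_top_of_nonneg hp1 h1.ne)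
      (ENNReal.rpow_lt_top_of_nonneg (inv_nonneg.mpr hp0.le) ht.ne))
  have hr : s ≤ s + 2 * γ / p := le_add_of_nonneg_right (by positivity)
  obtain ⟨w, hw, hwu⟩ := exists_aestronglyMeasurable_leiLin ha hs hs0 hr u hU hu hfin
  refine ⟨w, ⟨hw, ?_⟩, hwu⟩
  rw [eLpNorm_lt_top_iff_lintegral_rpow_enorm_lt_top (by simpa using hp0) ENNReal.ofReal_ne_top,
    ENNReal.toReal_ofReal hp0.le]
  have h3 : supNorm a σ s U ^ ((1 - p⁻¹) * p) ≠ ⊤ :=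
    (ENNReal.rpow_lt_top_of_nonneg (by positivity) h1.ne).ne
  refine lt_of_le_of_lt (b := ∫⁻ t, supNorm a σ s U ^ ((1 - p⁻¹) * p)
    * xNorm a σ (s + 2 * γ) (U t) ∂timeMeasure T) (lintegral_mono_ae ?_) ?_
  · filter_upwards [hwu] with t ht
    have hwt : IsHat (w t).toDistr (U t) := ht ▸ hu t
    rw [← ofReal_norm, LeiLin.ofReal_norm_eq_xNorm hwt]
    refine (ENNReal.rpow_le_rpow (hle t) hp0.le).trans (le_of_eq ?_)
    rw [ENNReal.mul_rpow_of_nonneg _ _ hp0.le, ← ENNReal.rpow_mul, ← ENNReal.rpow_mul,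
      inv_mul_cancel₀ hp0.ne', ENNReal.rpow_one]
  · rw [lintegral_const_mul' _ _ h3]
    exact ENNReal.mul_lt_top h3.lt_top h2

end TimeIntegrability

/-! ### The mild formulation on the Fourier side -/

section MildFormula

variable {V : Type*} [NormedAddCommGroup V] [NormedSpace ℂ V] [CompleteSpace V] {a σ s T : ℝ}

/-- The Duhamel integral in `𝓢'` is given on the Fourier side by a pointwise integral. -/
theorem exists_hasTimeIntegral_fracHeat (ha : 0 ≤ a) (hs : -1 ≤ s) (hs0 : s ≤ 0) (γ : ℝ)
    {H : Icc (0 : ℝ) T → E3 → V} (hH : StronglyMeasurable (Function.uncurry H))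
    (fH : timeNorm a σ s H < ⊤) {G : Icc (0 : ℝ) T → 𝓢'(E3, V)}
    (hG : ∀ᵐ τ ∂timeMeasure T, IsHat (G τ) (H τ)) (t : Icc (0 : ℝ) T) :
    ∃ J, IsHat J (fun ξ => ∫ τ in Iic t,
        (Real.exp (-(((t : ℝ) - τ) * ‖ξ‖ ^ (2 * γ))) : ℂ) • H τ ξ ∂timeMeasure T) ∧
      HasTimeIntegral t (fun τ => fracHeat γ ((t : ℝ) - τ) (G τ)) J := by
  refine exists_hasTimeIntegral t ⟨?_, ?_⟩ ?_
  · have h1 : Measurable fun p : Icc (0 : ℝ) T × E3 => (1 + ‖p.2‖ ^ 2 : ℝ)⁻¹ := by fun_prop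
    have h2 : Measurable fun p : Icc (0 : ℝ) T × E3 =>
      ((Real.exp (-(((t : ℝ) - p.1) * ‖p.2‖ ^ (2 * γ))) : ℝ) : ℂ) := by fun_prop
    exact (h1.stronglyMeasurable.smul (h2.stronglyMeasurable.smul hH)).aestronglyMeasurable
  · have h1 : Measurable fun p : Icc (0 : ℝ) T × E3 => (1 + ‖p.2‖ ^ 2 : ℝ)⁻¹ := by fun_prop
    have h2 : Measurable fun p : Icc (0 : ℝ) T × E3 =>
      ((Real.exp (-(((t : ℝ) - p.1) * ‖p.2‖ ^ (2 * γ))) : ℝ) : ℂ) := by fun_prop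
    have h3 : Measurable fun p : Icc (0 : ℝ) T × E3 => ‖(1 + ‖p.2‖ ^ 2 : ℝ)⁻¹ •
        ((Real.exp (-(((t : ℝ) - p.1) * ‖p.2‖ ^ (2 * γ))) : ℝ) : ℂ) • H p.1 p.2‖ₑ :=
      (h1.stronglyMeasurable.smul (h2.stronglyMeasurable.smul hH)).enorm
    rw [HasFiniteIntegral, lintegral_prod _ h3.aemeasurable]
    refine lt_of_le_of_lt ((setLIntegral_mono' measurableSet_Iic fun τ hτ => ?_).trans
      (setLIntegral_le_lintegral (Iic t) fun τ => xNorm a σ s (H τ))) fH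
    refine lintegral_mono_ae ?_
    filter_upwards [ae_ne_zero] with ξ hξ
    have hτ' : (τ : ℝ) ≤ t := hτ
    have h3 : ‖(Real.exp (-(((t : ℝ) - τ) * ‖ξ‖ ^ (2 * γ))) : ℂ)‖ₑ ≤ 1 := by
      rw [← ofReal_norm, Complex.norm_real, Real.norm_of_nonneg (Real.exp_pos _).le,
        ENNReal.ofReal_le_one, Real.exp_le_one_iff, neg_nonpos]
      have := sub_nonneg.mpr hτ'
      positivity
    rw [enorm_smul, enorm_smul]
    refine mul_le_mul' ?_ (mul_le_of_le_one_left' h3)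
    rw [← ofReal_norm, Real.norm_of_nonneg (by positivity)]
    exact ENNReal.ofReal_le_ofReal (inv_one_add_sq_le_leiLinWeight ha hs hs0 hξ)
  · filter_upwards [ae_restrict_of_ae hG, ae_restrict_mem measurableSet_Iic,
      ae_restrict_of_ae (ae_lt_top (measurable_xNorm a σ s hH) fH.ne)] with τ h1 h2 h3
    have h2' : (τ : ℝ) ≤ t := h2
    exact h1.fracHeat (temperedIntegrable_of_xNorm_lt_top ha hs hs0
      (section_stronglyMeasurable hH τ).aestronglyMeasurable h3) γ (sub_nonneg.mpr h2')

variable {α β : ℝ} {κ C₁ : ℝ≥0∞}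
  {u : Icc (0 : ℝ) T → 𝓢'(E3, C3)} {θ : Icc (0 : ℝ) T → 𝓢'(E3, ℂ)}
  {U : Icc (0 : ℝ) T → E3 → C3} {Θ : Icc (0 : ℝ) T → E3 → ℂ}

/-- On the Fourier side, the right-hand side of the velocity equation is the Duhamel formula with
the forcing term `forcingU`. -/
theorem Admissible.exists_velocity (A : Admissible a σ α β s T κ C₁)
    (hU : StronglyMeasurable (Function.uncurry U)) (hΘ : StronglyMeasurable (Function.uncurry Θ))
    (hu : ∀ t, IsHat (u t) (U t)) (hθ : ∀ t, IsHat (θ t) (Θ t))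
    (eU : energy a σ s α U < ⊤) (eΘ : energy a σ s β Θ < ⊤) {u₀ : 𝓢'(E3, C3)} {g₁ : E3 → C3}
    (h₀ : IsHat u₀ g₁) (t₀ : TemperedIntegrable g₁) (t : Icc (0 : ℝ) T) :
    ∃ N L : 𝓢'(E3, C3),
      HasTimeIntegral t
        (fun τ => fracHeat α ((t : ℝ) - τ) (leray (transport (u τ) (u τ)))) N ∧
      HasTimeIntegral t (fun τ => fracHeat α ((t : ℝ) - τ) (leray (buoyancy (θ τ)))) L ∧
      IsHat (fracHeat α t u₀ - N + L) (duhamel α g₁ (forcingU U Θ) t) := by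
  have iU := ae_integrable_section A.ha A.hs A.hs0 A.hα hU eU
  have hA := stronglyMeasurable_leray (stronglyMeasurable_transportHat hU hU)
  have hB := stronglyMeasurable_leray (stronglyMeasurable_buoyancy hΘ)
  have fA : timeNorm a σ s (fun t ξ => leraySymbol ξ (transportHat (U t) (U t) ξ)) < ⊤ :=
    (timeNorm_leray_le a σ s fun t => transportHat (U t) (U t)).trans_lt
      (ENNReal.mul_lt_top (by simp) ((A.bilinear_uu hU hU).trans_lt
        (ENNReal.mul_lt_top (ENNReal.mul_lt_top (by simp) A.κ_ne_top.lt_top)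
          (ENNReal.mul_lt_top eU eU))))
  have fB : timeNorm a σ s (fun t ξ => leraySymbol ξ (Θ t ξ • (EuclideanSpace.single 2 (1 : ℂ) : C3)))
      < ⊤ := (timeNorm_leray_buoyancy_le a σ s Θ).trans_lt
        (ENNReal.mul_lt_top (ENNReal.mul_lt_top (by simp) ENNReal.ofReal_lt_top)
          ((supNorm_le_energy a σ s β Θ).trans_lt eΘ))
  obtain ⟨N, hN, hN'⟩ := exists_hasTimeIntegral_fracHeat A.ha A.hs A.hs0 α hA fA
    (G := fun τ => leray (transport (u τ) (u τ))) (by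
      filter_upwards [iU] with τ h1
      exact ((hu τ).transport (hu τ) h1 h1).leray (TemperedIntegrable.transportHat h1 h1)) t
  have tB : ∀ τ, TemperedIntegrable fun ξ => Θ τ ξ • (EuclideanSpace.single 2 (1 : ℂ) : C3) := by
    intro τ
    have hm := (section_stronglyMeasurable hΘ τ)
    have h1 : TemperedIntegrable (Θ τ) := temperedIntegrable_of_xNorm_lt_top A.ha A.hs A.hs0
      hm.aestronglyMeasurable ((le_iSup (fun t => xNorm a σ s (Θ t)) τ).trans_lt
        ((supNorm_le_energy a σ s β Θ).trans_lt eΘ))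
    refine h1.mono (hm.smul_const (EuclideanSpace.single 2 (1 : ℂ) : C3)).aestronglyMeasurable 1
      (Eventually.of_forall fun ξ => ?_)
    rw [norm_smul]
    simp
  obtain ⟨L, hL, hL'⟩ := exists_hasTimeIntegral_fracHeat A.ha A.hs A.hs0 α hB fB
    (G := fun τ => leray (buoyancy (θ τ)))
    (Eventually.of_forall fun τ => (hθ τ).buoyancy.leray (tB τ)) t
  refine ⟨N, L, hN', hL', (((h₀.fracHeat t₀ α t.2.1).sub hN).add hL).congr_ae ?_⟩
  filter_upwards [ae_lintegral_lt_top_of_timeNorm hA fA, ae_lintegral_lt_top_of_timeNorm hB fB]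
    with ξ h1 h2
  simp only [Pi.add_apply, Pi.sub_apply, duhamel, forcingU, smul_add, smul_neg]
  have e := integral_add (integrable_kernel_smul (γ := α) hA h1 t).neg
    (integrable_kernel_smul (γ := α) hB h2 t)
  simp only [Pi.neg_apply] at e
  rw [e, integral_neg, ← add_assoc, sub_eq_add_neg]

theorem Admissible.exists_temperature (A : Admissible a σ α β s T κ C₁)
    (hU : StronglyMeasurable (Function.uncurry U)) (hΘ : StronglyMeasurable (Function.uncurry Θ))
    (hu : ∀ t, IsHat (u t) (U t)) (hθ : ∀ t, IsHat (θ t) (Θ t))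
    (eU : energy a σ s α U < ⊤) (eΘ : energy a σ s β Θ < ⊤) {θ₀ : 𝓢'(E3, ℂ)} {g₂ : E3 → ℂ}
    (h₀ : IsHat θ₀ g₂) (t₀ : TemperedIntegrable g₂) (t : Icc (0 : ℝ) T) :
    ∃ N : 𝓢'(E3, ℂ),
      HasTimeIntegral t (fun τ => fracHeat β ((t : ℝ) - τ) (transport (u τ) (θ τ))) N ∧
      IsHat (fracHeat β t θ₀ - N) (duhamel β g₂ (forcingT U Θ) t) := by
  have iU := ae_integrable_section A.ha A.hs A.hs0 A.hα hU eU
  have iΘ := ae_integrable_section A.ha A.hs A.hs0 A.hβ hΘ eΘ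
  have hA := stronglyMeasurable_transportHat hU hΘ
  have fA : timeNorm a σ s (fun t => transportHat (U t) (Θ t)) < ⊤ :=
    (A.bilinear_ut hU hΘ).trans_lt
        (ENNReal.mul_lt_top (ENNReal.mul_lt_top (by simp) A.κ_ne_top.lt_top)
          (ENNReal.mul_lt_top eU eΘ))
  obtain ⟨N, hN, hN'⟩ := exists_hasTimeIntegral_fracHeat A.ha A.hs A.hs0 β hA fA
    (G := fun τ => transport (u τ) (θ τ)) (by
      filter_upwards [iU, iΘ] with τ h1 h2
      exact (hu τ).transport (hθ τ) h1 h2) t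
  refine ⟨N, hN', ((h₀.fracHeat t₀ β t.2.1).sub hN).congr_ae (Eventually.of_forall fun ξ => ?_)⟩
  simp only [Pi.sub_apply, duhamel, forcingT, smul_neg]
  rw [integral_neg, ← sub_eq_add_neg]

end MildFormula

/-! ### Almost everywhere equality and incompressibility -/

section Congruence

variable {V : Type*} [NormedAddCommGroup V] [NormedSpace ℂ V] {T : ℝ}

theorem transportHat_congr {f f' : E3 → C3} {g g' : E3 → V} (hf : f =ᵐ[volume] f')
    (hg : g =ᵐ[volume] g') : transportHat f g = transportHat f' g' := by
  funext ξ
  unfold transportHat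
  refine Finset.sum_congr rfl fun j _ => ?_
  congr 2
  refine integral_congr_ae ?_
  have hf' := (Measure.measurePreserving_sub_left (volume : Measure E3) ξ).quasiMeasurePreserving.ae hf
  filter_upwards [hf', hg] with η h1 h2
  rw [h1, h2]

theorem forcingU_congr {U U' : Icc (0 : ℝ) T → E3 → C3} {Θ Θ' : Icc (0 : ℝ) T → E3 → ℂ}
    {t : Icc (0 : ℝ) T} (hU : U t =ᵐ[volume] U' t) (hΘ : Θ t =ᵐ[volume] Θ' t) :
    forcingU U Θ t =ᵐ[volume] forcingU U' Θ' t := by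
  filter_upwards [hΘ] with ξ h
  unfold forcingU
  rw [transportHat_congr hU hU, h]

theorem forcingT_congr {U U' : Icc (0 : ℝ) T → E3 → C3} {Θ Θ' : Icc (0 : ℝ) T → E3 → ℂ}
    {t : Icc (0 : ℝ) T} (hU : U t =ᵐ[volume] U' t) (hΘ : Θ t =ᵐ[volume] Θ' t) :
    forcingT U Θ t = forcingT U' Θ' t := by
  funext ξ
  unfold forcingT
  rw [transportHat_congr hU hΘ]

/-- Fubini turns equality at almost every time into equality of the Duhamel formulas at every time.
-/
theorem duhamel_congr (γ : ℝ) {g g' : E3 → V} {F F' : Icc (0 : ℝ) T → E3 → V}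
    (hF : StronglyMeasurable (Function.uncurry F)) (hF' : StronglyMeasurable (Function.uncurry F'))
    (hg : g =ᵐ[volume] g') (h : ∀ᵐ t ∂timeMeasure T, F t =ᵐ[volume] F' t) :
    ∀ᵐ ξ, ∀ t, duhamel γ g F t ξ = duhamel γ g' F' t ξ := by
  have h' : ∀ᵐ ξ, ∀ᵐ t ∂timeMeasure T, F t ξ = F' t ξ :=
    (Measure.ae_ae_comm (p := fun t ξ => F t ξ = F' t ξ) (hF.measurableSet_eq_fun hF')).mp h
  filter_upwards [h', hg] with ξ h1 h2 t
  unfold duhamel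
  rw [h2]
  congr 1
  refine integral_congr_ae (ae_restrict_of_ae ?_)
  filter_upwards [h1] with τ hτ
  rw [hτ]

theorem map_duhamel [CompleteSpace V] {W : Type*} [NormedAddCommGroup W] [NormedSpace ℂ W]
    [CompleteSpace W] (l : V →L[ℂ] W) (γ : ℝ) {g : E3 → V} {F : Icc (0 : ℝ) T → E3 → V}
    (hF : StronglyMeasurable (Function.uncurry F)) {ξ : E3}
    (h : ∫⁻ τ, ‖F τ ξ‖ₑ ∂timeMeasure T < ⊤) (t : Icc (0 : ℝ) T) :
    l (duhamel γ g F t ξ) = duhamel γ (fun ξ => l (g ξ)) (fun t ξ => l (F t ξ)) t ξ := by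
  unfold duhamel
  rw [map_add, map_smul, ← l.integral_comp_comm (integrable_kernel_smul hF h t)]
  simp only [map_smul]

/-- The Duhamel formula propagates incompressibility, since the forcing term is a Leray
projection. -/
theorem sum_mul_duhamel_eq_zero {a σ s γ : ℝ} {g : E3 → C3} {U : Icc (0 : ℝ) T → E3 → C3}
    {Θ : Icc (0 : ℝ) T → E3 → ℂ} (hU : StronglyMeasurable (Function.uncurry U))
    (hΘ : StronglyMeasurable (Function.uncurry Θ)) (f : timeNorm a σ s (forcingU U Θ) < ⊤)
    (hg : ∀ᵐ ξ : E3, ∑ j, ((ξ j : ℝ) : ℂ) * g ξ j = 0) :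
    ∀ᵐ ξ : E3, ∀ t, ∑ j, ((ξ j : ℝ) : ℂ) * duhamel γ g (forcingU U Θ) t ξ j = 0 := by
  have hF := stronglyMeasurable_forcingU hU hΘ
  filter_upwards [hg, ae_lintegral_lt_top_of_timeNorm hF f] with ξ h1 h2 t
  let l : C3 →L[ℂ] ℂ := ∑ j, ((ξ j : ℝ) : ℂ) • (EuclideanSpace.proj j : C3 →L[ℂ] ℂ)
  have hl : ∀ v, l v = ∑ j, ((ξ j : ℝ) : ℂ) * v j := fun v => by simp [l]
  have h3 : ∀ τ, l (forcingU U Θ τ ξ) = 0 := fun τ => by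
    rw [forcingU, map_add, map_neg, hl, hl, sum_mul_leraySymbol, sum_mul_leraySymbol]
    simp
  rw [← hl, map_duhamel l γ hF h2 t]
  have h0 : l (g ξ) = 0 := by rw [hl, h1]
  unfold duhamel
  simp [h0, h3]

end Congruence

/-! ### Reality of the solution -/

section Reality

/-- Complex conjugation of the components. -/
noncomputable def conjC3 : C3 ≃ₗᵢ[ℝ] C3 :=
  LinearIsometryEquiv.piLpCongrRight 2 fun _ => Complex.conjLIE

theorem conjC3_apply (v : C3) (j : Fin 3) : conjC3 v j = (starRingEnd ℂ) (v j) := rfl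

theorem conjC3_smul (c : ℂ) (v : C3) : conjC3 (c • v) = (starRingEnd ℂ) c • conjC3 v := by
  ext j
  simp [conjC3_apply]

theorem leraySymbol_conjC3 (ξ : E3) (v : C3) :
    leraySymbol ξ (conjC3 v) = conjC3 (leraySymbol (-ξ) v) := by
  ext j
  simp [conjC3_apply, leraySymbol_apply]

variable {V : Type*} [NormedAddCommGroup V] [NormedSpace ℂ V] {T : ℝ}

theorem xNorm_reflect (a σ r : ℝ) (J : V ≃ₗᵢ[ℝ] V) (g : E3 → V) :
    xNorm a σ r (fun ξ => J (g (-ξ))) = xNorm a σ r g := by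
  unfold xNorm
  rw [← lintegral_neg_eq_self (μ := (volume : Measure E3))]
  refine lintegral_congr fun ξ => ?_
  have h : ‖J (g ξ)‖ₑ = ‖g ξ‖ₑ := by rw [← ofReal_norm, J.norm_map, ofReal_norm]
  simp [leiLinWeight, h]

theorem energy_reflect (a σ s γ : ℝ) (J : V ≃ₗᵢ[ℝ] V) (U : Icc (0 : ℝ) T → E3 → V) :
    energy a σ s γ (fun t ξ => J (U t (-ξ))) = energy a σ s γ U := by
  simp only [energy, supNorm, timeNorm, xNorm_reflect]

theorem stronglyMeasurable_reflect (J : V ≃ₗᵢ[ℝ] V) {U : Icc (0 : ℝ) T → E3 → V}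
    (hU : StronglyMeasurable (Function.uncurry U)) :
    StronglyMeasurable (Function.uncurry fun t ξ => J (U t (-ξ))) :=
  J.continuous.comp_stronglyMeasurable
    (hU.comp_measurable (g := fun p : Icc (0 : ℝ) T × E3 => (p.1, -p.2)) (by fun_prop))

theorem ae_neg {p : E3 → Prop} (h : ∀ᵐ ξ, p ξ) : ∀ᵐ ξ : E3, p (-ξ) :=
  (Measure.measurePreserving_neg (volume : Measure E3)).quasiMeasurePreserving.ae h

variable [CompleteSpace V]

theorem duhamel_reflect (γ : ℝ) {J : V ≃ₗᵢ[ℝ] V}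
    (hJ : ∀ (c : ℂ) v, J (c • v) = (starRingEnd ℂ) c • J v) (g : E3 → V)
    (F : Icc (0 : ℝ) T → E3 → V) (t : Icc (0 : ℝ) T) (ξ : E3) :
    duhamel γ (fun ξ => J (g (-ξ))) (fun t ξ => J (F t (-ξ))) t ξ = J (duhamel γ g F t (-ξ)) := by
  unfold duhamel
  have h := J.toLinearIsometry.integral_comp_comm (μ := (timeMeasure T).restrict (Iic t))
    fun τ => (Real.exp (-(((t : ℝ) - τ) * ‖-ξ‖ ^ (2 * γ))) : ℂ) • F τ (-ξ)
  simp only [LinearIsometryEquiv.coe_toLinearIsometry, hJ, Complex.conj_ofReal, norm_neg] at h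
  rw [map_add, hJ, norm_neg, ← h, Complex.conj_ofReal]

/-- The reflection of `ξ` and the conjugation of `i` compensate each other in the symbol `i ξ_j` of
the derivative. -/
theorem transportHat_reflect {J : V ≃ₗᵢ[ℝ] V}
    (hJ : ∀ (c : ℂ) v, J (c • v) = (starRingEnd ℂ) c • J v) (f : E3 → C3) (g : E3 → V) (ξ : E3) :
    transportHat (fun ξ => conjC3 (f (-ξ))) (fun ξ => J (g (-ξ))) ξ = J (transportHat f g (-ξ)) := by
  unfold transportHat
  rw [map_sum]
  refine Finset.sum_congr rfl fun j _ => ?_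
  have h := J.toLinearIsometry.integral_comp_comm (μ := (volume : Measure E3))
    fun η => f (-ξ - η) j • g η
  simp only [LinearIsometryEquiv.coe_toLinearIsometry, hJ] at h
  rw [hJ, hJ, ← h, ← integral_neg_eq_self, map_inv₀, Complex.conj_ofReal, map_mul, Complex.conj_I,
    Complex.conj_ofReal, PiLp.neg_apply, Complex.ofReal_neg, neg_mul_neg]
  congr 2
  refine integral_congr_ae (Eventually.of_forall fun η => ?_)
  simp only [conjC3_apply, neg_neg, sub_neg_eq_add, neg_add]
  rw [← sub_eq_add_neg]

theorem conj_smul_conjLIE (c v : ℂ) :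
    Complex.conjLIE (c • v) = (starRingEnd ℂ) c • Complex.conjLIE v := by simp

theorem forcingU_reflect (U : Icc (0 : ℝ) T → E3 → C3) (Θ : Icc (0 : ℝ) T → E3 → ℂ)
    (t : Icc (0 : ℝ) T) (ξ : E3) :
    forcingU (fun t ξ => conjC3 (U t (-ξ))) (fun t ξ => Complex.conjLIE (Θ t (-ξ))) t ξ
      = conjC3 (forcingU U Θ t (-ξ)) := by
  have he : conjC3 (EuclideanSpace.single 2 (1 : ℂ) : C3) = EuclideanSpace.single 2 (1 : ℂ) := by
    ext j
    fin_cases j <;> simp [conjC3_apply]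
  unfold forcingU
  rw [transportHat_reflect conjC3_smul, leraySymbol_conjC3, map_add, map_neg, ← leraySymbol_conjC3 ξ
    (Θ t (-ξ) • _), conjC3_smul, he]
  rfl

theorem forcingT_reflect (U : Icc (0 : ℝ) T → E3 → C3) (Θ : Icc (0 : ℝ) T → E3 → ℂ)
    (t : Icc (0 : ℝ) T) (ξ : E3) :
    forcingT (fun t ξ => conjC3 (U t (-ξ))) (fun t ξ => Complex.conjLIE (Θ t (-ξ))) t ξ
      = Complex.conjLIE (forcingT U Θ t (-ξ)) := by
  unfold forcingT
  rw [transportHat_reflect conj_smul_conjLIE, map_neg]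

/-- Real data give real solutions: the reflected and conjugated forcing term reproduces itself with
the same data, so uniqueness applies. -/
theorem Admissible.duhamel_reflect_eq {a σ α β s : ℝ} {κ C₁ : ℝ≥0∞}
    (A : Admissible a σ α β s T κ C₁) {g₁ : E3 → C3}
    {g₂ : E3 → ℂ} (hg₁ : StronglyMeasurable g₁) (hg₂ : StronglyMeasurable g₂)
    (s₁ : ∀ᵐ ξ, conjC3 (g₁ (-ξ)) = g₁ ξ) (s₂ : ∀ᵐ ξ, Complex.conjLIE (g₂ (-ξ)) = g₂ ξ)
    {F : Icc (0 : ℝ) T → E3 → C3} {G : Icc (0 : ℝ) T → E3 → ℂ}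
    (hF : StronglyMeasurable (Function.uncurry F)) (hG : StronglyMeasurable (Function.uncurry G))
    (fF : timeNorm a σ s F < ⊤) (fG : timeNorm a σ s G < ⊤)
    (h : energy a σ s α (duhamel α g₁ F) + energy a σ s β (duhamel β g₂ G) ≤ C₁)
    (eF : ∀ᵐ t ∂timeMeasure T, F t =ᵐ[volume] forcingU (duhamel α g₁ F) (duhamel β g₂ G) t)
    (eG : ∀ᵐ t ∂timeMeasure T, G t =ᵐ[volume] forcingT (duhamel α g₁ F) (duhamel β g₂ G) t)
    (t : Icc (0 : ℝ) T) :
    (∀ᵐ ξ, conjC3 (duhamel α g₁ F t (-ξ)) = duhamel α g₁ F t ξ) ∧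
      ∀ᵐ ξ, Complex.conjLIE (duhamel β g₂ G t (-ξ)) = duhamel β g₂ G t ξ := by
  have hF' := stronglyMeasurable_reflect conjC3 hF
  have hG' := stronglyMeasurable_reflect Complex.conjLIE hG
  have dF : ∀ t, duhamel α g₁ (fun t ξ => conjC3 (F t (-ξ))) t
      =ᵐ[volume] fun ξ => conjC3 (duhamel α g₁ F t (-ξ)) := fun t => by
    filter_upwards [duhamel_congr α hF' hF' s₁ (Eventually.of_forall fun t => ae_eq_rfl)] with ξ hξ
    rw [← hξ, duhamel_reflect α conjC3_smul]
  have dG : ∀ t, duhamel β g₂ (fun t ξ => Complex.conjLIE (G t (-ξ))) t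
      =ᵐ[volume] fun ξ => Complex.conjLIE (duhamel β g₂ G t (-ξ)) := fun t => by
    filter_upwards [duhamel_congr β hG' hG' s₂ (Eventually.of_forall fun t => ae_eq_rfl)] with ξ hξ
    rw [← hξ, duhamel_reflect β conj_smul_conjLIE]
  obtain ⟨e₁, e₂⟩ := A.forcing_unique hg₁ hg₂ hF' hF hG' hG
    (by simpa only [timeNorm, xNorm_reflect] using fF) fF
    (by simpa only [timeNorm, xNorm_reflect] using fG) fG
    (by
      rw [energy_congr a σ s α dF, energy_congr a σ s β dG, energy_reflect, energy_reflect]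
      exact h) h
    (by
      filter_upwards [eF] with t ht
      filter_upwards [ae_neg ht, forcingU_congr (U' := fun t ξ => conjC3 (duhamel α g₁ F t (-ξ)))
        (Θ' := fun t ξ => Complex.conjLIE (duhamel β g₂ G t (-ξ))) (dF t) (dG t)] with ξ h1 h2
      rw [h2, forcingU_reflect, h1])
    eF
    (by
      filter_upwards [eG] with t ht
      filter_upwards [ae_neg ht] with ξ h1
      rw [forcingT_congr (U' := fun t ξ => conjC3 (duhamel α g₁ F t (-ξ)))
        (Θ' := fun t ξ => Complex.conjLIE (duhamel β g₂ G t (-ξ))) (dF t) (dG t), forcingT_reflect, h1])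
    eG
  constructor
  · filter_upwards [dF t, duhamel_congr α hF' hF (ae_eq_refl g₁) e₁] with ξ h1 h2
    rw [← h1, h2]
  · filter_upwards [dG t, duhamel_congr β hG' hG (ae_eq_refl g₂) e₂] with ξ h1 h2
    rw [← h1, h2]

end Reality

/-! ### Well-posedness for admissible parameters -/

section WellPosedness

variable {a σ α β s T : ℝ} {κ C₁ : ℝ≥0∞}

theorem ofReal_norm_eq_supNorm {V : Type*} [NormedAddCommGroup V] [NormedSpace ℂ V]
    [CompleteSpace V] {u : C(Icc (0 : ℝ) T, LeiLin V a σ s)} {U : Icc (0 : ℝ) T → E3 → V}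
    (hu : ∀ t, IsHat (u t).toDistr (U t)) : ENNReal.ofReal ‖u‖ = supNorm a σ s U := by
  have hle : supNorm a σ s U ≤ ENNReal.ofReal ‖u‖ := iSup_le fun t => by
    rw [← LeiLin.ofReal_norm_eq_xNorm (hu t)]
    exact ENNReal.ofReal_le_ofReal (u.norm_coe_le_norm t)
  refine le_antisymm ?_ hle
  have hfin : supNorm a σ s U ≠ ⊤ := ne_top_of_le_ne_top ENNReal.ofReal_ne_top hle
  refine ENNReal.ofReal_le_of_le_toReal ((u.norm_le ENNReal.toReal_nonneg).mpr fun t => ?_)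
  rw [← ENNReal.ofReal_le_iff_le_toReal hfin, LeiLin.ofReal_norm_eq_xNorm (hu t)]
  exact le_iSup (fun t => xNorm a σ s (U t)) t

theorem solutionNorm_eq {u : C(Icc (0 : ℝ) T, LeiLin C3 a σ s)}
    {θ : C(Icc (0 : ℝ) T, LeiLin ℂ a σ s)} {U : Icc (0 : ℝ) T → E3 → C3}
    {Θ : Icc (0 : ℝ) T → E3 → ℂ} (hu : ∀ t, IsHat (u t).toDistr (U t))
    (hθ : ∀ t, IsHat (θ t).toDistr (Θ t)) :
    solutionNorm a σ α β s u θ = energy a σ s α U + energy a σ s β Θ := by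
  have h1 : ∫⁻ t, leiLinENorm a σ (s + 2 * α) (u t).toDistr ∂timeMeasure T
      = timeNorm a σ (s + 2 * α) U := lintegral_congr fun t => leiLinENorm_eq a σ _ (hu t)
  have h2 : ∫⁻ t, leiLinENorm a σ (s + 2 * β) (θ t).toDistr ∂timeMeasure T
      = timeNorm a σ (s + 2 * β) Θ := lintegral_congr fun t => leiLinENorm_eq a σ _ (hθ t)
  rw [solutionNorm, h1, h2, ofReal_norm_eq_supNorm hu, ofReal_norm_eq_supNorm hθ, energy, energy,
    add_assoc]

theorem Admissible.timeNorm_forcing_lt_top (A : Admissible a σ α β s T κ C₁)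
    {U : Icc (0 : ℝ) T → E3 → C3} {Θ : Icc (0 : ℝ) T → E3 → ℂ}
    (hU : StronglyMeasurable (Function.uncurry U)) (hΘ : StronglyMeasurable (Function.uncurry Θ))
    (h : energy a σ s α U + energy a σ s β Θ ≤ C₁) :
    timeNorm a σ s (forcingU U Θ) < ⊤ ∧ timeNorm a σ s (forcingT U Θ) < ⊤ := by
  refine lt_top_of_add_le (z := C₁) ?_ A.C₁_ne_top
  exact (le_mul_of_one_le_left' (by norm_num)).trans ((A.timeNorm_forcing_le hU hΘ h).trans h)

/-- The Fourier transform of a mild solution satisfies the Duhamel formula with the forcing term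
given by the solution itself. -/
theorem Admissible.eq_duhamel_of_isMildSolution (A : Admissible a σ α β s T κ C₁)
    {u₀ : 𝓢'(E3, C3)} {θ₀ : 𝓢'(E3, ℂ)} {g₁ : E3 → C3} {g₂ : E3 → ℂ}
    (hu₀ : IsHat u₀ g₁) (hθ₀ : IsHat θ₀ g₂) (t₁ : TemperedIntegrable g₁)
    (t₂ : TemperedIntegrable g₂) {u : Icc (0 : ℝ) T → 𝓢'(E3, C3)}
    {θ : Icc (0 : ℝ) T → 𝓢'(E3, ℂ)} (h : IsMildSolution α β u₀ θ₀ u θ)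
    {U : Icc (0 : ℝ) T → E3 → C3} {Θ : Icc (0 : ℝ) T → E3 → ℂ}
    (hU : StronglyMeasurable (Function.uncurry U)) (hΘ : StronglyMeasurable (Function.uncurry Θ))
    (hu : ∀ t, IsHat (u t) (U t)) (hθ : ∀ t, IsHat (θ t) (Θ t))
    (eU : energy a σ s α U < ⊤) (eΘ : energy a σ s β Θ < ⊤) (t : Icc (0 : ℝ) T) :
    U t =ᵐ[volume] duhamel α g₁ (forcingU U Θ) t ∧
      Θ t =ᵐ[volume] duhamel β g₂ (forcingT U Θ) t := by
  constructor
  · obtain ⟨N, L, hN, hL, e⟩ := h.velocity t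
    obtain ⟨N', L', hN', hL', e'⟩ := A.exists_velocity hU hΘ hu hθ eU eΘ hu₀ t₁ t
    rw [← hN.unique hN', ← hL.unique hL', ← e] at e'
    exact (hu t).ae_eq e'
  · obtain ⟨N, hN, e⟩ := h.temperature t
    obtain ⟨N', hN', e'⟩ := A.exists_temperature hU hΘ hu hθ eU eΘ hθ₀ t₂ t
    rw [← hN.unique hN', ← e] at e'
    exact (hθ t).ae_eq e'

/-- A curve whose Fourier transform reproduces itself through the Duhamel formula is a mild
solution. -/
theorem Admissible.isMildSolution (A : Admissible a σ α β s T κ C₁)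
    {u₀ : 𝓢'(E3, C3)} {θ₀ : 𝓢'(E3, ℂ)} {g₁ : E3 → C3} {g₂ : E3 → ℂ}
    (hu₀ : IsHat u₀ g₁) (hθ₀ : IsHat θ₀ g₂) (t₁ : TemperedIntegrable g₁)
    (t₂ : TemperedIntegrable g₂) (d₀ : divergence u₀ = 0) {u : Icc (0 : ℝ) T → 𝓢'(E3, C3)}
    {θ : Icc (0 : ℝ) T → 𝓢'(E3, ℂ)}
    {U : Icc (0 : ℝ) T → E3 → C3} {Θ : Icc (0 : ℝ) T → E3 → ℂ}
    (hU : StronglyMeasurable (Function.uncurry U)) (hΘ : StronglyMeasurable (Function.uncurry Θ))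
    (hu : ∀ t, IsHat (u t) (U t)) (hθ : ∀ t, IsHat (θ t) (Θ t))
    (h : energy a σ s α U + energy a σ s β Θ ≤ C₁)
    (rU : ∀ t, ∀ᵐ ξ, conjC3 (U t (-ξ)) = U t ξ)
    (rΘ : ∀ t, ∀ᵐ ξ, Complex.conjLIE (Θ t (-ξ)) = Θ t ξ)
    (eU : ∀ t, U t =ᵐ[volume] duhamel α g₁ (forcingU U Θ) t)
    (eΘ : ∀ t, Θ t =ᵐ[volume] duhamel β g₂ (forcingT U Θ) t) :
    IsMildSolution α β u₀ θ₀ u θ := by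
  obtain ⟨fU, fΘ⟩ := lt_top_of_add_le h A.C₁_ne_top
  have tU : ∀ t, TemperedIntegrable (U t) := fun t =>
    temperedIntegrable_of_xNorm_lt_top A.ha A.hs A.hs0
      (section_stronglyMeasurable hU t).aestronglyMeasurable
      ((le_iSup (fun t => xNorm a σ s (U t)) t).trans_lt ((supNorm_le_energy a σ s α U).trans_lt fU))
  have tΘ : ∀ t, TemperedIntegrable (Θ t) := fun t =>
    temperedIntegrable_of_xNorm_lt_top A.ha A.hs A.hs0
      (section_stronglyMeasurable hΘ t).aestronglyMeasurable
      ((le_iSup (fun t => xNorm a σ s (Θ t)) t).trans_lt ((supNorm_le_energy a σ s β Θ).trans_lt fΘ))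
  refine ⟨fun t j => ?_, fun t => ?_, fun t => ?_, fun t => ?_, fun t => ?_⟩
  · rw [((hu t).component j).isRealDistr_iff ((tU t).mono
      ((EuclideanSpace.proj j : C3 →L[ℂ] ℂ).continuous.comp_aestronglyMeasurable
        (tU t).aestronglyMeasurable) 1 (Eventually.of_forall fun ξ => by
          rw [one_mul]
          exact PiLp.norm_apply_le (U t ξ) j))]
    filter_upwards [rU t] with ξ hξ
    rw [← conjC3_apply, hξ]
  · rw [(hθ t).isRealDistr_iff (tΘ t)]
    filter_upwards [rΘ t] with ξ hξ
    exact hξ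
  · rw [(hu t).divergence_eq_zero_iff]
    filter_upwards [eU t, sum_mul_duhamel_eq_zero (γ := α) hU hΘ
      (A.timeNorm_forcing_lt_top hU hΘ h).1 (hu₀.divergence_eq_zero_iff.mp d₀)] with ξ h1 h2
    rw [h1]
    exact h2 t
  · obtain ⟨N, L, hN, hL, e⟩ := A.exists_velocity hU hΘ hu hθ fU fΘ hu₀ t₁ t
    exact ⟨N, L, hN, hL, (hu t).distr_eq e (eU t)⟩
  · obtain ⟨N, hN, e⟩ := A.exists_temperature hU hΘ hu hθ fU fΘ hθ₀ t₂ t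
    exact ⟨N, hN, (hθ t).distr_eq e (eΘ t)⟩

theorem IsHat.conjC3_eq {f : 𝓢'(E3, C3)} {g : E3 → C3} (h : IsHat f g) (ht : TemperedIntegrable g)
    (hr : ∀ j, IsRealDistr (_root_.component j f)) : ∀ᵐ ξ, conjC3 (g (-ξ)) = g ξ := by
  have h1 : ∀ j, ∀ᵐ ξ, (starRingEnd ℂ) (g (-ξ) j) = g ξ j := fun j =>
    ((h.component j).isRealDistr_iff (ht.mono
      ((EuclideanSpace.proj j : C3 →L[ℂ] ℂ).continuous.comp_aestronglyMeasurable
        ht.aestronglyMeasurable) 1 (Eventually.of_forall fun ξ => by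
          rw [one_mul]
          exact PiLp.norm_apply_le (g ξ) j))).mp (hr j)
  filter_upwards [ae_all_iff.mpr h1] with ξ hξ
  ext j
  exact hξ j

/-- Well-posedness under the smallness conditions collected in `Admissible`. -/
theorem Admissible.exists_unique_solution (A : Admissible a σ α β s T κ C₁)
    (u₀ : LeiLin C3 a σ s) (θ₀ : LeiLin ℂ a σ s)
    (r₁ : ∀ j, IsRealDistr (component j u₀.toDistr)) (r₂ : IsRealDistr θ₀.toDistr)
    (d₀ : divergence u₀.toDistr = 0)
    (hd : 6 * (ENNReal.ofReal ‖u₀‖ + ENNReal.ofReal ‖θ₀‖) ≤ C₁) :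
    ∃ (u : C(Icc (0 : ℝ) T, LeiLin C3 a σ s)) (θ : C(Icc (0 : ℝ) T, LeiLin ℂ a σ s)),
      IsSolutionInClass a σ α β s u₀ θ₀ u θ ∧
      (∀ (u' : C(Icc (0 : ℝ) T, LeiLin C3 a σ s)) (θ' : C(Icc (0 : ℝ) T, LeiLin ℂ a σ s)),
        IsSolutionInClass a σ α β s u₀ θ₀ u' θ' →
        solutionNorm a σ α β s u' θ' ≤ C₁ → u' = u ∧ θ' = θ) ∧
      solutionNorm a σ α β s u θ ≤ 6 * (ENNReal.ofReal ‖u₀‖ + ENNReal.ofReal ‖θ₀‖) ∧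
      ∀ p : ℝ, 1 ≤ p →
        MemLpLeiLin a σ (s + 2 * α / p) p (fun t => (u t).toDistr) ∧
        MemLpLeiLin a σ (s + 2 * β / p) p (fun t => (θ t).toDistr) := by
  obtain ⟨g₁, hg₁, h₁⟩ := u₀.exists_isHat
  obtain ⟨g₂, hg₂, h₂⟩ := θ₀.exists_isHat
  have e₁ := LeiLin.ofReal_norm_eq_xNorm h₁
  have e₂ := LeiLin.ofReal_norm_eq_xNorm h₂
  rw [e₁, e₂] at hd ⊢
  have x₁ : xNorm a σ s g₁ < ⊤ := e₁ ▸ ENNReal.ofReal_lt_top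
  have x₂ : xNorm a σ s g₂ < ⊤ := e₂ ▸ ENNReal.ofReal_lt_top
  have t₁ := temperedIntegrable_of_xNorm_lt_top A.ha A.hs A.hs0 hg₁.aestronglyMeasurable x₁
  have t₂ := temperedIntegrable_of_xNorm_lt_top A.ha A.hs A.hs0 hg₂.aestronglyMeasurable x₂
  obtain ⟨F, G, hF, hG, bF, bG, eF, eG⟩ := A.exists_forcing hg₁ hg₂ hd
  have fd : xNorm a σ s g₁ + xNorm a σ s g₂ < ⊤ := ENNReal.add_lt_top.mpr ⟨x₁, x₂⟩
  have fF := bF.trans_lt fd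
  have fG := bG.trans_lt fd
  have hU := stronglyMeasurable_duhamel α hg₁ hF
  have hΘ := stronglyMeasurable_duhamel β hg₂ hG
  have hE6 : energy a σ s α (duhamel α g₁ F) + energy a σ s β (duhamel β g₂ G)
      ≤ 6 * (xNorm a σ s g₁ + xNorm a σ s g₂) := by
    refine (add_le_add (energy_duhamel_le a σ s α hg₁ hF) (energy_duhamel_le a σ s β hg₂ hG)).trans ?_
    calc _ = 2 * ((xNorm a σ s g₁ + xNorm a σ s g₂) + timeNorm a σ s F + timeNorm a σ s G) := by
          ring
      _ ≤ 2 * ((xNorm a σ s g₁ + xNorm a σ s g₂) + (xNorm a σ s g₁ + xNorm a σ s g₂)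
          + (xNorm a σ s g₁ + xNorm a σ s g₂)) := by gcongr
      _ = _ := by ring
  have hE := hE6.trans hd
  obtain ⟨u, hu⟩ := exists_continuousMap_duhamel A.ha A.hs A.hs0 α hg₁ hF x₁ fF
  obtain ⟨θ, hθ⟩ := exists_continuousMap_duhamel A.ha A.hs A.hs0 β hg₂ hG x₂ fG
  obtain ⟨fU, fΘ⟩ := lt_top_of_add_le hE A.C₁_ne_top
  have hα0 : 0 ≤ α := by linarith [A.hα]
  have hβ0 : 0 ≤ β := by linarith [A.hβ]
  have hLp : ∀ p : ℝ, 1 ≤ p → MemLpLeiLin a σ (s + 2 * α / p) p (fun t => (u t).toDistr) ∧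
      MemLpLeiLin a σ (s + 2 * β / p) p (fun t => (θ t).toDistr) := fun p hp =>
    ⟨memLpLeiLin_of_energy_lt_top A.ha A.hs A.hs0 hα0 hp u hU hu fU,
      memLpLeiLin_of_energy_lt_top A.ha A.hs A.hs0 hβ0 hp θ hΘ hθ fΘ⟩
  have hrefl := A.duhamel_reflect_eq hg₁ hg₂ (h₁.conjC3_eq t₁ r₁) ((h₂.isRealDistr_iff t₂).mp r₂)
    hF hG fF fG hE eF eG
  have hmild : IsMildSolution α β u₀.toDistr θ₀.toDistr (fun t => (u t).toDistr)
      (fun t => (θ t).toDistr) := by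
    refine A.isMildSolution h₁ h₂ t₁ t₂ d₀ hU hΘ hu hθ hE (fun t => (hrefl t).1)
      (fun t => (hrefl t).2) (fun t => ?_) (fun t => ?_)
    · filter_upwards [duhamel_congr α hF (stronglyMeasurable_forcingU hU hΘ) (ae_eq_refl g₁) eF]
        with ξ hξ
      exact hξ t
    · filter_upwards [duhamel_congr β hG (stronglyMeasurable_forcingT hU hΘ) (ae_eq_refl g₂) eG]
        with ξ hξ
      exact hξ t
  refine ⟨u, θ, ⟨?_, ?_, hmild⟩, ?_, ?_, hLp⟩
  · simpa using (hLp 1 le_rfl).1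
  · simpa using (hLp 1 le_rfl).2
  · intro u' θ' hcl hn
    -- the forcing term of the competitor reproduces itself, so it is `(F, G)`
    obtain ⟨U', hU', hu'⟩ := exists_jointly_measurable_hat u'
    obtain ⟨Θ', hΘ', hθ'⟩ := exists_jointly_measurable_hat θ'
    rw [solutionNorm_eq hu' hθ'] at hn
    obtain ⟨fU', fΘ'⟩ := lt_top_of_add_le hn A.C₁_ne_top
    have hdu := A.eq_duhamel_of_isMildSolution h₁ h₂ t₁ t₂ hcl.2.2 hU' hΘ' hu' hθ' fU' fΘ'
    have hF' := stronglyMeasurable_forcingU hU' hΘ'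
    have hG' := stronglyMeasurable_forcingT hU' hΘ'
    obtain ⟨fF', fG'⟩ := A.timeNorm_forcing_lt_top hU' hΘ' hn
    obtain ⟨q₁, q₂⟩ := A.forcing_unique hg₁ hg₂ hF' hF hG' hG fF' fF fG' fG
      (by
        rw [← energy_congr a σ s α fun t => (hdu t).1, ← energy_congr a σ s β fun t => (hdu t).2]
        exact hn) hE
      (Eventually.of_forall fun t => forcingU_congr (hdu t).1 (hdu t).2) eF
      (Eventually.of_forall fun t => Eventually.of_forall fun ξ => by
        rw [forcingT_congr (hdu t).1 (hdu t).2]) eG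
    constructor
    · ext1 t
      refine LeiLin.ext_distr ((hu' t).distr_eq (hu t) ((hdu t).1.trans ?_))
      filter_upwards [duhamel_congr α hF' hF (ae_eq_refl g₁) q₁] with ξ hξ
      exact hξ t
    · ext1 t
      refine LeiLin.ext_distr ((hθ' t).distr_eq (hθ t) ((hdu t).2.trans ?_))
      filter_upwards [duhamel_congr β hG' hG (ae_eq_refl g₂) q₂] with ξ hξ
      exact hξ t
  · rw [solutionNorm_eq hu hθ]
    exact hE6

end WellPosedness

/-! ### Choice of the constants -/

section Constants

/-- The power of `T` in the bilinear estimate, obtained by interpolation in `𝒳^s ∩ 𝒳^{s+2x}` and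
`𝒳^s ∩ 𝒳^{s+2y}`, in terms of one of the three numbers that define the critical index. -/
theorem one_sub_exponent_eq {x y : ℝ} (z : ℝ) (hx : 1 / 2 ≤ x) (hy : 1 / 2 ≤ y) :
    1 - (1 / (2 * x) + -z / (2 * y)) = (z - y * (1 - 2 * x) / x) / (2 * y) := by
  have hx0 : x ≠ 0 := by linarith
  have hy0 : y ≠ 0 := by linarith
  field_simp
  ring

variable {a σ α β s T κ C₁ : ℝ}

theorem qIndex_le_iff (hα : 1 / 2 ≤ α) : qIndex α β ≤ s ↔
    α * (1 - 2 * α) / α ≤ s ∧ β * (1 - 2 * α) / α ≤ s ∧ α * (1 - 2 * β) / β ≤ s := by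
  have hα0 : α ≠ 0 := by linarith
  rw [mul_div_cancel_left₀ _ hα0, qIndex, max_le_iff, max_le_iff, and_comm (a := _ ≤ s) (b := _ ≤ s)]

theorem qIndex_lt_iff (hα : 1 / 2 ≤ α) : qIndex α β < s ↔
    α * (1 - 2 * α) / α < s ∧ β * (1 - 2 * α) / α < s ∧ α * (1 - 2 * β) / β < s := by
  have hα0 : α ≠ 0 := by linarith
  rw [mul_div_cancel_left₀ _ hα0, qIndex, max_lt_iff, max_lt_iff]
  tauto

theorem admissible_of_real (ha : 0 ≤ a) (hσ : 1 ≤ σ) (hα : 1 / 2 ≤ α)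
    (hβ : 1 / 2 ≤ β) (hs : s ∈ Icc (max (-1) (qIndex α β)) 0) (hT : 0 < T) (hC : 0 ≤ C₁)
    (hκ : 0 ≤ κ) (h₁ : T ^ (1 - (1 / (2 * α) + -s / (2 * α))) ≤ κ)
    (h₂ : T ^ (1 - (1 / (2 * α) + -s / (2 * β))) ≤ κ)
    (h₃ : T ^ (1 - (1 / (2 * β) + -s / (2 * α))) ≤ κ)
    (hsmall : 8 * (24 * κ * C₁ + 2 * T) ≤ 1) :
    Admissible a σ α β s T (ENNReal.ofReal κ) (ENNReal.ofReal C₁) := by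
  obtain ⟨hs1, hq⟩ := max_le_iff.mp hs.1
  obtain ⟨q₁, q₂, q₃⟩ := (qIndex_le_iff hα).mp hq
  have hα0 : 0 < α := by linarith
  have hβ0 : 0 < β := by linarith
  have hexp : ∀ {x y : ℝ}, 1 / 2 ≤ x → 1 / 2 ≤ y → y * (1 - 2 * x) / x ≤ s →
      1 / (2 * x) + -s / (2 * y) ≤ 1 := by
    intro x y hx hy hxy
    rw [← sub_nonneg, one_sub_exponent_eq s hx hy]
    exact div_nonneg (sub_nonneg.mpr hxy) (by linarith)
  have hle : ∀ {e : ℝ}, T ^ e ≤ κ → ENNReal.ofReal T ^ e ≤ ENNReal.ofReal κ := fun he => by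
    rw [ENNReal.ofReal_rpow_of_pos hT]
    exact ENNReal.ofReal_le_ofReal he
  refine ⟨ha, hσ, hα, hβ, hs1, hs.2, hexp hα hα q₁, hexp hα hβ q₂, ?_, hle h₁, hle h₂, ?_,
    ENNReal.ofReal_ne_top, ENNReal.ofReal_ne_top, ?_⟩
  · rw [add_comm]
    exact hexp hβ hα q₃
  · rw [add_comm (-s / (2 * α))]
    exact hle h₃
  · have := ENNReal.ofReal_le_ofReal hsmall
    rw [ENNReal.ofReal_mul (by norm_num), ENNReal.ofReal_add (by positivity) (by positivity),
      ENNReal.ofReal_mul (by positivity), ENNReal.ofReal_mul (by norm_num),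
      ENNReal.ofReal_mul (by norm_num)] at this
    simpa using this

/-- Above the critical index the constant of the bilinear estimate is a positive power of `T`. -/
theorem exists_admissible_of_lt (ha : 0 ≤ a) (hσ : 1 ≤ σ) (hα : 1 / 2 ≤ α) (hβ : 1 / 2 ≤ β)
    (hs : s ∈ Icc (max (-1) (qIndex α β)) 0) (hq : qIndex α β < s) (hC : 0 < C₁) :
    ∃ T > (0 : ℝ), ∃ κ, Admissible a σ α β s T κ (ENNReal.ofReal C₁) := by
  obtain ⟨q₁, q₂, q₃⟩ := (qIndex_lt_iff hα).mp hq
  have hev : ∀ {x y : ℝ}, 1 / 2 ≤ x → 1 / 2 ≤ y → y * (1 - 2 * x) / x < s →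
      ∀ᶠ T in 𝓝[>] (0 : ℝ), T ^ (1 - (1 / (2 * x) + -s / (2 * y))) ≤ 1 / (384 * C₁) := by
    intro x y hx hy hxy
    have he : 0 < 1 - (1 / (2 * x) + -s / (2 * y)) := by
      rw [one_sub_exponent_eq s hx hy]
      exact div_pos (sub_pos.mpr hxy) (by linarith)
    have hc := (Real.continuousAt_rpow_const 0 _ (Or.inr he.le)).tendsto.mono_left
      (nhdsWithin_le_nhds (s := Ioi (0 : ℝ)))
    rw [Real.zero_rpow he.ne'] at hc
    exact hc.eventually_le_const (by positivity)
  have hT : ∀ᶠ T in 𝓝[>] (0 : ℝ), T ≤ 1 / 64 :=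
    (tendsto_id.mono_left nhdsWithin_le_nhds).eventually_le_const (by norm_num)
  obtain ⟨T, ⟨⟨⟨⟨h₁, h₂⟩, h₃⟩, h₄⟩, h₅⟩⟩ := ((((hev hα hα q₁).and (hev hα hβ q₂)).and
    (hev hβ hα q₃)).and hT).and self_mem_nhdsWithin |>.exists
  refine ⟨T, h₅, _, admissible_of_real ha hσ hα hβ hs h₅ hC.le (by positivity) h₁ h₂ h₃ ?_⟩
  -- `κ = 1 / (384 C₁)` leaves room for the buoyancy term `16 T ≤ 1 / 4`
  have e : 24 * (1 / (384 * C₁)) * C₁ = 1 / 16 := by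
    field_simp
    norm_num
  rw [e]
  linarith

/-- At the critical index the bilinear estimate holds with a constant that does not decay as
`T → 0`, and smallness comes from `C₁`. -/
theorem admissible_critical (ha : 0 ≤ a) (hσ : 1 ≤ σ) (hα : 1 / 2 ≤ α) (hβ : 1 / 2 ≤ β)
    (hs : s ∈ Icc (max (-1) (qIndex α β)) 0) :
    Admissible a σ α β s (1 / 64) (ENNReal.ofReal 1) (ENNReal.ofReal (1 / 384)) := by
  obtain ⟨q₁, q₂, q₃⟩ := (qIndex_le_iff hα).mp (max_le_iff.mp hs.1).2
  have hle : ∀ {x y : ℝ}, 1 / 2 ≤ x → 1 / 2 ≤ y → y * (1 - 2 * x) / x ≤ s →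
      (1 / 64 : ℝ) ^ (1 - (1 / (2 * x) + -s / (2 * y))) ≤ 1 := by
    intro x y hx hy hxy
    refine Real.rpow_le_one (by norm_num) (by norm_num) ?_
    rw [one_sub_exponent_eq s hx hy]
    exact div_nonneg (sub_nonneg.mpr hxy) (by linarith)
  exact admissible_of_real ha hσ hα hβ hs (by norm_num) (by norm_num) (by norm_num)
    (hle hα hα q₁) (hle hα hβ q₂) (hle hβ hα q₃) (by norm_num)

end Constants

theorem theorem1p1 (a σ α β s : ℝ) (ha : 0 ≤ a) (hσ : 1 ≤ σ) (hα : 1 / 2 ≤ α) (hβ : 1 / 2 ≤ β)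
    (hs : s ∈ Set.Icc (max (-1) (qIndex α β)) 0) :
    ∃ ε > (0 : ℝ), ∃ C₂ > (0 : ℝ), ∀ M : ℝ, (s = qIndex α β → M < ε) →
      ∃ T > (0 : ℝ), ∃ C₁ > (0 : ℝ),
        ∀ (u₀ : LeiLin C3 a σ s) (θ₀ : LeiLin ℂ a σ s),
          (∀ j, IsRealDistr (component j u₀.toDistr)) → IsRealDistr θ₀.toDistr →
          divergence u₀.toDistr = 0 → ‖u₀‖ + ‖θ₀‖ ≤ M →
          ∃ (u : C(Set.Icc (0 : ℝ) T, LeiLin C3 a σ s))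
            (θ : C(Set.Icc (0 : ℝ) T, LeiLin ℂ a σ s)),
            IsSolutionInClass a σ α β s u₀ θ₀ u θ ∧
            solutionNorm a σ α β s u θ < ENNReal.ofReal C₁ ∧
            (∀ (u' : C(Set.Icc (0 : ℝ) T, LeiLin C3 a σ s))
              (θ' : C(Set.Icc (0 : ℝ) T, LeiLin ℂ a σ s)),
              IsSolutionInClass a σ α β s u₀ θ₀ u' θ' →
              solutionNorm a σ α β s u' θ' < ENNReal.ofReal C₁ → u' = u ∧ θ' = θ) ∧
            solutionNorm a σ α β s u θ ≤ ENNReal.ofReal (C₂ * (‖u₀‖ + ‖θ₀‖)) ∧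
            ∀ p : ℝ, 1 ≤ p →
              MemLpLeiLin a σ (s + 2 * α / p) p (fun t => (u t).toDistr) ∧
              MemLpLeiLin a σ (s + 2 * β / p) p (fun t => (θ t).toDistr) := by
  -- the energy is at most `6 M`, which has to stay below `C₁`; at the critical index `C₁ = 1 / 384`
  refine ⟨1 / 2304, by norm_num, 6, by norm_num, fun M hM => ?_⟩
  obtain ⟨T, hT, C₁, hC, hMC, κ, A⟩ : ∃ T > (0 : ℝ), ∃ C₁ > (0 : ℝ), 6 * M < C₁ ∧
      ∃ κ, Admissible a σ α β s T κ (ENNReal.ofReal C₁) := by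
    rcases (max_le_iff.mp hs.1).2.eq_or_lt with hq | hq
    · exact ⟨1 / 64, by norm_num, 1 / 384, by norm_num, by linarith [hM hq.symm], _,
        admissible_critical ha hσ hα hβ hs⟩
    · have hC : 0 < 6 * |M| + 1 := by positivity
      obtain ⟨T, hT, κ, A⟩ := exists_admissible_of_lt ha hσ hα hβ hs hq hC
      exact ⟨T, hT, _, hC, by linarith [le_abs_self M], κ, A⟩
  refine ⟨T, hT, C₁, hC, fun u₀ θ₀ r₁ r₂ d₀ hd => ?_⟩
  have e : 6 * (ENNReal.ofReal ‖u₀‖ + ENNReal.ofReal ‖θ₀‖)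
      = ENNReal.ofReal (6 * (‖u₀‖ + ‖θ₀‖)) := by
    rw [ENNReal.ofReal_mul (by norm_num), ENNReal.ofReal_add (norm_nonneg _) (norm_nonneg _)]
    simp
  have hlt : ENNReal.ofReal (6 * (‖u₀‖ + ‖θ₀‖)) < ENNReal.ofReal C₁ :=
    (ENNReal.ofReal_lt_ofReal_iff hC).mpr (by linarith)
  obtain ⟨u, θ, h₁, h₂, h₃, h₄⟩ := A.exists_unique_solution u₀ θ₀ r₁ r₂ d₀ (e ▸ hlt.le)
  rw [e] at h₃
  exact ⟨u, θ, h₁, h₃.trans_lt hlt, fun u' θ' h h' => h₂ u' θ' h h'.le, h₃, h₄⟩
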